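/- **Setting.** Let $M$ be a real-analytic surface (Hausdorff, second countable), e.g. $M=\mathbb R^2$ or $M$ compact, and let $T^*M$ carry its canonical symplectic form $\sum d\xi_j\wedge dx_j$. Let $p:T^*M\to\mathbb R$ and $q:T^*M\to\mathbb C$ be real analytic, and let $H_p=p'_\xi\cdot\partial_x-p'_x\cdot\partial_\xi$. Assume that $\{|p|\le c\}$ is compact for some $c>0$ (ellipticity at infinity), that $p^{-1}(0)$ is connected, and that $dp\ne0$ on $p^{-1}(0)$. Fix $0\le K\in C_0^\infty(\mathbb R)$ with $\int K=1$ and set $$\langle f\rangle_{T,K}(\rho)=\int K_T(-t)\,f(\exp(tH_p)\rho)\,dt,\qquad K_T(t)=\tfrac1T K\big(\tfrac tT\big).$$ **Tori.** Let $\Lambda_1,\dots,\Lambda_L\subset p^{-1}(0)$ be pairwise disjoint, analytic, $H_p$-invariant Lagrangian tori. Suppose that $\Lambda_j$ carries real-analytic coordinates $x_1,x_2$ identifying it with $\mathbb T^2=\mathbb R^2/2\pi\mathbb Z^2$, in which $H_p=a_j\cdot\partial_x$ along $\Lambda_j$. Here $a_j\in\mathbb R^2$ is Diophantine: $|a_j\cdot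 k|\ge 1/(C_0|k|^{N_0})$ for $0\ne k\in\mathbb Z^2$, with some $C_0,N_0>0$. Suppose that the mean of $q$ over $\Lambda_j$ (with respect to $dx/(2\pi)^2$) has the same value $F$ for all $j$. **Normal forms.** A *canonical tube* around $\Lambda_j$ is a canonical transformation $\kappa$ from a neighbourhood of $\Lambda_j$ in $T^*M$ onto $\mathbb T^2\times\{|\xi|<R\}\subset T^*\mathbb T^2$, for some $R>0$, which maps $\Lambda_j$ to $\xi=0$ and restricts to the given coordinates on $\Lambda_j$. For functions $f$ on $T^*M$ put $\langle f\rangle(\xi)=(2\pi)^{-2}\int_{\mathbb T^2} (f\circ\kappa^{-1})(x,\xi)\,dx$. For each $j$ let $\kappa_{\infty,j}$ be a smooth canonical tube with $$p\circ\kappa_{\infty,j}^{-1}=p_{\infty,j}(\xi)+O(\xi^\infty),\qquad p_{\infty,j}(\xi)=a_j\cdot\xi+O(\xi^2),\quad p_{\infty,j}\text{ smooth},$$ chosen so small that in the tube the surface $p=0$ is a graph over $(x,\xi_1)$ ($\xi_2$ is determined by $x$ and $\xi_1$). Write $\langle q_j\rangle$ for the average of $q$ formed with $\kappa_{\infty,j}$.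 Assume that $dp_{\infty,j}(0)$ and $d\,\mathrm{Re}\,\langle q_j\rangle(0)$ are linearly independent for every $j$. **Global assumption (H0).** For $\delta>0$ let $\Lambda_\delta=p^{-1}(0)\cap\bigcup_j\{|\xi_1\circ\kappa_{\infty,j}|<\delta\}$. Let $\Omega_\pm(\delta)$ be the union of the connected components of $p^{-1}(0)\setminus\Lambda_\delta$ that meet $\{\xi_1\circ\kappa_{\infty,j}=\pm\delta\}$ for some $j$. Assume that there are integers $N_1,N_2\ge1$ and a sequence of $\delta>0$ tending to $0$ along which $$\langle \mathrm{Re}\,q\rangle_{\delta^{-N_1},K}-\mathrm{Re}\,F\ \ge\ \delta^{N_2}\ \text{ on }\Omega_+(\delta),\qquad \langle \mathrm{Re}\,q\rangle_{\delta^{-N_1},K}-\mathrm{Re}\,F\ \le\ -\delta^{N_2}\ \text{ on }\Omega_-(\delta),$$ where for $N_2=1$ the bounds $\pm\delta$ are replaced by $\pm\delta/C_1$ for some constant $C_1>0$. **Proposition.** For every sufficiently large $N$ the following holds. For each $j$ let $\kappa_{N,j}$ be a real-analytic canonical tube around $\Lambda_j$ with $p\circ\kappa_{N,j}^{-1}=p_{N,j}(\xi)+O(\xi^{N+1})$,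 where $p_{N,j}$ is analytic and $p_{N,j}(\xi)=a_j\cdot\xi+O(\xi^2)$. Let $G_j$ be a complex-valued analytic function near $\Lambda_j$ with $$H_pG_j=q-r_j,\qquad r_j\circ\kappa_{N,j}^{-1}(x,\xi)=\langle q\rangle(\xi)+O(|\xi|^N)\ \text{ uniformly in }x,$$ where $\langle q\rangle$ is formed with $\kappa_{N,j}$. Then there is $r_0>0$ such that for every $r\in(0,r_0]$ there is $\delta_1>0$ such that for every $\delta_0\in(0,\delta_1]$, with $$W_j=\kappa_{N,j}^{-1}\big(\{(x,\xi):|\xi|<r,\ |\xi_1|<\delta_0\}\big),\qquad W=\bigcup_jW_j,$$ there is $\widetilde G\in C_0^\infty(T^*M;\mathbb C)$ with $\widetilde G=G_j$ in $W_j$ for all $j$, and there are $C(W)>0$ and $\eta_0>0$ with the following property. For $0<\eta\le\eta_0$ let $\widetilde\Omega_\pm$ be the union of the connected components of $p^{-1}((-\eta,\eta))\setminus W$ that meet $\Omega_\pm(\delta_0)$. Then $$\mathrm{Re}\,(q-H_p\widetilde G-F)\ge \frac1{C(W)}\ \text{ on }\widetilde\Omega_+,\qquad \mathrm{Re}\,(q-H_p\widetilde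 G-F)\le-\frac1{C(W)}\ \text{ on }\widetilde\Omega_-.$$ -/

import Mathlib

open scoped Manifold ContDiff Topology

namespace GlobalWeight

noncomputable section

/-- The Euclidean plane: the model space of the surface `M`, the universal cover of the torus
`𝕋² = ℝ² / 2πℤ²`, and the fibre of `T^*𝕋² = 𝕋² × ℝ²`. -/
abbrev Plane : Type := EuclideanSpace ℝ (Fin 2)

/-- The model vector space of `T^*M`: canonical coordinates `(x, ξ)`, with `ξ` a covector. -/
abbrev PhaseModel : Type := Plane × (Plane →L[ℝ] ℝ)

/-- The model with corners of the manifold `T^*M`. -/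
abbrev phaseModel :
    ModelWithCorners ℝ PhaseModel (ModelProd Plane (Plane →L[ℝ] ℝ)) :=
  (𝓘(ℝ, Plane)).prod 𝓘(ℝ, Plane →L[ℝ] ℝ)

/-- The cotangent bundle `T^*M`, with the topology and charts of Mathlib's bundle of continuous
linear maps from the tangent bundle to the trivial line bundle. The preferred chart at a covector
over `x₀` is the system of canonical coordinates `(x, ξ)` of `T^*M` that is induced by the
preferred chart of `M` at `x₀`. -/
abbrev Cotangent (M : Type*) [TopologicalSpace M] [ChartedSpace Plane M] : Type _ :=
  Bundle.TotalSpace (Plane →L[ℝ] ℝ)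
    (fun x : M => TangentSpace 𝓘(ℝ, Plane) x →L[ℝ] Bundle.Trivial M ℝ x)

section Symplectic

variable {M : Type*} [TopologicalSpace M] [ChartedSpace Plane M] [IsManifold 𝓘(ℝ, Plane) ω M]

/-- The canonical symplectic form `∑ dξ_j ∧ dx_j` of `T^*M` at `m`. A tangent vector at `m` is
represented by its components `(v_x, v_ξ)` in the preferred chart at `m`, that is, in canonical
coordinates. -/
def symplecticForm (m : Cotangent M) (v w : TangentSpace phaseModel m) : ℝ :=
  let v' : PhaseModel := v
  let w' : PhaseModel := w
  v'.2 w'.1 - w'.2 v'.1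

/-- The differential of `p` at `m` in the canonical coordinates of the preferred chart at `m`. -/
def differential (p : Cotangent M → ℝ) (m : Cotangent M) : PhaseModel →L[ℝ] ℝ :=
  mfderiv phaseModel 𝓘(ℝ, ℝ) p m

/-- The Hamilton field `H_p = p'_ξ · ∂_x - p'_x · ∂_ξ`. -/
def hamiltonField (p : Cotangent M → ℝ) (m : Cotangent M) : TangentSpace phaseModel m :=
  ((∑ i : Fin 2, differential p m (0, EuclideanSpace.proj i) • EuclideanSpace.single i (1 : ℝ),
    -(differential p m).comp (ContinuousLinearMap.inl ℝ Plane (Plane →L[ℝ] ℝ))) : PhaseModel)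

/-- The derivative `H_p G` of a complex-valued function `G` along the Hamilton field of `p`. -/
def hamiltonDeriv (p : Cotangent M → ℝ) (G : Cotangent M → ℂ) (m : Cotangent M) : ℂ :=
  (mfderiv phaseModel 𝓘(ℝ, ℂ) G m : PhaseModel →L[ℝ] ℂ) (hamiltonField p m)

open Classical in
/-- The Hamilton flow `exp(t H_p)(ρ)`: the value at time `t` of the integral curve of `H_p` that
starts at `ρ`. (Where no integral curve exists for all times, the value is `ρ`; this does not occur
on a compact regular level set of `p`.) -/
def hamiltonFlow (p : Cotangent M → ℝ) (t : ℝ) (ρ : Cotangent M) : Cotangent M :=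
  if h : ∃ c : ℝ → Cotangent M, c 0 = ρ ∧ IsMIntegralCurve (I := phaseModel) c (hamiltonField p)
  then h.choose t else ρ

/-- The smoothed flow average
`⟨f⟩_{T,K}(ρ) = ∫ K_T(-t) f(exp(t H_p)(ρ)) dt`, with `K_T(t) = T⁻¹ K(t / T)`. -/
def flowAverage (p : Cotangent M → ℝ) (K : ℝ → ℝ) (T : ℝ) (f : Cotangent M → ℝ)
    (ρ : Cotangent M) : ℝ :=
  ∫ t : ℝ, (T⁻¹ * K (-t / T)) * f (hamiltonFlow p t ρ)

end Symplectic

/-- `x` and `y` represent the same point of `𝕋² = ℝ² / 2πℤ²`. -/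
def SameTorusPoint (x y : Plane) : Prop :=
  ∃ k : Fin 2 → ℤ, ∀ i, x i - y i = 2 * Real.pi * (k i : ℝ)

/-- The mean value over `𝕋²` of a `2πℤ²`-periodic function. -/
def torusMean (f : Plane → ℂ) : ℂ :=
  ((2 * Real.pi) ^ 2 : ℝ)⁻¹ •
    ∫ s in (0 : ℝ)..(2 * Real.pi), ∫ t in (0 : ℝ)..(2 * Real.pi), f !₂[s, t]

/-- The Diophantine condition `|a · k| ≥ 1 / (C₀ |k|^{N₀})` for `0 ≠ k ∈ ℤ²`. -/
def Diophantine (a : Plane) : Prop :=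
  ∃ C₀ : ℝ, 0 < C₀ ∧ ∃ N₀ : ℝ, 0 < N₀ ∧ ∀ k : Fin 2 → ℤ, k ≠ 0 →
    1 / (C₀ * ‖(!₂[(k 0 : ℝ), (k 1 : ℝ)] : Plane)‖ ^ N₀) ≤ |a 0 * (k 0 : ℝ) + a 1 * (k 1 : ℝ)|

/-- The average `⟨f⟩(ξ) = (2π)⁻² ∫ f(x, ξ) dx`, where `f` on `T^*M` is read through
`Ψ : (x, ξ) ↦ κ⁻¹(x, ξ)`. -/
def torusAverage {X : Type*} (f : X → ℂ) (Ψ : Plane × Plane → X) (ξ : Plane) : ℂ :=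
  torusMean (fun x => f (Ψ (x, ξ)))

section Tori

variable {M : Type*} [TopologicalSpace M] [ChartedSpace Plane M] [IsManifold 𝓘(ℝ, Plane) ω M]

/-- `γ` is the (`2πℤ²`-periodic) parametrization, by real analytic coordinates `x₁, x₂`, of an
analytic `H_p`-invariant Lagrangian torus in `p⁻¹(0)` along which `H_p = a₁ ∂_{x₁} + a₂ ∂_{x₂}`. -/
structure IsInvariantTorus (p : Cotangent M → ℝ) (a : Plane) (γ : Plane → Cotangent M) :
    Prop where
  analytic : ContMDiff 𝓘(ℝ, Plane) phaseModel ω γ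
  eq_iff : ∀ x y, γ x = γ y ↔ SameTorusPoint x y
  immersion : ∀ x, Function.Injective (mfderiv 𝓘(ℝ, Plane) phaseModel γ x)
  lagrangian : ∀ x, ∀ v w : TangentSpace 𝓘(ℝ, Plane) x,
    symplecticForm (γ x) (mfderiv 𝓘(ℝ, Plane) phaseModel γ x v)
      (mfderiv 𝓘(ℝ, Plane) phaseModel γ x w) = 0
  energy : ∀ x, p (γ x) = 0
  invariant : ∀ x, mfderiv 𝓘(ℝ, Plane) phaseModel γ x a = hamiltonField p (γ x)

/-- `Ψ = κ⁻¹` for a canonical transformation `κ`, of class `C^n`, from a neighbourhood of the torus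
`Λ = γ(ℝ²)` in `T^*M` onto `{|ξ| < R}` in `T^*𝕋²`, which maps `Λ` to the zero section and extends
the coordinates `x₁, x₂` given on `Λ`. It is written as a map of `(x, ξ)` that is
`2πℤ²`-periodic in `x`; only its values at `|ξ| < R` are relevant. -/
structure IsCanonicalTube (n : WithTop ℕ∞) (γ : Plane → Cotangent M) (R : ℝ)
    (Ψ : Plane × Plane → Cotangent M) : Prop where
  radius_pos : 0 < R
  smooth : ContMDiffOn 𝓘(ℝ, Plane × Plane) phaseModel n Ψ {z | ‖z.2‖ < R}
  eq_iff : ∀ z w : Plane × Plane, ‖z.2‖ < R → ‖w.2‖ < R →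
    (Ψ z = Ψ w ↔ SameTorusPoint z.1 w.1 ∧ z.2 = w.2)
  symplectic : ∀ z : Plane × Plane, ‖z.2‖ < R → ∀ v w : Plane × Plane,
    symplecticForm (Ψ z) (mfderiv 𝓘(ℝ, Plane × Plane) phaseModel Ψ z v)
      (mfderiv 𝓘(ℝ, Plane × Plane) phaseModel Ψ z w) = inner ℝ v.2 w.1 - inner ℝ w.2 v.1
  zero_section : ∀ x, Ψ (x, 0) = γ x

/-- `p ∘ κ⁻¹ = p_N(ξ) + O(|ξ|^{N+1})` and `p_N(ξ) = a · ξ + O(|ξ|²)` as `ξ → 0`, where `p_N` is of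
class `C^n` and does not depend on `x`. -/
structure IsNormalForm (n : WithTop ℕ∞) (p : Cotangent M → ℝ) (a : Plane) (R : ℝ)
    (Ψ : Plane × Plane → Cotangent M) (pN : Plane → ℝ) (N : ℕ) : Prop where
  smooth : ContDiffOn ℝ n pN {ξ | ‖ξ‖ < R}
  linear_part : ∃ C : ℝ, ∃ r : ℝ, 0 < r ∧ ∀ ξ : Plane, ‖ξ‖ < r →
    |pN ξ - inner ℝ a ξ| ≤ C * ‖ξ‖ ^ 2
  remainder : ∃ C : ℝ, ∃ r : ℝ, 0 < r ∧ ∀ x ξ : Plane, ‖ξ‖ < r →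
    |p (Ψ (x, ξ)) - pN ξ| ≤ C * ‖ξ‖ ^ (N + 1)

/-- In the tube `{|ξ| < R}` the energy surface `p = 0` is a graph over `(x, ξ₁)`: the coordinate
`ξ₂` of a point of the surface is determined by `x` and `ξ₁`. -/
def IsEnergyGraph (p : Cotangent M → ℝ) (R : ℝ) (Ψ : Plane × Plane → Cotangent M) : Prop :=
  ∀ x ξ η : Plane, ‖ξ‖ < R → ‖η‖ < R → p (Ψ (x, ξ)) = 0 → p (Ψ (x, η)) = 0 → ξ 0 = η 0 → ξ = η

/-- `G` is an analytic solution, in a neighbourhood `V` of the torus `Ψ(·, 0)`, of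
`H_p G = q - r`, where `r = ⟨q⟩(ξ) + O(|ξ|^N)`. -/
def IsLocalSolution (p : Cotangent M → ℝ) (q : Cotangent M → ℂ)
    (Ψ : Plane × Plane → Cotangent M) (N : ℕ) (G : Cotangent M → ℂ) : Prop :=
  ∃ V : Set (Cotangent M), IsOpen V ∧ (∀ x, Ψ (x, 0) ∈ V) ∧
    ContMDiffOn phaseModel 𝓘(ℝ, ℂ) ω G V ∧
    ∃ r : Cotangent M → ℂ, (∀ m ∈ V, hamiltonDeriv p G m = q m - r m) ∧
      ∃ C : ℝ, ∃ R' : ℝ, 0 < R' ∧ ∀ x ξ : Plane, ‖ξ‖ < R' →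
        ‖r (Ψ (x, ξ)) - torusAverage q Ψ ξ‖ ≤ C * ‖ξ‖ ^ N

variable {L : ℕ}

/-- `Λ_δ`: the part of the energy surface where `|ξ₁| < δ` in one of the tubes. -/
def collar (p : Cotangent M → ℝ) (R : Fin L → ℝ) (Ψ : Fin L → Plane × Plane → Cotangent M)
    (δ : ℝ) : Set (Cotangent M) :=
  {ρ | p ρ = 0 ∧ ∃ j, ∃ x ξ : Plane, ‖ξ‖ < R j ∧ |ξ 0| < δ ∧ Ψ j (x, ξ) = ρ}

/-- `Ω_+(δ)` (for `s = 1`) and `Ω_-(δ)` (for `s = -1`): the union of the connected components of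
`p⁻¹(0) \ Λ_δ` that meet, in one of the tubes, the face `ξ₁ = s δ` of `Λ_δ`. -/
def omegaPart (p : Cotangent M → ℝ) (R : Fin L → ℝ) (Ψ : Fin L → Plane × Plane → Cotangent M)
    (s δ : ℝ) : Set (Cotangent M) :=
  {ρ | ∃ j, ∃ x ξ : Plane, ‖ξ‖ < R j ∧ ξ 0 = s * δ ∧
    Ψ j (x, ξ) ∈ {m | p m = 0} \ collar p R Ψ δ ∧
    ρ ∈ connectedComponentIn ({m | p m = 0} \ collar p R Ψ δ) (Ψ j (x, ξ))}

/-- The global dynamical assumption: for some `N₁, N₂ ≥ 1` and a sequence `δ → 0`,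
`⟨Re q⟩_{δ^{-N₁},K} - Re F` is at least `δ^{N₂}` on `Ω_+(δ)` and at most `-δ^{N₂}` on `Ω_-(δ)`;
when `N₂ = 1`, the bounds `±δ` are replaced by `±c δ` for some `c > 0`. -/
def GlobalAssumption (p : Cotangent M → ℝ) (q : Cotangent M → ℂ) (F : ℂ) (K : ℝ → ℝ)
    (R : Fin L → ℝ) (Ψ : Fin L → Plane × Plane → Cotangent M) : Prop :=
  ∃ N₁ N₂ : ℕ, 1 ≤ N₁ ∧ 1 ≤ N₂ ∧ ∃ c : ℝ, 0 < c ∧ (N₂ ≠ 1 → c = 1) ∧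
    ∃ δ : ℕ → ℝ, (∀ n, 0 < δ n) ∧ Filter.Tendsto δ Filter.atTop (𝓝 0) ∧ ∀ n,
      (∀ ρ ∈ omegaPart p R Ψ 1 (δ n),
        c * δ n ^ N₂ ≤ flowAverage p K ((δ n)⁻¹ ^ N₁) (fun m => (q m).re) ρ - F.re) ∧
      (∀ ρ ∈ omegaPart p R Ψ (-1) (δ n),
        flowAverage p K ((δ n)⁻¹ ^ N₁) (fun m => (q m).re) ρ - F.re ≤ -(c * δ n ^ N₂))

/-- The neighbourhood `{|ξ₁| < δ₀}` of a torus, in the tube `{|ξ| < r}`. -/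
def torusNhd (Ψ : Plane × Plane → Cotangent M) (r δ₀ : ℝ) : Set (Cotangent M) :=
  {ρ | ∃ x ξ : Plane, ‖ξ‖ < r ∧ |ξ 0| < δ₀ ∧ Ψ (x, ξ) = ρ}

/-- `Ω̃_±`: the union of the connected components of `p⁻¹((-η, η)) \ W` that meet `Ω`. -/
def thickened (p : Cotangent M → ℝ) (W Ω : Set (Cotangent M)) (η : ℝ) : Set (Cotangent M) :=
  {ρ | ∃ ρ' ∈ Ω, ρ' ∈ {m | |p m| < η} \ W ∧
    ρ ∈ connectedComponentIn ({m | |p m| < η} \ W) ρ'}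

end Tori

end

end GlobalWeight

namespace GlobalWeight
noncomputable section

/-! ### Topology of the cotangent bundle -/

section Topology

variable {M : Type*} [TopologicalSpace M] [ChartedSpace Plane M] [IsManifold 𝓘(ℝ, Plane) ω M]

/-! Put u = Re q. The heart of the matter is a smooth real G₀ for which u − Re F − H_p G₀ has no
zeros on p = 0 apart from the tori. It is interpolated from two partial solutions.

Away from the tori one uses the flow average. A weighted time integral of u along the flow gives G
with H_p G = u − ⟨u⟩_{T,K} on p = 0 and |G| = O(T) (`exists_average_primitive`). With T = δ^{-N₁},
assumption (H0) makes u − Re F − H_p G at least of size δ^{N₂}, with the right sign, on Ω_±(δ).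

Near a torus one uses g = Re G_j. Let y be the coordinate ξ₁ of the smooth tube. On p = 0, u − H_p g
= Re F + c y + O(y²) with c ≠ 0 (`exists_collarChart`). The equation for G_j is stated in another
tube, but two tubes extending the same coordinates have the same fibre directions at the torus
modulus tangent vectors, and u − H_p g is constant on the torus. Its first order expansion therefore
carries over. Averaging in x removes H_p g to second order, so the linear part is d Re⟨q_j⟩(0)
(`exists_solution_expansion`). On the energy surface a·ξ = O(ξ²) eliminates ξ₂, and linear
independence says that the remaining coefficient c is not zero.

The two pieces fit together because H_p y = O(y^∞), while all losses are powers of δ. First, c > 0: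
for c < 0 the function g − G, of size δ^{-N₁}, would grow along the flow at rate at least of order δ
throughout the shell δ ≤ y ≤ 2δ, which near-invariance of y forbids by a maximum argument
(`IsCollarChart.exists_deriv_le`, `IsCollarChart.exists_slope_nonneg`). Second, in G + χ(y/δ)(g − G)
the derivative of the cutoff contributes only O(δ^{N₂+1}), and what is left is a convex combination
of two functions with the sign of y (`IsCollarChart.exists_transition`).

Since p⁻¹(0) is connected, each component of the complement of the collar reaches a face y = ±δ.
Hence Ω_+ and Ω_- together exhaust that complement (`mem_omegaPart_or`), and G₀ has the desired
property (`exists_global_weight`). One δ of the sequence is fixed for this. For every smaller δ₀ the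
zero-free function then has constant sign on components, read off on the faces y = ±δ₀, and
compactness gives a lower bound on a thin energy shell outside W. The complex G_j are finally glued
in by cutoffs that leave the real part unchanged near p = 0 (`exists_compact_weight`).

Smoothness of G rests on the smooth dependence of flows on time and initial point, obtained from the
implicit function theorem in a space of paths. -/

instance : FiniteDimensional ℝ (Plane →L[ℝ] ℝ) := inferInstance

instance : ProperSpace (Plane →L[ℝ] ℝ) := FiniteDimensional.proper ℝ _

instance : LocallyCompactSpace (ModelProd Plane (Plane →L[ℝ] ℝ)) :=
  inferInstanceAs (LocallyCompactSpace (Plane × (Plane →L[ℝ] ℝ)))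

instance : T2Space (ModelProd Plane (Plane →L[ℝ] ℝ)) :=
  inferInstanceAs (T2Space (Plane × (Plane →L[ℝ] ℝ)))

instance : SecondCountableTopology (ModelProd Plane (Plane →L[ℝ] ℝ)) :=
  inferInstanceAs (SecondCountableTopology (Plane × (Plane →L[ℝ] ℝ)))

instance cotangent_locallyCompactSpace : LocallyCompactSpace (Cotangent M) :=
  ChartedSpace.locallyCompactSpace (ModelProd Plane (Plane →L[ℝ] ℝ)) (Cotangent M)

theorem mem_cotangent_chart_source_iff {a b : Cotangent M} :
    b ∈ (chartAt (ModelProd Plane (Plane →L[ℝ] ℝ)) a).source ↔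
      b.proj ∈ (chartAt Plane a.proj).source := by
  simp only [FiberBundle.chartedSpace_chartAt, mfld_simps]
  rw [hom_trivializationAt_apply]
  simp only [Bundle.Trivial.fiberBundle_trivializationAt', Bundle.Trivial.trivialization_baseSet,
    Set.mem_univ, and_true, and_self]

theorem continuous_cotangent_proj :
    Continuous (Bundle.TotalSpace.proj : Cotangent M → M) := FiberBundle.continuous_proj _ _

/-- Covectors over one base point lie in a common chart, which is Hausdorff; otherwise preimages of
neighbourhoods in M separate them. -/
instance cotangent_t2Space [T2Space M] : T2Space (Cotangent M) := by
  refine ⟨fun a b hab => ?_⟩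
  by_cases h : a.proj = b.proj
  · let e := chartAt (ModelProd Plane (Plane →L[ℝ] ℝ)) a
    have ha : a ∈ e.source := mem_chart_source _ a
    have hb : b ∈ e.source := by
      rw [mem_cotangent_chart_source_iff, ← h]
      exact mem_chart_source _ _
    obtain ⟨u, v, hu, hv, hau, hbv, huv⟩ :=
      t2_separation (fun h' : e a = e b => hab (e.injOn ha hb h'))
    refine ⟨e.source ∩ e ⁻¹' u, e.source ∩ e ⁻¹' v, e.isOpen_inter_preimage hu,
      e.isOpen_inter_preimage hv, ⟨ha, hau⟩, ⟨hb, hbv⟩, ?_⟩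
    exact Set.disjoint_left.2 fun x hx hx' => Set.disjoint_left.1 huv hx.2 hx'.2
  · obtain ⟨u, v, hu, hv, hau, hbv, huv⟩ := t2_separation h
    exact ⟨_, _, hu.preimage continuous_cotangent_proj, hv.preimage continuous_cotangent_proj,
      hau, hbv, huv.preimage _⟩

instance cotangent_secondCountableTopology [SecondCountableTopology M] :
    SecondCountableTopology (Cotangent M) := by
  obtain ⟨s, hs, hsU⟩ := TopologicalSpace.countable_cover_nhds
    (fun x : M => chart_source_mem_nhds Plane x)
  -- The domain of a bundle chart depends only on the base point, so charts at zero covectors over a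
  -- countable set of base points suffice.
  let z : M → Cotangent M := fun x => ⟨x, 0⟩
  refine ChartedSpace.secondCountable_of_countable_cover (s := z '' s)
    (ModelProd Plane (Plane →L[ℝ] ℝ)) ?_ (hs.image z)
  refine Set.eq_univ_of_forall fun m => ?_
  have hm : m.proj ∈ ⋃ x ∈ s, (chartAt Plane x).source := hsU ▸ Set.mem_univ _
  simp only [Set.mem_iUnion] at hm ⊢
  obtain ⟨x, hx, hxm⟩ := hm
  exact ⟨z x, ⟨x, hx, rfl⟩, mem_cotangent_chart_source_iff.2 hxm⟩

instance : FiniteDimensional ℝ PhaseModel := inferInstance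

end Topology

/-! ### Linear symplectic algebra -/

section Linear

/-- The canonical symplectic form on the model space. -/
def stdForm (v w : PhaseModel) : ℝ := v.2 w.1 - w.2 v.1

/-- The isomorphism from covectors to vectors given by the canonical symplectic form. -/
def stdGrad : (PhaseModel →L[ℝ] ℝ) →L[ℝ] PhaseModel :=
  ContinuousLinearMap.prod
    (∑ i : Fin 2, (ContinuousLinearMap.apply ℝ ℝ
      ((0, EuclideanSpace.proj i) : PhaseModel)).smulRight (EuclideanSpace.single i (1 : ℝ)))
    (-(ContinuousLinearMap.compL ℝ Plane PhaseModel ℝ).flip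
      (ContinuousLinearMap.inl ℝ Plane (Plane →L[ℝ] ℝ)))

theorem stdGrad_apply (l : PhaseModel →L[ℝ] ℝ) :
    stdGrad l = (∑ i : Fin 2, l (0, EuclideanSpace.proj i) • EuclideanSpace.single i (1 : ℝ),
      -l.comp (ContinuousLinearMap.inl ℝ Plane (Plane →L[ℝ] ℝ))) := by
  apply Prod.ext
  · simp [stdGrad]
  · rfl

theorem covector_eq_sum (w : Plane →L[ℝ] ℝ) :
    w = ∑ i : Fin 2, w (EuclideanSpace.single i 1) • (EuclideanSpace.proj i : Plane →L[ℝ] ℝ) := by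
  ext x
  have hx : x = ∑ i : Fin 2, x i • EuclideanSpace.single i (1 : ℝ) := by
    ext j; fin_cases j <;> simp [Fin.sum_univ_two]
  conv_lhs => rw [hx]
  simp [Fin.sum_univ_two, mul_comm]

theorem stdForm_stdGrad (l : PhaseModel →L[ℝ] ℝ) (w : PhaseModel) :
    stdForm w (stdGrad l) = l w := by
  have h1 : l w = l (w.1, 0) + l (0, w.2) := by rw [← map_add]; simp
  have h2 : ((0, w.2) : PhaseModel) = ∑ i : Fin 2, w.2 (EuclideanSpace.single i 1) •
      ((0, EuclideanSpace.proj i) : PhaseModel) := by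
    conv_lhs => rw [covector_eq_sum w.2]
    simp [Fin.sum_univ_two]
  rw [h1, h2, stdGrad_apply]
  simp only [stdForm, Fin.sum_univ_two, map_add, map_smul, smul_eq_mul]
  simp
  ring

theorem eq_of_stdForm_eq {v v' : PhaseModel} (h : ∀ w, stdForm w v = stdForm w v') : v = v' := by
  apply Prod.ext
  · ext i
    simpa [stdForm] using h (0, EuclideanSpace.proj i)
  · ext x
    simpa [stdForm] using h (x, 0)

end Linear

/-! ### Canonical coordinates and their changes -/

section Charts

variable {M : Type*} [TopologicalSpace M] [ChartedSpace Plane M] [IsManifold 𝓘(ℝ, Plane) ω M]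

/-- The covector part of a point of the cotangent bundle, in the preferred chart of its base
point. -/
def covectorPart (m : Cotangent M) : Plane →L[ℝ] ℝ := m.2

/-- Covectors transform contragrediently: the coordinate change goes from the chart at `a` to the
one in which `m` is stored. -/
theorem cotangent_extChartAt_apply (a m : Cotangent M)
    (h : m.proj ∈ (chartAt Plane a.proj).source) :
    extChartAt phaseModel a m = (extChartAt 𝓘(ℝ, Plane) a.proj m.proj,
      (covectorPart m).comp (tangentCoordChange 𝓘(ℝ, Plane) a.proj m.proj m.proj)) := by
  have h1 : extChartAt phaseModel a m = chartAt (ModelProd Plane (Plane →L[ℝ] ℝ)) a m := by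
    simp only [mfld_simps]
  rw [h1, hom_chart]
  refine Prod.ext ?_ ?_
  · simp only [mfld_simps]
  · show ContinuousLinearMap.inCoordinates _ _ _ _ _ _ _ _ _ = _
    ext x
    have h2 : Bundle.Trivialization.continuousLinearMapAt ℝ
        (trivializationAt ℝ (Bundle.Trivial M ℝ) a.proj) m.proj = ContinuousLinearMap.id ℝ ℝ :=
      Bundle.Trivial.continuousLinearMapAt_trivialization ..
    simp only [ContinuousLinearMap.inCoordinates]
    rw [h2, TangentBundle.symmL_trivializationAt_eq_core h]
    rfl

theorem mem_cotangent_extChartAt_source_iff {a b : Cotangent M} :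
    b ∈ (extChartAt phaseModel a).source ↔ b.proj ∈ (chartAt Plane a.proj).source := by
  rw [extChartAt_source, mem_cotangent_chart_source_iff]

/-- A change of charts of the bundle is the cotangent lift (x, ξ) ↦ (τ(x), ξ ∘ Dσ(τ(x))) of the
change τ of base charts, with σ inverse to τ. This explicit form is what can be differentiated. -/
theorem cotangent_chart_transition (a b : Cotangent M) {z : PhaseModel}
    (hz : z ∈ (extChartAt phaseModel a).target)
    (hb : (extChartAt phaseModel a).symm z ∈ (extChartAt phaseModel b).source) :
    (extChartAt phaseModel b ∘ (extChartAt phaseModel a).symm) z =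
      ((extChartAt 𝓘(ℝ, Plane) b.proj ∘ (extChartAt 𝓘(ℝ, Plane) a.proj).symm) z.1,
        z.2.comp (fderiv ℝ (extChartAt 𝓘(ℝ, Plane) a.proj ∘ (extChartAt 𝓘(ℝ, Plane) b.proj).symm)
          ((extChartAt 𝓘(ℝ, Plane) b.proj ∘ (extChartAt 𝓘(ℝ, Plane) a.proj).symm) z.1))) := by
  set m := (extChartAt phaseModel a).symm z with hm
  have hma : m ∈ (extChartAt phaseModel a).source := (extChartAt phaseModel a).map_target hz
  have hz' : z = extChartAt phaseModel a m := ((extChartAt phaseModel a).right_inv hz).symm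
  have ha' := mem_cotangent_extChartAt_source_iff.1 hma
  have hb' := mem_cotangent_extChartAt_source_iff.1 hb
  rw [cotangent_extChartAt_apply a m ha'] at hz'
  have h1 : (extChartAt 𝓘(ℝ, Plane) a.proj).symm z.1 = m.proj := by
    rw [hz']
    exact (extChartAt 𝓘(ℝ, Plane) a.proj).left_inv (by rwa [extChartAt_source])
  simp only [Function.comp_apply, h1]
  rw [← hm, cotangent_extChartAt_apply b m hb']
  refine Prod.ext rfl ?_
  show _ = ContinuousLinearMap.comp z.2 _
  rw [hz']
  ext x
  dsimp only
  simp only [ContinuousLinearMap.comp_apply]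
  congr 1
  rw [← fderivWithin_univ]
  have := tangentCoordChange_comp (I := 𝓘(ℝ, Plane)) (w := b.proj) (x := a.proj) (y := m.proj)
    (z := m.proj) (v := x) (by
      simp only [extChartAt_source]; exact ⟨⟨hb', ha'⟩, mem_chart_source _ _⟩)
  rw [← this, tangentCoordChange_def (x := b.proj) (y := a.proj)]
  simp

/-- The coordinate changes of the cotangent bundle are canonical transformations. -/
theorem stdForm_tangentCoordChange (a b : Cotangent M) {m : Cotangent M}
    (ha : m ∈ (extChartAt phaseModel a).source) (hb : m ∈ (extChartAt phaseModel b).source)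
    (v w : PhaseModel) :
    stdForm (tangentCoordChange phaseModel a b m v) (tangentCoordChange phaseModel a b m w) =
      stdForm v w := by
  have ha' := mem_cotangent_extChartAt_source_iff.1 ha
  have hb' := mem_cotangent_extChartAt_source_iff.1 hb
  set τ : Plane → Plane := extChartAt 𝓘(ℝ, Plane) b.proj ∘ (extChartAt 𝓘(ℝ, Plane) a.proj).symm
    with hτ
  set σ : Plane → Plane := extChartAt 𝓘(ℝ, Plane) a.proj ∘ (extChartAt 𝓘(ℝ, Plane) b.proj).symm
    with hσ
  set z := extChartAt phaseModel a m with hz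
  have hz1 : z.1 = extChartAt 𝓘(ℝ, Plane) a.proj m.proj := by
    rw [hz, cotangent_extChartAt_apply a m ha']
  have hτz : τ z.1 = extChartAt 𝓘(ℝ, Plane) b.proj m.proj := by
    rw [hτ, Function.comp_apply, hz1, (extChartAt 𝓘(ℝ, Plane) a.proj).left_inv
      (by rwa [extChartAt_source])]
  have smooth : ∀ c d : Cotangent M, m.proj ∈ (chartAt Plane c.proj).source →
      m.proj ∈ (chartAt Plane d.proj).source →
      ContDiffAt ℝ ω (extChartAt 𝓘(ℝ, Plane) d.proj ∘ (extChartAt 𝓘(ℝ, Plane) c.proj).symm)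
        (extChartAt 𝓘(ℝ, Plane) c.proj m.proj) := by
    intro c d hc hd
    have := contDiffWithinAt_ext_coord_change (I := 𝓘(ℝ, Plane)) (n := ω) d.proj c.proj
      (y := extChartAt 𝓘(ℝ, Plane) c.proj m.proj) (by
        rw [PartialEquiv.trans_source'', PartialEquiv.symm_symm, PartialEquiv.symm_target]
        exact Set.mem_image_of_mem _ (by simp only [extChartAt_source]; exact ⟨hc, hd⟩))
    simpa [contDiffWithinAt_univ] using this
  have hτs : ContDiffAt ℝ ω τ z.1 := by rw [hz1]; exact smooth a b ha' hb'
  have hσs : ContDiffAt ℝ ω σ (τ z.1) := by rw [hτz]; exact smooth b a hb' ha'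
  have hA : DifferentiableAt ℝ (fderiv ℝ σ) (τ z.1) :=
    (hσs.fderiv_right (m := 1) (by simp)).differentiableAt (by simp)
  have hστ : (fderiv ℝ σ (τ z.1)).comp (fderiv ℝ τ z.1) = ContinuousLinearMap.id ℝ Plane := by
    rw [← fderiv_comp _ (hσs.differentiableAt (by simp)) (hτs.differentiableAt (by simp))]
    have : σ ∘ τ =ᶠ[𝓝 z.1] id := by
      have h1 : (extChartAt 𝓘(ℝ, Plane) a.proj).target ∈ 𝓝 z.1 := by
        rw [hz1]; exact extChartAt_target_mem_nhds' ((extChartAt 𝓘(ℝ, Plane) a.proj).map_source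
          (by rwa [extChartAt_source]))
      have h2 : (extChartAt 𝓘(ℝ, Plane) a.proj).symm ⁻¹' (extChartAt 𝓘(ℝ, Plane) b.proj).source
          ∈ 𝓝 z.1 := by
        rw [hz1]
        refine (continuousAt_extChartAt_symm' (by rwa [extChartAt_source])).preimage_mem_nhds ?_
        rw [(extChartAt 𝓘(ℝ, Plane) a.proj).left_inv (by rwa [extChartAt_source])]
        exact extChartAt_source_mem_nhds' (by rwa [extChartAt_source])
      filter_upwards [h1, h2] with y hy1 hy2
      simp only [hσ, hτ, Function.comp_apply, id]
      rw [(extChartAt 𝓘(ℝ, Plane) b.proj).left_inv hy2,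
        (extChartAt 𝓘(ℝ, Plane) a.proj).right_inv hy1]
    rw [this.fderiv_eq, fderiv_id]
  have hS : HasFDerivAt (extChartAt phaseModel b ∘ (extChartAt phaseModel a).symm)
      (tangentCoordChange phaseModel a b m) z := by
    have := hasFDerivWithinAt_tangentCoordChange (I := phaseModel) (x := a) (y := b) (z := m)
      ⟨ha, hb⟩
    rw [ModelWithCorners.range_eq_univ, hasFDerivWithinAt_univ] at this
    exact this
  have hev : (fun y : PhaseModel => (τ y.1, y.2.comp (fderiv ℝ σ (τ y.1)))) =ᶠ[𝓝 z]
      (extChartAt phaseModel b ∘ (extChartAt phaseModel a).symm) := by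
    have h1 : (extChartAt phaseModel a).target ∈ 𝓝 z :=
      extChartAt_target_mem_nhds' ((extChartAt phaseModel a).map_source ha)
    have h2 : (extChartAt phaseModel a).symm ⁻¹' (extChartAt phaseModel b).source ∈ 𝓝 z := by
      refine (continuousAt_extChartAt_symm' ha).preimage_mem_nhds ?_
      rw [(extChartAt phaseModel a).left_inv ha]
      exact extChartAt_source_mem_nhds' hb
    filter_upwards [h1, h2] with y hy1 hy2
    exact (cotangent_chart_transition a b hy1 hy2).symm
  have hτd : HasFDerivAt (fun y : PhaseModel => τ y.1)
      ((fderiv ℝ τ z.1).comp (ContinuousLinearMap.fst ℝ Plane (Plane →L[ℝ] ℝ))) z :=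
    (hτs.differentiableAt (by simp)).hasFDerivAt.comp z hasFDerivAt_fst
  have hAd := hA.hasFDerivAt.comp z hτd
  have hd := (hτd.prodMk ((hasFDerivAt_snd (p := z)).clm_comp hAd)).congr_of_eventuallyEq hev.symm
  have hD := hS.unique hd
  -- Differentiating the lift produces a term in D²σ. The symplectic form antisymmetrizes it, so it
  -- disappears; the remaining terms pair Dσ with its inverse Dτ.
  have hsymm : ∀ u u' : Plane, fderiv ℝ (fderiv ℝ σ) (τ z.1) u u' =
      fderiv ℝ (fderiv ℝ σ) (τ z.1) u' u := by
    intro u u'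
    exact (hσs.isSymmSndFDerivAt (by simp)) u u'
  have hid : ∀ u : Plane, fderiv ℝ σ (τ z.1) (fderiv ℝ τ z.1 u) = u := fun u => by
    have := congrArg (fun L : Plane →L[ℝ] Plane => L u) hστ
    simpa using this
  rw [hD]
  simp only [stdForm, ContinuousLinearMap.prod_apply, ContinuousLinearMap.comp_apply,
    add_apply, ContinuousLinearMap.coe_fst', ContinuousLinearMap.coe_snd',
    ContinuousLinearMap.compL_apply, ContinuousLinearMap.flip_apply, Function.comp_apply]
  rw [hsymm (fderiv ℝ τ z.1 v.1) (fderiv ℝ τ z.1 w.1), hid, hid]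
  ring

end Charts

/-! ### The Hamilton field as a smooth vector field -/

section HamiltonField

variable {M : Type*} [TopologicalSpace M] [ChartedSpace Plane M] [IsManifold 𝓘(ℝ, Plane) ω M]

/-- The Hamilton field as a vector of the model space. -/
def hamiltonVec (p : Cotangent M → ℝ) (m : Cotangent M) : PhaseModel := hamiltonField p m

/-- The derivative of a vector-valued function, as a map on the model space. -/
def modelDeriv {F : Type*} [NormedAddCommGroup F] [NormedSpace ℝ F] (f : Cotangent M → F)
    (m : Cotangent M) : PhaseModel →L[ℝ] F := mfderiv phaseModel 𝓘(ℝ, F) f m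

theorem hamiltonVec_eq_stdGrad (p : Cotangent M → ℝ) (m : Cotangent M) :
    hamiltonVec p m = stdGrad (modelDeriv p m) := (stdGrad_apply _).symm

theorem stdForm_hamiltonVec (p : Cotangent M → ℝ) (m : Cotangent M) (w : PhaseModel) :
    stdForm w (hamiltonVec p m) = modelDeriv p m w := by
  rw [hamiltonVec_eq_stdGrad]
  exact stdForm_stdGrad _ _

theorem modelDeriv_eq_fderiv_chart {F : Type*} [NormedAddCommGroup F] [NormedSpace ℝ F]
    {f : Cotangent M → F} {a m : Cotangent M}
    (hf : MDifferentiableAt phaseModel 𝓘(ℝ, F) f m) (ha : m ∈ (extChartAt phaseModel a).source)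
    (u : PhaseModel) :
    modelDeriv f m u =
      fderiv ℝ (f ∘ (extChartAt phaseModel a).symm) (extChartAt phaseModel a m)
        (tangentCoordChange phaseModel m a m u) := by
  have hm : m ∈ (extChartAt phaseModel m).source := mem_extChartAt_source m
  have hS : HasFDerivAt (extChartAt phaseModel a ∘ (extChartAt phaseModel m).symm)
      (tangentCoordChange phaseModel m a m) (extChartAt phaseModel m m) := by
    have := hasFDerivWithinAt_tangentCoordChange (I := phaseModel) (x := m) (y := a) (z := m)
      ⟨hm, ha⟩
    rw [ModelWithCorners.range_eq_univ, hasFDerivWithinAt_univ] at this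
    exact this
  have hfa : DifferentiableAt ℝ (f ∘ (extChartAt phaseModel a).symm) (extChartAt phaseModel a m) := by
    have h1 : MDifferentiableAt 𝓘(ℝ, PhaseModel) phaseModel (extChartAt phaseModel a).symm
        (extChartAt phaseModel a m) := by
      have := mdifferentiableWithinAt_extChartAt_symm (I := phaseModel)
        ((extChartAt phaseModel a).map_source ha)
      rwa [ModelWithCorners.range_eq_univ, mdifferentiableWithinAt_univ] at this
    have h2 : MDifferentiableAt phaseModel 𝓘(ℝ, F) f
        ((extChartAt phaseModel a).symm (extChartAt phaseModel a m)) := by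
      rwa [(extChartAt phaseModel a).left_inv ha]
    exact (h2.comp _ h1).differentiableAt
  have hev : (f ∘ (extChartAt phaseModel m).symm) =ᶠ[𝓝 (extChartAt phaseModel m m)]
      (f ∘ (extChartAt phaseModel a).symm) ∘
        (extChartAt phaseModel a ∘ (extChartAt phaseModel m).symm) := by
    have h2 : (extChartAt phaseModel m).symm ⁻¹' (extChartAt phaseModel a).source ∈
        𝓝 (extChartAt phaseModel m m) := by
      refine (continuousAt_extChartAt_symm' hm).preimage_mem_nhds ?_
      rw [(extChartAt phaseModel m).left_inv hm]
      exact extChartAt_source_mem_nhds' ha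
    filter_upwards [h2] with y hy
    simp only [Function.comp_apply]
    rw [(extChartAt phaseModel a).left_inv hy]
  have hfa' : HasFDerivAt (f ∘ (extChartAt phaseModel a).symm)
      (fderiv ℝ (f ∘ (extChartAt phaseModel a).symm) (extChartAt phaseModel a m))
      ((extChartAt phaseModel a ∘ (extChartAt phaseModel m).symm) (extChartAt phaseModel m m)) := by
    rw [Function.comp_apply, (extChartAt phaseModel m).left_inv hm]
    exact hfa.hasFDerivAt
  have hcomp := (hfa'.comp _ hS).congr_of_eventuallyEq hev
  have hmf : mfderiv phaseModel 𝓘(ℝ, F) f m =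
      fderivWithin ℝ (writtenInExtChartAt phaseModel 𝓘(ℝ, F) m f) (Set.range phaseModel)
        (extChartAt phaseModel m m) := by
    exact hf.mfderiv
  have hw : writtenInExtChartAt phaseModel 𝓘(ℝ, F) m f = f ∘ (extChartAt phaseModel m).symm := rfl
  rw [hw, ModelWithCorners.range_eq_univ, fderivWithin_univ, hcomp.fderiv] at hmf
  rw [modelDeriv, hmf]
  rfl

/-- The form and dp determine the Hamilton field, and coordinate changes preserve the form. Hence
the field, defined in a chart that varies with the point, has the usual formula in any fixed chart;
its smoothness can be seen there. -/
theorem hamiltonField_chart {p : Cotangent M → ℝ} {a m : Cotangent M}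
    (hp : MDifferentiableAt phaseModel 𝓘(ℝ, ℝ) p m) (ha : m ∈ (extChartAt phaseModel a).source) :
    tangentCoordChange phaseModel m a m (hamiltonVec p m) =
      stdGrad (fderiv ℝ (p ∘ (extChartAt phaseModel a).symm) (extChartAt phaseModel a m)) := by
  have hm : m ∈ (extChartAt phaseModel m).source := mem_extChartAt_source m
  refine eq_of_stdForm_eq fun w => ?_
  have hw : w = tangentCoordChange phaseModel m a m (tangentCoordChange phaseModel a m m w) := by
    rw [tangentCoordChange_comp ⟨⟨ha, hm⟩, ha⟩, tangentCoordChange_self ha]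
  rw [stdForm_stdGrad, hw]
  rw [stdForm_tangentCoordChange m a hm ha]
  have h1 := stdForm_hamiltonVec p m (tangentCoordChange phaseModel a m m w)
  have h2 := modelDeriv_eq_fderiv_chart hp ha (tangentCoordChange phaseModel a m m w)
  exact h1.trans h2

theorem contMDiff_hamiltonField {p : Cotangent M → ℝ} (hp : ContMDiff phaseModel 𝓘(ℝ, ℝ) ∞ p) :
    ContMDiff phaseModel phaseModel.tangent ∞
      (fun m => (⟨m, hamiltonField p m⟩ : TangentBundle phaseModel (Cotangent M))) := by
  intro a
  rw [Bundle.contMDiffAt_totalSpace]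
  refine ⟨contMDiffAt_id, ?_⟩
  have hev : (fun m => (trivializationAt PhaseModel (TangentSpace phaseModel) a
      (⟨m, hamiltonField p m⟩ : TangentBundle phaseModel (Cotangent M))).2) =ᶠ[𝓝 a]
      fun m => stdGrad (fderiv ℝ (p ∘ (extChartAt phaseModel a).symm)
        (extChartAt phaseModel a m)) := by
    filter_upwards [extChartAt_source_mem_nhds (I := phaseModel) a] with m hm
    rw [← hamiltonField_chart (hp.mdifferentiable (by simp) m) hm]
    rfl
  refine ContMDiffAt.congr_of_eventuallyEq ?_ hev
  have h1 : ContDiffAt ℝ ∞ (p ∘ (extChartAt phaseModel a).symm) (extChartAt phaseModel a a) := by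
    have h3 := contMDiffWithinAt_extChartAt_symm_range (I := phaseModel) (n := ∞) a
        (mem_extChartAt_target a)
    rw [ModelWithCorners.range_eq_univ, contMDiffWithinAt_univ] at h3
    exact (hp.contMDiffAt.comp _ h3).contDiffAt
  have h2 : ContDiffAt ℝ ∞ (fun y => stdGrad (fderiv ℝ (p ∘ (extChartAt phaseModel a).symm) y))
      (extChartAt phaseModel a a) :=
    stdGrad.contDiff.contDiffAt.comp _ (h1.fderiv_right (by simp))
  exact h2.contMDiffAt.comp a contMDiffAt_extChartAt

theorem modelDeriv_hamiltonVec_self (p : Cotangent M → ℝ) (m : Cotangent M) :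
    modelDeriv p m (hamiltonVec p m) = 0 := by
  rw [← stdForm_hamiltonVec]
  simp [stdForm]

theorem hamiltonDeriv_eq (p : Cotangent M → ℝ) (G : Cotangent M → ℂ) (m : Cotangent M) :
    hamiltonDeriv p G m = modelDeriv G m (hamiltonVec p m) := rfl

end HamiltonField

/-! ### Smoothness of composition operators on spaces of paths -/

section Nemytskii

universe u

variable {X : Type*} [TopologicalSpace X] [CompactSpace X]
  {E : Type u} [NormedAddCommGroup E] [NormedSpace ℝ E]

/-- Pointwise application of a continuous family of operators to a continuous function. -/
def pointwiseApply (X E F : Type*) [TopologicalSpace X] [CompactSpace X]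
    [NormedAddCommGroup E] [NormedSpace ℝ E] [NormedAddCommGroup F] [NormedSpace ℝ F] :
    C(X, E →L[ℝ] F) →L[ℝ] C(X, E) →L[ℝ] C(X, F) :=
  LinearMap.mkContinuous₂
    (LinearMap.mk₂ ℝ (fun (A : C(X, E →L[ℝ] F)) (g : C(X, E)) =>
      (⟨fun x => A x (g x), by fun_prop⟩ : C(X, F)))
      (by intros; ext; simp) (by intros; ext; simp) (by intros; ext; simp)
      (by intros; ext; simp)) 1 (by
    intro A g
    refine (ContinuousMap.norm_le _ (by positivity)).2 fun x => ?_
    rw [one_mul]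
    exact ((A x).le_opNorm (g x)).trans
      (mul_le_mul (A.norm_coe_le_norm x) (g.norm_coe_le_norm x) (by positivity) (by positivity)))

/-- The range of γ is compact, so `f'` varies by less than `c` on balls of one radius δ about its
points; the mean value inequality then gives the remainder uniformly in the parameter of the path.
-/
theorem hasFDerivAt_postcomp {F : Type*} [NormedAddCommGroup F] [NormedSpace ℝ F]
    {f : E → F} {f' : E → E →L[ℝ] F} (hf : Continuous f) (hf' : Continuous f')
    (h : ∀ x, HasFDerivAt f (f' x) x) (γ : C(X, E)) :
    HasFDerivAt (fun g : C(X, E) => (⟨f, hf⟩ : C(E, F)).comp g)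
      (pointwiseApply X E F ((⟨f', hf'⟩ : C(E, E →L[ℝ] F)).comp γ)) γ := by
  rw [hasFDerivAt_iff_isLittleO, Asymptotics.isLittleO_iff]
  intro c hc
  have hK : IsCompact (Set.range γ) := isCompact_range γ.continuous
  obtain ⟨δ, hδ, hδ'⟩ : ∃ δ > 0, ∀ x ∈ Set.range γ, ∀ y, dist x y < δ → dist (f' x) (f' y) < c := by
    have := hK.uniformContinuousAt_of_continuousAt f' (fun x _ => hf'.continuousAt)
      (Metric.dist_mem_uniformity hc)
    obtain ⟨δ, hδ, hs⟩ := Metric.mem_uniformity_dist.1 this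
    exact ⟨δ, hδ, fun x hx y hxy => hs hxy hx⟩
  filter_upwards [Metric.ball_mem_nhds γ hδ] with g hg
  refine (ContinuousMap.norm_le _ (by positivity)).2 fun x => ?_
  have hgx : dist (γ x) (g x) < δ := by
    rw [dist_comm]
    exact (ContinuousMap.dist_apply_le_dist x).trans_lt hg
  have := (convex_ball (γ x) δ).norm_image_sub_le_of_norm_hasFDerivWithin_le' (f := f) (f' := f')
    (φ := f' (γ x)) (C := c) (x := γ x) (y := g x)
    (fun y _ => (h y).hasFDerivWithinAt) (fun y hy => by
      rw [← dist_eq_norm, dist_comm]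
      exact (hδ' _ ⟨x, rfl⟩ y (by rwa [dist_comm])).le)
    (Metric.mem_ball_self hδ) (by rwa [Metric.mem_ball, dist_comm])
  refine this.trans ?_
  gcongr
  exact (g - γ).norm_coe_le_norm x

/-- The derivative is composition with `fderiv ℝ f` followed by a fixed continuous linear map, so
induction on `n` works. The target varies in the induction and shares the universe of `E`, since it
is replaced by `E →L[ℝ] F`. -/
theorem contDiff_postcomp (n : ℕ) : ∀ {F : Type u} [NormedAddCommGroup F] [NormedSpace ℝ F]
    {f : E → F} (hf : ContDiff ℝ n f),
    ContDiff ℝ n (fun g : C(X, E) => (⟨f, hf.continuous⟩ : C(E, F)).comp g) := by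
  induction n with
  | zero =>
    intro F _ _ f hf
    exact contDiff_zero.2 (ContinuousMap.continuous_postcomp _)
  | succ n ih =>
    intro F _ _ f hf
    have hf1 : ContDiff ℝ n (fderiv ℝ f) := hf.fderiv_right (by simp)
    have hd := hasFDerivAt_postcomp (X := X) hf.continuous hf1.continuous
      (fun x => (hf.differentiable (by simp) x).hasFDerivAt)
    push_cast
    rw [contDiff_succ_iff_fderiv]
    refine ⟨fun γ => (hd γ).differentiableAt, by simp, ?_⟩
    have : fderiv ℝ (fun g : C(X, E) => (⟨f, hf.continuous⟩ : C(E, F)).comp g) =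
        fun γ => pointwiseApply X E F ((⟨fderiv ℝ f, hf1.continuous⟩ : C(E, E →L[ℝ] F)).comp γ) :=
      funext fun γ => (hd γ).fderiv
    rw [this]
    exact (pointwiseApply X E F).contDiff.comp (ih hf1)

end Nemytskii

/-! ### Short-time solutions by the implicit function theorem -/

section Volterra

variable {E : Type*} [NormedAddCommGroup E]

/-- The time interval on which rescaled short-time solutions are considered. -/
abbrev FlowTime : Type := Set.Icc (-2 : ℝ) 2

/-- The extension of a path by constants. -/
def extendPath (γ : C(FlowTime, E)) (t : ℝ) : E :=
  γ (Set.projIcc (-2) 2 (by norm_num) t)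

theorem continuous_extendPath (γ : C(FlowTime, E)) : Continuous (extendPath γ) :=
  γ.continuous.comp continuous_projIcc

/-- The primitive of a path which vanishes at time zero. -/
def volterra (E : Type*) [NormedAddCommGroup E] [NormedSpace ℝ E] :
    C(FlowTime, E) →L[ℝ] C(FlowTime, E) :=
  LinearMap.mkContinuous
    { toFun := fun γ => ⟨fun t => ∫ s in (0 : ℝ)..t, extendPath γ s,
        (intervalIntegral.continuous_primitive
          (fun a b => (continuous_extendPath γ).intervalIntegrable a b) 0).comp
          continuous_subtype_val⟩
      map_add' := by
        intro γ γ'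
        ext t
        exact intervalIntegral.integral_add ((continuous_extendPath γ).intervalIntegrable _ _)
          ((continuous_extendPath γ').intervalIntegrable _ _)
      map_smul' := by
        intro c γ
        ext t
        exact intervalIntegral.integral_smul c (extendPath γ) } 2 (by
    intro γ
    refine (ContinuousMap.norm_le _ (by positivity)).2 fun t => ?_
    have h := intervalIntegral.norm_integral_le_of_norm_le_const (a := 0) (b := (t : ℝ))
      (f := extendPath γ) (C := ‖γ‖) (fun s _ => γ.norm_coe_le_norm _)
    refine h.trans ?_
    rw [mul_comm]
    gcongr
    rw [sub_zero, abs_le]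
    exact t.2)

variable [NormedSpace ℝ E]

theorem volterra_apply (γ : C(FlowTime, E)) (t : FlowTime) :
    volterra E γ t = ∫ s in (0 : ℝ)..t, extendPath γ s := rfl

/-- Solutions of `γ' = h f(γ)`, `γ(0) = x` for small `h`, depending smoothly on `(h, x)`. -/
theorem exists_contDiffAt_path [CompleteSpace E] {f : E → E} (hf : ContDiff ℝ ∞ f) (x₀ : E)
    (n : ℕ) (hn : n ≠ 0) :
    ∃ ψ : ℝ × E → C(FlowTime, E), ContDiffAt ℝ n ψ (0, x₀) ∧
      ψ (0, x₀) = ContinuousMap.const _ x₀ ∧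
      ∀ᶠ v in 𝓝 ((0 : ℝ), x₀), ∀ t : FlowTime,
        ψ v t = v.2 + v.1 • ∫ s in (0 : ℝ)..t, f (extendPath (ψ v) s) := by
  have hfn : ContDiff ℝ n f := hf.of_le (by exact_mod_cast le_top)
  let N : C(FlowTime, E) → C(FlowTime, E) := fun g => (⟨f, hfn.continuous⟩ : C(E, E)).comp g
  have hN : ContDiff ℝ n N := contDiff_postcomp n hfn
  let c : E →L[ℝ] C(FlowTime, E) := ContinuousLinearMap.const ℝ _
  -- Zeros of Φ are the solutions in rescaled time. At h = 0 the nonlinear term is absent, so the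
  -- partial derivative in the path is the identity and no contraction estimate is needed.
  let Φ : (ℝ × E) × C(FlowTime, E) → C(FlowTime, E) :=
    fun u => u.2 - c u.1.2 - u.1.1 • volterra E (N u.2)
  have hΦ : ContDiff ℝ n Φ := by
    refine (contDiff_snd.sub (c.contDiff.comp (contDiff_snd.comp contDiff_fst))).sub
      ((contDiff_fst.comp contDiff_fst).smul ((volterra E).contDiff.comp (hN.comp contDiff_snd)))
  let u : (ℝ × E) × C(FlowTime, E) := ((0, x₀), c x₀)
  have hn' : (n : WithTop ℕ∞) ≠ 0 := by exact_mod_cast hn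
  have hinv : (fderiv ℝ Φ u ∘L .inr ℝ (ℝ × E) C(FlowTime, E)).IsInvertible := by
    have h1 : HasFDerivAt (fun g : C(FlowTime, E) => Φ ((0, x₀), g))
        (fderiv ℝ Φ u ∘L .inr ℝ (ℝ × E) C(FlowTime, E)) (c x₀) :=
      (hΦ.differentiable hn' u).hasFDerivAt.comp (c x₀) (hasFDerivAt_prodMk_right _ _)
    have h2 : HasFDerivAt (fun g : C(FlowTime, E) => Φ ((0, x₀), g))
        (ContinuousLinearMap.id ℝ C(FlowTime, E)) (c x₀) := by
      have : (fun g : C(FlowTime, E) => Φ ((0, x₀), g)) = fun g => g - c x₀ := by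
        funext g; simp [Φ]
      rw [this]
      exact (hasFDerivAt_id _).sub_const _
    rw [h1.unique h2]
    exact ⟨ContinuousLinearEquiv.refl ℝ _, rfl⟩
  have hΦu : Φ u = 0 := by simp [Φ, u]
  refine ⟨hΦ.contDiffAt.implicitFunction hn' hinv,
    hΦ.contDiffAt.contDiffAt_implicitFunction hn' hinv,
    hΦ.contDiffAt.implicitFunction_apply_self hn' hinv, ?_⟩
  filter_upwards [hΦ.contDiffAt.eventually_apply_implicitFunction hn' hinv] with v hv t
  rw [hΦu] at hv
  have := congrArg (fun g : C(FlowTime, E) => g t) hv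
  simp only [Φ, ContinuousMap.sub_apply, ContinuousMap.smul_apply, ContinuousMap.zero_apply,
    volterra_apply] at this
  rw [sub_sub, sub_eq_zero] at this
  exact this

end Volterra

/-! ### Local flows on manifolds -/

section Flow

variable {E : Type*} [NormedAddCommGroup E] [NormedSpace ℝ E] {H : Type*} [TopologicalSpace H]
  {I : ModelWithCorners ℝ E H} {N : Type*} [TopologicalSpace N] [ChartedSpace H N]

/-- The expression of a vector field in the preferred chart at `a`. -/
def chartField (I : ModelWithCorners ℝ E H) [IsManifold I 1 N] (v : (x : N) → TangentSpace I x)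
    (a : N) (y : E) : E :=
  tangentCoordChange I ((extChartAt I a).symm y) a ((extChartAt I a).symm y)
    (v ((extChartAt I a).symm y))

theorem contDiffOn_chartField [IsManifold I ∞ N] {v : (x : N) → TangentSpace I x}
    (hv : ContMDiff I I.tangent ∞ (fun x => (⟨x, v x⟩ : TangentBundle I N))) (a : N) :
    haveI : IsManifold I 1 N := .of_le (n := ∞) (by simp)
    ContDiffOn ℝ ∞ (chartField I v a) (extChartAt I a).target := by
  have : IsManifold I 1 N := .of_le (n := ∞) (by simp)
  rw [← contMDiffOn_iff_contDiffOn]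
  have h1 : ContMDiffOn I 𝓘(ℝ, E) ∞ (fun m => (trivializationAt E (TangentSpace I) a
      (⟨m, v m⟩ : TangentBundle I N)).2) (extChartAt I a).source := by
    intro m hm
    have := (Bundle.Trivialization.contMDiffWithinAt_iff (IB := I) (n := ∞)
      (e := trivializationAt E (TangentSpace I) a) (s := Set.univ) (x₀ := m)
      (f := fun x => (⟨x, v x⟩ : TangentBundle I N)) (by
        rw [Bundle.Trivialization.mem_source, TangentBundle.trivializationAt_baseSet]
        rwa [extChartAt_source] at hm)).1 hv.contMDiffAt.contMDiffWithinAt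
    exact this.2.mono (Set.subset_univ _)
  have h2 : ContMDiffOn 𝓘(ℝ, E) I ∞ (extChartAt I a).symm (extChartAt I a).target :=
    contMDiffOn_extChartAt_symm a
  refine (h1.comp h2 (fun y hy => (extChartAt I a).map_target hy)).congr fun y hy => ?_
  rfl

variable [I.Boundaryless]

theorem hasMFDerivAt_chart_symm_curve [IsManifold I 1 N] (v : (x : N) → TangentSpace I x) (a : N)
    {c : ℝ → E} {t h : ℝ} (hc : c t ∈ (extChartAt I a).target)
    (hd : HasDerivAt c (h • chartField I v a (c t)) t) :
    HasMFDerivAt 𝓘(ℝ, ℝ) I ((extChartAt I a).symm ∘ c) t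
      ((1 : ℝ →L[ℝ] ℝ).smulRight (h • v ((extChartAt I a).symm (c t)))) := by
  set m : N := (extChartAt I a).symm (c t) with hm
  have h1 : m ∈ (extChartAt I a).source := (extChartAt I a).map_target hc
  have h2 : m ∈ (extChartAt I m).source := mem_extChartAt_source m
  have key : HasDerivAt ((extChartAt I m ∘ (extChartAt I a).symm) ∘ c)
      (tangentCoordChange I a m m (h • chartField I v a (c t))) t := by
    apply HasFDerivAt.comp_hasDerivAt _ _ hd
    have h4 := hasFDerivWithinAt_tangentCoordChange (I := I) (x := a) (y := m) (z := m) ⟨h1, h2⟩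
    rw [ModelWithCorners.range_eq_univ, hasFDerivWithinAt_univ] at h4
    rwa [hm, (extChartAt I a).right_inv hc] at h4
  have h3 : tangentCoordChange I a m m (h • chartField I v a (c t)) = (h • v m : TangentSpace I m) := by
    have h5 := (tangentCoordChange_comp (I := I) (w := m) (x := a) (y := m) (v := (v m : E))
      ⟨⟨h2, h1⟩, h2⟩).trans (tangentCoordChange_self (I := I) (v := (v m : E)) h2)
    rw [map_smul]
    exact congrArg (fun w : E => h • w) h5
  rw [h3] at key
  exact ⟨(continuousAt_extChartAt_symm'' hc).comp hd.continuousAt,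
    key.hasFDerivAt.hasFDerivWithinAt⟩

variable [FiniteDimensional ℝ E] [IsManifold I ∞ N] 

/-- Smooth families of short-time integral curves, in rescaled time. -/
theorem exists_local_curves {v : (x : N) → TangentSpace I x}
    (hv : ContMDiff I I.tangent ∞ (fun x => (⟨x, v x⟩ : TangentBundle I N)))
    (n : ℕ) (hn : n ≠ 0) (a : N) :
    ∃ ψ : ℝ × E → C(FlowTime, E), ContDiffAt ℝ n ψ (0, extChartAt I a a) ∧
      ψ (0, extChartAt I a a) = ContinuousMap.const _ (extChartAt I a a) ∧
      ∀ᶠ z in 𝓝 ((0 : ℝ), extChartAt I a a),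
        IsMIntegralCurveOn (I := I) ((extChartAt I a).symm ∘ extendPath (ψ z))
          (fun m => z.1 • v m) (Set.Ioo (-2) 2) ∧ extendPath (ψ z) 0 = z.2 := by
  have : IsManifold I 1 N := .of_le (n := ∞) (by simp)
  have : CompleteSpace E := FiniteDimensional.complete ℝ E
  set e := extChartAt I a with he
  have hopen : IsOpen e.target := isOpen_extChartAt_target a
  have hya : e a ∈ e.target := mem_extChartAt_target a
  obtain ⟨ρ, hρ, hball⟩ := Metric.isOpen_iff.1 hopen (e a) hya
  -- The cutoff extends the chart field to all of E. By continuity of ψ in the sup norm, paths with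
  -- parameters near (0, e a) stay where `b` is 1 and thus solve the original equation.
  let b : ContDiffBump (e a) := ⟨ρ / 4, ρ / 2, by positivity, by linarith⟩
  let f : E → E := fun y => b y • chartField I v a y
  have hfs : ContDiff ℝ ∞ f := by
    rw [contDiff_iff_contDiffAt]
    intro y
    by_cases hy : y ∈ Metric.ball (e a) ρ
    · exact b.contDiffAt.smul
        ((contDiffOn_chartField hv a).contDiffAt (hopen.mem_nhds (hball hy)))
    · have : f =ᶠ[𝓝 y] fun _ => 0 := by
        have hy' : y ∈ (Metric.closedBall (e a) (ρ / 2))ᶜ := by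
          simp only [Metric.mem_ball, not_lt, Set.mem_compl_iff, Metric.mem_closedBall,
            not_le] at hy ⊢
          linarith
        filter_upwards [Metric.isClosed_closedBall.isOpen_compl.mem_nhds hy'] with z hz
        have : b z = 0 := b.zero_of_le_dist (by
          simp only [Set.mem_compl_iff, Metric.mem_closedBall, not_le] at hz
          exact hz.le)
        simp [f, this]
      exact contDiffAt_const.congr_of_eventuallyEq this
  obtain ⟨ψ, hψ, hψ0, hψe⟩ := exists_contDiffAt_path hfs (e a) n hn
  have hclose : ∀ᶠ z in 𝓝 ((0 : ℝ), e a), ∀ t, ψ z t ∈ Metric.closedBall (e a) (ρ / 4) := by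
    have h1 : ContinuousAt ψ (0, e a) := hψ.continuousAt
    have h2 := h1.preimage_mem_nhds (Metric.closedBall_mem_nhds _ (show (0 : ℝ) < ρ / 4 by positivity))
    filter_upwards [h2] with z hz t
    rw [hψ0] at hz
    exact (ContinuousMap.dist_apply_le_dist t).trans hz
  refine ⟨ψ, hψ, hψ0, ?_⟩
  filter_upwards [hclose, hψe] with z hz1 hz2
  have hext : ∀ t ∈ Set.Ioo (-2 : ℝ) 2, extendPath (ψ z) t =
      z.2 + z.1 • ∫ s in (0 : ℝ)..t, f (extendPath (ψ z) s) := by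
    intro t ht
    have := hz2 ⟨t, ht.1.le, ht.2.le⟩
    rw [← this, extendPath, Set.projIcc_of_mem _ ⟨ht.1.le, ht.2.le⟩]
  have hcont : Continuous fun s => f (extendPath (ψ z) s) :=
    hfs.continuous.comp (continuous_extendPath _)
  have hmem : ∀ t, extendPath (ψ z) t ∈ Metric.closedBall (e a) (ρ / 4) := fun t => hz1 _
  have hder : ∀ t ∈ Set.Ioo (-2 : ℝ) 2,
      HasDerivAt (extendPath (ψ z)) (z.1 • chartField I v a (extendPath (ψ z) t)) t := by
    intro t ht
    have h1 : HasDerivAt (fun t => z.2 + z.1 • ∫ s in (0 : ℝ)..t, f (extendPath (ψ z) s))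
        (z.1 • f (extendPath (ψ z) t)) t :=
      ((intervalIntegral.integral_hasDerivAt_right (hcont.intervalIntegrable _ _)
        (hcont.stronglyMeasurableAtFilter _ _) hcont.continuousAt).const_smul z.1).const_add z.2
    have h2 : f (extendPath (ψ z) t) = chartField I v a (extendPath (ψ z) t) := by
      have : b (extendPath (ψ z) t) = 1 := b.one_of_mem_closedBall (hmem t)
      simp [f, this]
    rw [h2] at h1
    refine h1.congr_of_eventuallyEq ?_
    filter_upwards [isOpen_Ioo.mem_nhds ht] with s hs using hext s hs
  have hcurve : IsMIntegralCurveOn (I := I) (e.symm ∘ extendPath (ψ z))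
      (fun m => z.1 • v m) (Set.Ioo (-2) 2) := by
    intro t ht
    refine (hasMFDerivAt_chart_symm_curve v a (hball ?_) (hder t ht)).hasMFDerivWithinAt
    exact (Metric.mem_closedBall.1 (hmem t)).trans_lt (by linarith)
  refine ⟨hcurve, ?_⟩
  have := hext 0 (by norm_num)
  rwa [intervalIntegral.integral_same, smul_zero, add_zero] at this

/-- A flow of a smooth vector field is smooth near time zero. -/
theorem contMDiffAt_flow_zero [T2Space N] {v : (x : N) → TangentSpace I x}
    (hv : ContMDiff I I.tangent ∞ (fun x => (⟨x, v x⟩ : TangentBundle I N)))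
    {φ : ℝ → N → N} (h0 : ∀ x, φ 0 x = x)
    (hφ : ∀ x, IsMIntegralCurve (I := I) (fun t => φ t x) v) (n : ℕ) (hn : n ≠ 0) (a : N) :
    ContMDiffAt (𝓘(ℝ, ℝ).prod I) I n (fun z : ℝ × N => φ z.1 z.2) (0, a) := by
  have : IsManifold I 1 N := .of_le (n := ∞) (by simp)
  set e := extChartAt I a with he
  have hopen : IsOpen e.target := isOpen_extChartAt_target a
  have hya : e a ∈ e.target := mem_extChartAt_target a
  obtain ⟨ψ, hψ, hψ0, hψe⟩ := exists_local_curves hv n hn a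
  have hkey : ∀ᶠ z in 𝓝 ((0 : ℝ), e a),
      φ z.1 (e.symm z.2) = e.symm (ψ z ⟨1, by norm_num⟩) := by
    filter_upwards [hψe] with z hz
    -- In rescaled time both the flow line and the path in the chart are integral curves of z.1 • v
    -- from the same point. By uniqueness they agree at rescaled time 1, interior to [-2, 2], which
    -- is true time z.1.
    have hcurve' : IsMIntegralCurveOn (I := I) ((fun t => φ t (e.symm z.2)) ∘ (· * z.1))
        (fun m => z.1 • v m) (Set.Ioo (-2) 2) :=
      ((hφ (e.symm z.2)).comp_mul z.1).isMIntegralCurveOn _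
    have hvz : ContMDiff I I.tangent 1
        (fun x => (⟨x, z.1 • v x⟩ : TangentBundle I N)) :=
      ContMDiff.const_smul_section (hv.of_le (by simp))
    have heq := isMIntegralCurveOn_Ioo_eqOn_of_contMDiff_boundaryless (t₀ := 0) (by norm_num) hvz
      hcurve' hz.1 (by
        rw [Function.comp_apply, Function.comp_apply, hz.2, zero_mul, h0])
    have := heq (x := 1) (by norm_num)
    simp only [Function.comp_apply, one_mul] at this
    rw [this, extendPath, Set.projIcc_of_mem _ (by norm_num)]
  have hchart : ContMDiffAt (𝓘(ℝ, ℝ).prod I) 𝓘(ℝ, ℝ × E) n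
      (fun z : ℝ × N => (z.1, e z.2)) (0, a) :=
    contMDiffAt_fst.prodMk_space ((contMDiffAt_extChartAt (I := I) (x := a) (n := n)).comp
      ((0 : ℝ), a) contMDiffAt_snd)
  have hev : (fun z : ℝ × N => φ z.1 z.2) =ᶠ[𝓝 ((0 : ℝ), a)]
      fun z => e.symm (ψ (z.1, e z.2) ⟨1, by norm_num⟩) := by
    have h1 := hchart.continuousAt.eventually hkey
    have h2 : ∀ᶠ z : ℝ × N in 𝓝 ((0 : ℝ), a), z.2 ∈ e.source :=
      continuousAt_snd.eventually (extChartAt_source_mem_nhds a)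
    filter_upwards [h1, h2] with z hz1 hz2
    rwa [e.left_inv hz2] at hz1
  refine ContMDiffAt.congr_of_eventuallyEq ?_ hev
  have hψ1 : ContMDiffAt (𝓘(ℝ, ℝ).prod I) 𝓘(ℝ, E) n
      (fun z : ℝ × N => ψ (z.1, e z.2) ⟨1, by norm_num⟩) (0, a) := by
    let ev : C(FlowTime, E) →L[ℝ] E := ContinuousMap.evalCLM ℝ ⟨1, by norm_num⟩
    have h1 : ContDiffAt ℝ n (fun z => ev (ψ z)) ((0 : ℝ), e a) :=
      ev.contDiff.contDiffAt.comp _ hψ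
    exact h1.contMDiffAt.comp ((0 : ℝ), a) hchart
  have hval : ψ (0, e a) ⟨1, by norm_num⟩ = e a := by rw [hψ0]; rfl
  have hsymm : ContMDiffAt 𝓘(ℝ, E) I n e.symm
      ((fun z : ℝ × N => ψ (z.1, e z.2) ⟨1, by norm_num⟩) (0, a)) := by
    simp only [hval]
    exact ((contMDiffOn_extChartAt_symm (I := I) (n := ∞) a).contMDiffAt
      (hopen.mem_nhds hya)).of_le (by exact_mod_cast le_top)
  exact hsymm.comp ((0 : ℝ), a) hψ1

/-- Integral curves of a smooth vector field exist for a time which is locally uniform. -/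
theorem exists_uniform_time_nhds {v : (x : N) → TangentSpace I x}
    (hv : ContMDiff I I.tangent ∞ (fun x => (⟨x, v x⟩ : TangentBundle I N))) (a : N) :
    ∃ U ∈ 𝓝 a, ∃ ε : ℝ, 0 < ε ∧ ∀ x ∈ U, ∃ γ : ℝ → N, γ 0 = x ∧
      IsMIntegralCurveOn (I := I) γ v (Set.Ioo (-ε) ε) := by
  obtain ⟨ψ, -, -, hψe⟩ := exists_local_curves hv 1 one_ne_zero a
  rw [nhds_prod_eq, Filter.eventually_prod_iff] at hψe
  obtain ⟨P, hP, Q, hQ, hPQ⟩ := hψe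
  obtain ⟨δ, hδ, hδP⟩ := Metric.eventually_nhds_iff.1 hP
  have hP2 : P (δ / 2) := hδP (by rw [Real.dist_eq, sub_zero, abs_of_pos] <;> linarith)
  refine ⟨(extChartAt I a).source ∩ extChartAt I a ⁻¹' {y | Q y}, Filter.inter_mem
    (extChartAt_source_mem_nhds a) ((continuousAt_extChartAt a).preimage_mem_nhds hQ),
    δ / 2, by positivity, ?_⟩
  rintro x ⟨hx1, hx2⟩
  obtain ⟨h1, h2⟩ := hPQ hP2 hx2
  -- Undoing the rescaling: a curve of (δ/2) • v on (-2, 2) becomes a curve of v on (-δ, δ).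
  have h3 := h1.comp_mul (2 / δ)
  have hfield : ((2 / δ) • fun m => (δ / 2) • v m) = v := by
    funext m
    rw [Pi.smul_apply, smul_smul, div_mul_div_cancel₀ hδ.ne', div_self two_ne_zero, one_smul]
  rw [hfield] at h3
  refine ⟨_, ?_, h3.mono fun t ht => ?_⟩
  · rw [Function.comp_apply, Function.comp_apply, zero_mul, h2]
    exact (extChartAt I a).left_inv hx1
  · have h4 : (2 / δ) * (δ / 2) = 1 := by field_simp
    have h5 : 0 < 2 / δ := by positivity
    constructor <;> nlinarith [ht.1, ht.2]

end Flow

/-! ### Complete flows and integrals along them -/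

section CompleteFlow

variable {E : Type*} [NormedAddCommGroup E] [NormedSpace ℝ E] {H : Type*} [TopologicalSpace H]
  {I : ModelWithCorners ℝ E H} {N : Type*} [TopologicalSpace N] [ChartedSpace H N]
  [I.Boundaryless] [FiniteDimensional ℝ E] [IsManifold I ∞ N] [T2Space N]

/-- A compactly supported smooth vector field is complete. -/
theorem exists_isMIntegralCurve_of_compact_support {v : (x : N) → TangentSpace I x}
    (hv : ContMDiff I I.tangent ∞ (fun x => (⟨x, v x⟩ : TangentBundle I N)))
    {S : Set N} (hS : IsCompact S) (hvS : ∀ x, x ∉ S → v x = 0) (x : N) :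
    ∃ γ : ℝ → N, γ 0 = x ∧ IsMIntegralCurve (I := I) γ v := by
  have : IsManifold I 1 N := .of_le (n := ∞) (by simp)
  have huni : ∃ ε : ℝ, 0 < ε ∧ ∀ x ∈ S, ∃ γ : ℝ → N, γ 0 = x ∧
      IsMIntegralCurveOn (I := I) γ v (Set.Ioo (-ε) ε) := by
    refine hS.induction_on (p := fun s => ∃ ε : ℝ, 0 < ε ∧ ∀ x ∈ s, ∃ γ : ℝ → N, γ 0 = x ∧
      IsMIntegralCurveOn (I := I) γ v (Set.Ioo (-ε) ε)) ⟨1, one_pos, by simp⟩ ?_ ?_ ?_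
    · rintro s t hst ⟨ε, hε, h⟩
      exact ⟨ε, hε, fun x hx => h x (hst hx)⟩
    · rintro s t ⟨ε, hε, h⟩ ⟨ε', hε', h'⟩
      refine ⟨min ε ε', lt_min hε hε', fun x hx => ?_⟩
      rcases hx with hx | hx
      · obtain ⟨γ, h1, h2⟩ := h x hx
        exact ⟨γ, h1, h2.mono (Set.Ioo_subset_Ioo (neg_le_neg (min_le_left _ _))
          (min_le_left _ _))⟩
      · obtain ⟨γ, h1, h2⟩ := h' x hx
        exact ⟨γ, h1, h2.mono (Set.Ioo_subset_Ioo (neg_le_neg (min_le_right _ _))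
          (min_le_right _ _))⟩
    · intro a _
      obtain ⟨U, hU, ε, hε, h⟩ := exists_uniform_time_nhds hv a
      exact ⟨U, mem_nhdsWithin_of_mem_nhds hU, ε, hε, h⟩
  obtain ⟨ε, hε, h⟩ := huni
  refine exists_isMIntegralCurve_of_isMIntegralCurveOn (hv.of_le (by simp)) hε (fun y => ?_) x
  by_cases hy : y ∈ S
  · exact h y hy
  · exact ⟨fun _ => y, rfl, (isMIntegralCurve_const (hvS y hy)).isMIntegralCurveOn _⟩

theorem IsMIntegralCurve.eq_of_eq_zero {v : (x : N) → TangentSpace I x}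
    (hv : ContMDiff I I.tangent ∞ (fun x => (⟨x, v x⟩ : TangentBundle I N)))
    {c c' : ℝ → N} (hc : IsMIntegralCurve (I := I) c v) (hc' : IsMIntegralCurve (I := I) c' v)
    (h : c 0 = c' 0) : c = c' := by
  have : IsManifold I 1 N := .of_le (n := ∞) (by simp)
  exact isMIntegralCurve_Ioo_eq_of_contMDiff_boundaryless (t₀ := 0) (hv.of_le (by simp)) hc hc' h

/-- The flow of a compactly supported smooth vector field. -/
theorem exists_smooth_flow {v : (x : N) → TangentSpace I x}
    (hv : ContMDiff I I.tangent ∞ (fun x => (⟨x, v x⟩ : TangentBundle I N)))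
    {S : Set N} (hS : IsCompact S) (hvS : ∀ x, x ∉ S → v x = 0) :
    ∃ φ : ℝ → N → N, (∀ x, φ 0 x = x) ∧ (∀ x, IsMIntegralCurve (I := I) (fun t => φ t x) v) ∧
      (∀ s t x, φ (s + t) x = φ s (φ t x)) ∧
      ContMDiff (𝓘(ℝ, ℝ).prod I) I ∞ (fun z : ℝ × N => φ z.1 z.2) := by
  have : IsManifold I 1 N := .of_le (n := ∞) (by simp)
  choose c hc0 hc using exists_isMIntegralCurve_of_compact_support hv hS hvS
  let φ : ℝ → N → N := fun t x => c x t
  have h0 : ∀ x, φ 0 x = x := hc0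
  have hgroup : ∀ s t x, φ (s + t) x = φ s (φ t x) := by
    intro s t x
    have h1 : IsMIntegralCurve (I := I) (c x ∘ (· + t)) v := (hc x).comp_add t
    have h2 := IsMIntegralCurve.eq_of_eq_zero hv h1 (hc (c x t)) (by simp [hc0])
    exact congrFun h2 s
  refine ⟨φ, h0, hc, hgroup, ?_⟩
  -- For finite n, being C^n at a point is an open condition. Smoothness at time zero therefore
  -- holds for a time interval uniform over the compact set `S`; outside `S` the flow is the
  -- identity.
  have hmain : ∀ n : ℕ, n ≠ 0 →
      ContMDiff (𝓘(ℝ, ℝ).prod I) I n (fun z : ℝ × N => φ z.1 z.2) := by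
    intro n hn
    have huni : ∃ ε : ℝ, 0 < ε ∧ ∀ x ∈ S, ∀ t, |t| < ε →
        ContMDiffAt (𝓘(ℝ, ℝ).prod I) I n (fun z : ℝ × N => φ z.1 z.2) (t, x) := by
      refine hS.induction_on (p := fun s => ∃ ε : ℝ, 0 < ε ∧ ∀ x ∈ s, ∀ t, |t| < ε →
        ContMDiffAt (𝓘(ℝ, ℝ).prod I) I n (fun z : ℝ × N => φ z.1 z.2) (t, x))
        ⟨1, one_pos, by simp⟩ ?_ ?_ ?_
      · rintro s t hst ⟨ε, hε, h⟩
        exact ⟨ε, hε, fun x hx => h x (hst hx)⟩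
      · rintro s t ⟨ε, hε, h⟩ ⟨ε', hε', h'⟩
        refine ⟨min ε ε', lt_min hε hε', fun x hx t ht => ?_⟩
        rcases hx with hx | hx
        · exact h x hx t (ht.trans_le (min_le_left _ _))
        · exact h' x hx t (ht.trans_le (min_le_right _ _))
      · intro a _
        have h1 := contMDiffAt_flow_zero hv h0 hc n hn a
        have hIM : IsManifold I n N := .of_le (n := ∞) (by exact_mod_cast le_top)
        have h2 := (contMDiffAt_iff_contMDiffAt_nhds (by simp)).1 h1
        rw [nhds_prod_eq, Filter.eventually_prod_iff] at h2
        obtain ⟨P, hP, Q, hQ, hPQ⟩ := h2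
        obtain ⟨δ, hδ, hδP⟩ := Metric.eventually_nhds_iff.1 hP
        refine ⟨{y | Q y}, mem_nhdsWithin_of_mem_nhds hQ, δ, hδ, fun x hx t ht => ?_⟩
        exact hPQ (hδP (by rwa [Real.dist_eq, sub_zero])) hx
    obtain ⟨ε, hε, hεS⟩ := huni
    have hsmall : ∀ x : N, ∀ t, |t| < ε →
        ContMDiffAt (𝓘(ℝ, ℝ).prod I) I n (fun z : ℝ × N => φ z.1 z.2) (t, x) := by
      intro x t ht
      by_cases hx : x ∈ S
      · exact hεS x hx t ht
      · have hfix : ∀ y, y ∉ S → ∀ t, φ t y = y := by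
          intro y hy t
          have := IsMIntegralCurve.eq_of_eq_zero hv (hc y)
            (isMIntegralCurve_const (hvS y hy)) (hc0 y)
          exact congrFun this t
        have hev : (fun z : ℝ × N => φ z.1 z.2) =ᶠ[𝓝 (t, x)] Prod.snd := by
          have : ∀ᶠ z : ℝ × N in 𝓝 (t, x), z.2 ∈ Sᶜ :=
            continuousAt_snd.eventually (hS.isClosed.isOpen_compl.mem_nhds hx)
          filter_upwards [this] with z hz using hfix _ hz _
        exact contMDiffAt_snd.congr_of_eventuallyEq hev
    -- Since φ_t = φ_{t/2} ∘ φ_{t/2}, the time interval of smoothness can be doubled repeatedly.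
    have hdouble : ∀ k : ℕ, ∀ x : N, ∀ t, |t| < 2 ^ k * ε →
        ContMDiffAt (𝓘(ℝ, ℝ).prod I) I n (fun z : ℝ × N => φ z.1 z.2) (t, x) := by
      intro k
      induction k with
      | zero => simpa using hsmall
      | succ k ih =>
        intro x t ht
        have ht2 : |t / 2| < 2 ^ k * ε := by
          rw [abs_div, abs_two]
          rw [pow_succ] at ht
          linarith
        have hhalf : ContMDiff (𝓘(ℝ, ℝ).prod I) 𝓘(ℝ, ℝ) n (fun z : ℝ × N => z.1 / 2) := by
          have : ContMDiff 𝓘(ℝ, ℝ) 𝓘(ℝ, ℝ) n (fun s : ℝ => s / 2) :=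
            (contDiff_id.div_const 2).contMDiff
          exact this.comp contMDiff_fst
        have h1 : ContMDiffAt (𝓘(ℝ, ℝ).prod I) (𝓘(ℝ, ℝ).prod I) n
            (fun z : ℝ × N => (z.1 / 2, z.2)) (t, x) :=
          hhalf.contMDiffAt.prodMk contMDiffAt_snd
        have h2 : ContMDiffAt (𝓘(ℝ, ℝ).prod I) I n
            (fun z : ℝ × N => φ (z.1 / 2) z.2) (t, x) :=
          (ih x (t / 2) ht2).comp (t, x) h1
        have h3 : ContMDiffAt (𝓘(ℝ, ℝ).prod I) (𝓘(ℝ, ℝ).prod I) n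
            (fun z : ℝ × N => (z.1 / 2, φ (z.1 / 2) z.2)) (t, x) :=
          hhalf.contMDiffAt.prodMk h2
        have h4 : ContMDiffAt (𝓘(ℝ, ℝ).prod I) I n
            (fun z : ℝ × N => φ (z.1 / 2) (φ (z.1 / 2) z.2)) (t, x) :=
          ContMDiffAt.comp (g := fun z : ℝ × N => φ z.1 z.2) (t, x)
            (ih (φ (t / 2) x) (t / 2) ht2) h3
        have : (fun z : ℝ × N => φ z.1 z.2) = fun z => φ (z.1 / 2) (φ (z.1 / 2) z.2) := by
          funext z
          rw [← hgroup, add_halves]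
        rwa [this]
    intro z
    obtain ⟨k, hk⟩ := pow_unbounded_of_one_lt (|z.1| / ε) one_lt_two
    exact hdouble k z.2 z.1 (by rwa [div_lt_iff₀ hε] at hk)
  rw [contMDiff_infty]
  intro n
  rcases Nat.eq_zero_or_pos n with rfl | hn
  · exact (hmain 1 one_ne_zero).of_le (by simp)
  · exact hmain n hn.ne'

/-- Weighted time integrals of a smooth function along a smooth flow are smooth. -/
theorem contMDiff_flow_integral {φ : ℝ → N → N}
    (hφ : ContMDiff (𝓘(ℝ, ℝ).prod I) I ∞ (fun z : ℝ × N => φ z.1 z.2))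
    {u : N → ℝ} (hu : ContMDiff I 𝓘(ℝ, ℝ) ∞ u) {w : ℝ → ℝ} (hw : MeasureTheory.LocallyIntegrable w)
    {S : ℝ} (hwS : ∀ t, S < |t| → w t = 0) :
    ContMDiff I 𝓘(ℝ, ℝ) ∞ (fun x => ∫ t, w t * u (φ t x)) := by
  have : IsManifold I 1 N := .of_le (n := ∞) (by simp)
  intro a
  set e := extChartAt I a with he
  -- In a chart the integral is the value at 0 of the convolution of `w` with `g y`, where `b`
  -- provides compact support without affecting times at which `w` is nonzero. Only local
  -- integrability of `w` enters, which admits a weight with a jump.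
  let b : ContDiffBump (0 : ℝ) := ⟨|S| + 1, |S| + 2, by positivity, by linarith⟩
  let g : E → ℝ → ℝ := fun y t => b t * u (φ (-t) (e.symm y))
  have hsymm : ContMDiffOn 𝓘(ℝ, E) I ∞ e.symm e.target := contMDiffOn_extChartAt_symm a
  have hg : ContDiffOn ℝ ∞ (fun z : E × ℝ => g z.1 z.2) (e.target ×ˢ Set.univ) := by
    refine (b.contDiff.comp contDiff_snd).contDiffOn.mul ?_
    rw [← contMDiffOn_iff_contDiffOn]
    have h1 : ContMDiffOn 𝓘(ℝ, E × ℝ) (𝓘(ℝ, ℝ).prod I) ∞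
        (fun z : E × ℝ => (-z.2, e.symm z.1)) (e.target ×ˢ Set.univ) := by
      refine ContMDiffOn.prodMk contDiff_snd.neg.contMDiff.contMDiffOn ?_
      exact hsymm.comp contDiff_fst.contMDiff.contMDiffOn fun z hz => hz.1
    exact (hu.comp hφ).comp_contMDiffOn h1
  have hconv := MeasureTheory.contDiffOn_convolution_right_with_param_comp (n := ⊤) (μ := MeasureTheory.volume)
    (ContinuousLinearMap.mul ℝ ℝ) (s := e.target) (v := fun _ => (0 : ℝ)) contDiffOn_const (f := w)
    (g := g) (k := Metric.closedBall (0 : ℝ) (|S| + 2)) (isOpen_extChartAt_target a)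
    (isCompact_closedBall _ _) (fun y t _ ht => by
      have : b t = 0 := b.zero_of_le_dist (by
        simp only [Metric.mem_closedBall, not_le] at ht
        exact ht.le)
      simp [g, this]) hw hg
  have hF : ContDiffOn ℝ ∞ (fun y => ∫ t, w t * u (φ t (e.symm y))) e.target := by
    refine hconv.congr fun y hy => ?_
    simp only [MeasureTheory.convolution, ContinuousLinearMap.mul_apply', g, zero_sub, neg_neg]
    refine MeasureTheory.integral_congr_ae (Filter.Eventually.of_forall fun t => ?_)
    by_cases ht : S < |t|
    · simp [hwS t ht]
    · have : b (-t) = 1 := b.one_of_mem_closedBall (by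
        rw [Metric.mem_closedBall, Real.dist_eq, sub_zero, abs_neg]
        linarith [le_abs_self S, not_lt.1 ht])
      simp [this]
  have h1 : ContMDiffAt I 𝓘(ℝ, ℝ) ∞ ((fun y => ∫ t, w t * u (φ t (e.symm y))) ∘ e) a :=
    ((hF.contDiffAt ((isOpen_extChartAt_target a).mem_nhds
      (mem_extChartAt_target a))).contMDiffAt).comp a contMDiffAt_extChartAt
  refine h1.congr_of_eventuallyEq ?_
  filter_upwards [extChartAt_source_mem_nhds (I := I) a] with x hx
  simp only [Function.comp_apply]
  rw [he, (extChartAt I a).left_inv hx]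

end CompleteFlow

/-! ### The weight that inverts the flow derivative -/

section Weight

open MeasureTheory

/-- The weight `w` with `∫ w(s) U(s) ds` a primitive, along the flow, of `U - ⟨U⟩`, where the
average is formed with the density `k` supported in `[-S, S]`. -/
def primitiveWeight (k : ℝ → ℝ) (S : ℝ) (s : ℝ) : ℝ :=
  (∫ t in (-S)..s, k t) - Set.indicator (Set.Ioi 0) (fun _ => (1 : ℝ)) s

variable {k : ℝ → ℝ} {S : ℝ}

theorem integral_eq_interval {f : ℝ → ℝ} (hf : ∀ t, S ≤ |t| → f t = 0) {b : ℝ} (hb : S ≤ b) :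
    ∫ t, f t = ∫ t in (-b)..b, f t := by
  refine (intervalIntegral.integral_eq_integral_of_support_subset fun t ht => ?_).symm
  have h1 : |t| < S := by
    by_contra h
    exact ht (hf t (not_lt.1 h))
  have h2 := abs_lt.1 (h1.trans_le hb)
  exact ⟨h2.1, h2.2.le⟩

theorem primitive_of_le (hS : ∀ t, S ≤ |t| → k t = 0) {s : ℝ} (hs : s ≤ -S) :
    ∫ t in (-S)..s, k t = 0 := by
  rw [intervalIntegral.integral_symm, neg_eq_zero]
  refine intervalIntegral.integral_zero_ae (Filter.Eventually.of_forall fun t ht => hS t ?_)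
  rw [Set.uIoc_of_le hs] at ht
  rw [le_abs]
  right
  linarith [ht.2]

theorem primitive_of_ge (hk : Continuous k) (hS : ∀ t, S ≤ |t| → k t = 0) (h1 : ∫ t, k t = 1)
    {s : ℝ} (hs : S ≤ s) : ∫ t in (-S)..s, k t = 1 := by
  rw [← h1, integral_eq_interval hS le_rfl, ← intervalIntegral.integral_add_adjacent_intervals
    (hk.intervalIntegrable (-S) S) (hk.intervalIntegrable S s), add_eq_left]
  refine intervalIntegral.integral_zero_ae (Filter.Eventually.of_forall fun t ht => hS t ?_)
  rw [Set.uIoc_of_le hs] at ht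
  exact le_abs.2 (Or.inl ht.1.le)

theorem primitiveWeight_eq_zero (hk : Continuous k) (hS0 : 0 < S) (hS : ∀ t, S ≤ |t| → k t = 0)
    (h1 : ∫ t, k t = 1) {s : ℝ} (hs : S ≤ |s|) : primitiveWeight k S s = 0 := by
  rcases le_abs.1 hs with h | h
  · rw [primitiveWeight, primitive_of_ge hk hS h1 h,
      Set.indicator_of_mem (show s ∈ Set.Ioi 0 from hS0.trans_le h), sub_self]
  · rw [primitiveWeight, primitive_of_le hS (by linarith),
      Set.indicator_of_notMem (show s ∉ Set.Ioi (0 : ℝ) from fun h' => by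
        have := Set.mem_Ioi.1 h'
        linarith), sub_self]

/-- The primitive of `k` increases from 0 to 1, so the weight lies in [0, 1] up to time 0 and in
[-1, 0] afterwards. -/
theorem abs_primitiveWeight_le (hk : Continuous k) (hS0 : 0 < S) (hk0 : ∀ t, 0 ≤ k t)
    (hS : ∀ t, S ≤ |t| → k t = 0) (h1 : ∫ t, k t = 1) (s : ℝ) : |primitiveWeight k S s| ≤ 1 := by
  by_cases hs : S ≤ |s|
  · rw [primitiveWeight_eq_zero hk hS0 hS h1 hs]; simp
  · have hs' := abs_lt.1 (not_le.1 hs)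
    have hC0 : 0 ≤ ∫ t in (-S)..s, k t :=
      intervalIntegral.integral_nonneg hs'.1.le fun t _ => hk0 t
    have hC1 : ∫ t in (-S)..s, k t ≤ 1 := by
      rw [← primitive_of_ge hk hS h1 le_rfl]
      exact intervalIntegral.integral_mono_interval le_rfl hs'.1.le hs'.2.le
        (Filter.Eventually.of_forall hk0) (hk.intervalIntegrable _ _)
    by_cases h : 0 < s
    · rw [primitiveWeight, Set.indicator_of_mem (show s ∈ Set.Ioi 0 from h), abs_le]
      constructor <;> linarith
    · rw [primitiveWeight, Set.indicator_of_notMem (show s ∉ Set.Ioi 0 from h), abs_le]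
      constructor <;> linarith

theorem continuous_primitive_weight (hk : Continuous k) :
    Continuous fun s => ∫ t in (-S)..s, k t :=
  intervalIntegral.continuous_primitive (fun a b => hk.intervalIntegrable a b) _

theorem locallyIntegrable_primitiveWeight (hk : Continuous k) :
    LocallyIntegrable (primitiveWeight k S) := by
  refine (continuous_primitive_weight hk).locallyIntegrable.sub ?_
  exact (locallyIntegrable_const (1 : ℝ)).indicator measurableSet_Ioi

theorem abs_integral_primitiveWeight_le (hk : Continuous k) (hS0 : 0 < S) (hk0 : ∀ t, 0 ≤ k t)
    (hS : ∀ t, S ≤ |t| → k t = 0) (h1 : ∫ t, k t = 1) {U : ℝ → ℝ} {A : ℝ} (hU : ∀ t, |U t| ≤ A) :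
    |∫ t, primitiveWeight k S t * U t| ≤ A * (2 * S) := by
  rw [integral_eq_interval (S := S) (fun t ht => by
    rw [primitiveWeight_eq_zero hk hS0 hS h1 ht, zero_mul]) le_rfl]
  have := intervalIntegral.norm_integral_le_of_norm_le_const (a := -S) (b := S)
    (f := fun t => primitiveWeight k S t * U t) (C := A) (fun t _ => by
      rw [Real.norm_eq_abs, abs_mul]
      calc |primitiveWeight k S t| * |U t| ≤ 1 * A :=
            mul_le_mul (abs_primitiveWeight_le hk hS0 hk0 hS h1 t) (hU t) (abs_nonneg _) zero_le_one
        _ = A := one_mul A)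
  rw [Real.norm_eq_abs] at this
  convert this using 2
  rw [abs_of_nonneg (by linarith)]
  ring

theorem hasDerivAt_integral_shift {f U : ℝ → ℝ} (hf : Continuous f) {A : ℝ → ℝ}
    (hA : ∀ t, HasDerivAt A (U t) t) (hU : Continuous U) (a b : ℝ) :
    HasDerivAt (fun h => ∫ s in a..b, f s * A (s + h)) (∫ s in a..b, f s * U s) 0 := by
  have hAc : Continuous A := continuous_iff_continuousAt.2 fun t => (hA t).continuousAt
  obtain ⟨B, hB⟩ : ∃ B, ∀ z ∈ Set.uIcc a b ×ˢ Metric.closedBall (0 : ℝ) 1,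
      ‖f z.1 * U (z.1 + z.2)‖ ≤ B :=
    (isCompact_uIcc.prod (isCompact_closedBall _ _)).exists_bound_of_continuousOn
      (f := fun z : ℝ × ℝ => f z.1 * U (z.1 + z.2)) (by fun_prop)
  have := intervalIntegral.hasDerivAt_integral_of_dominated_loc_of_deriv_le (μ := volume)
    (a := a) (b := b)
    (F := fun h s => f s * A (s + h)) (F' := fun h s => f s * U (s + h)) (x₀ := (0 : ℝ))
    (s := Metric.closedBall 0 1) (bound := fun _ => B) (Metric.closedBall_mem_nhds _ one_pos)
    (Filter.Eventually.of_forall fun h =>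
      (by fun_prop : Continuous fun s => f s * A (s + h)).aestronglyMeasurable)
    ((by fun_prop : Continuous fun s => f s * A (s + 0)).intervalIntegrable _ _)
    (by fun_prop : Continuous fun s => f s * U (s + 0)).aestronglyMeasurable
    (Filter.Eventually.of_forall fun s hs h hh => hB (s, h) ⟨Set.uIoc_subset_uIcc hs, hh⟩)
    intervalIntegrable_const
    (Filter.Eventually.of_forall fun s _ h _ => ((hA (s + h)).comp_const_add s h).const_mul (f s))
  simpa using this.2

/-- As a distribution the weight has derivative k minus the Dirac mass at 0; moving the derivative
from U to the weight gives U(0) − ∫kU. Since U is only continuous, it is first replaced by its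
primitive A, which can be differentiated under the integral. -/
theorem hasDerivAt_integral_primitiveWeight (hk : Continuous k) (hS0 : 0 < S)
    (hS : ∀ t, S ≤ |t| → k t = 0) (h1 : ∫ t, k t = 1) {U : ℝ → ℝ} (hU : Continuous U) :
    HasDerivAt (fun h => ∫ s, primitiveWeight k S s * U (s + h)) (U 0 - ∫ s, k s * U s) 0 := by
  let A : ℝ → ℝ := fun t => ∫ s in (0 : ℝ)..t, U s
  have hA : ∀ t, HasDerivAt A (U t) t := fun t =>
    intervalIntegral.integral_hasDerivAt_right (hU.intervalIntegrable _ _)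
      (hU.stronglyMeasurableAtFilter _ _) hU.continuousAt
  have hAc : Continuous A := continuous_iff_continuousAt.2 fun t => (hA t).continuousAt
  let C : ℝ → ℝ := fun s => ∫ t in (-S)..s, k t
  have hC : ∀ t, HasDerivAt C (k t) t := fun t =>
    intervalIntegral.integral_hasDerivAt_right (hk.intervalIntegrable _ _)
      (hk.stronglyMeasurableAtFilter _ _) hk.continuousAt
  have hCc : Continuous C := continuous_iff_continuousAt.2 fun t => (hC t).continuousAt
  have hformula : ∀ h, ∫ s, primitiveWeight k S s * U (s + h) =
      A h - ∫ s in (-S)..S, k s * A (s + h) := by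
    intro h
    have hUh : Continuous fun s => U (s + h) := by fun_prop
    rw [integral_eq_interval (S := S) (fun t ht => by
      rw [primitiveWeight_eq_zero hk hS0 hS h1 ht, zero_mul]) le_rfl]
    have e1 : ∫ s in (-S)..S, primitiveWeight k S s * U (s + h) =
        (∫ s in (-S)..S, C s * U (s + h)) -
          ∫ s in (-S)..S, Set.indicator (Set.Ioi 0) (fun s => U (s + h)) s := by
      rw [← intervalIntegral.integral_sub (f := fun s => C s * U (s + h))
        ((hCc.mul hUh).intervalIntegrable _ _)]
      · refine intervalIntegral.integral_congr fun s _ => ?_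
        simp only [primitiveWeight, C, sub_mul, Set.indicator_apply]
        split_ifs <;> simp
      · rw [intervalIntegrable_iff]
        exact ((hUh.intervalIntegrable (-S) S).def').indicator measurableSet_Ioi
    have e2 : ∫ s in (-S)..S, Set.indicator (Set.Ioi 0) (fun s => U (s + h)) s =
        A (S + h) - A h := by
      rw [← intervalIntegral.integral_add_adjacent_intervals (b := 0)]
      · have z1 : ∫ s in (-S)..0, Set.indicator (Set.Ioi 0) (fun s => U (s + h)) s = 0 := by
          refine intervalIntegral.integral_zero_ae (Filter.Eventually.of_forall fun s hs => ?_)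
          rw [Set.uIoc_of_le (by linarith)] at hs
          exact Set.indicator_of_notMem (not_lt.2 hs.2) _
        have z2 : ∫ s in (0 : ℝ)..S, Set.indicator (Set.Ioi 0) (fun s => U (s + h)) s =
            ∫ s in (0 : ℝ)..S, U (s + h) := by
          refine intervalIntegral.integral_congr_ae (Filter.Eventually.of_forall fun s hs => ?_)
          rw [Set.uIoc_of_le hS0.le] at hs
          exact Set.indicator_of_mem (show s ∈ Set.Ioi 0 from hs.1) _
        rw [z1, z2, zero_add, intervalIntegral.integral_comp_add_right, zero_add]
        exact (intervalIntegral.integral_interval_sub_left (hU.intervalIntegrable _ _)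
          (hU.intervalIntegrable _ _)).symm
      all_goals
        rw [intervalIntegrable_iff]
        exact ((hUh.intervalIntegrable _ _).def').indicator measurableSet_Ioi
    -- Integration by parts, where C(-S) = 0 and C(S) = 1; the boundary term A(S + h) cancels the
    -- one from the jump.
    have e3 : ∫ s in (-S)..S, C s * U (s + h) =
        A (S + h) - ∫ s in (-S)..S, k s * A (s + h) := by
      rw [intervalIntegral.integral_mul_deriv_eq_deriv_mul (u := C) (v := fun s => A (s + h))
        (u' := k) (fun s _ => hC s) (fun s _ => (hA (s + h)).comp_add_const s h)
        (hk.intervalIntegrable _ _) (hUh.intervalIntegrable _ _)]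
      have c1 : C S = 1 := primitive_of_ge hk hS h1 le_rfl
      have c2 : C (-S) = 0 := primitive_of_le hS le_rfl
      rw [c1, c2, one_mul, zero_mul, sub_zero]
    rw [e1, e2, e3]
    ring
  rw [funext hformula, integral_eq_interval (f := fun s => k s * U s) (S := S)
    (fun t ht => by rw [hS t ht, zero_mul]) le_rfl]
  exact (hA 0).sub (hasDerivAt_integral_shift hk hA hU _ _)

end Weight

/-! ### The Hamilton flow and the primitive of u minus its time average -/

section HamiltonFlow

variable {M : Type*} [TopologicalSpace M] [ChartedSpace Plane M]
  [IsManifold 𝓘(ℝ, Plane) ω M]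

theorem hasDerivAt_comp_curve {F : Type*} [NormedAddCommGroup F] [NormedSpace ℝ F]
    {v : (x : Cotangent M) → TangentSpace phaseModel x} {c : ℝ → Cotangent M}
    {f : Cotangent M → F} {t : ℝ}
    (hc : IsMIntegralCurve (I := phaseModel) c v)
    (hf : MDifferentiableAt phaseModel 𝓘(ℝ, F) f (c t)) :
    HasDerivAt (fun s => f (c s)) (modelDeriv f (c t) (v (c t) : PhaseModel)) t := by
  have h1 := hf.hasMFDerivAt.comp t (hc t)
  have h2 : HasFDerivAt (f ∘ c)
      ((modelDeriv f (c t)).comp ((1 : ℝ →L[ℝ] ℝ).smulRight (v (c t) : PhaseModel))) t :=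
    hasMFDerivAt_iff_hasFDerivAt.1 h1
  have h3 : ∀ u : PhaseModel, ((1 : ℝ →L[ℝ] ℝ).smulRight u) 1 = u := fun u => by simp
  exact h2.hasDerivAt.congr_deriv (congrArg (modelDeriv f (c t)) (h3 _))

theorem contMDiff_smul_hamiltonField {p f : Cotangent M → ℝ}
    (hp : ContMDiff phaseModel 𝓘(ℝ, ℝ) ∞ p) (hf : ContMDiff phaseModel 𝓘(ℝ, ℝ) ∞ f) :
    ContMDiff phaseModel phaseModel.tangent ∞
      (fun m => (⟨m, f m • hamiltonField p m⟩ : TangentBundle phaseModel (Cotangent M))) :=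
  hf.smul_section (contMDiff_hamiltonField hp)

/-- The Hamilton flow near a compact energy surface, as a smooth globally defined flow. -/
theorem exists_hamilton_flow [T2Space M] {p : Cotangent M → ℝ}
    (hp : ContMDiff phaseModel 𝓘(ℝ, ℝ) ∞ p) (hc : ∃ c : ℝ, 0 < c ∧ IsCompact {m | |p m| ≤ c}) :
    ∃ φ : ℝ → Cotangent M → Cotangent M, (∀ x, φ 0 x = x) ∧
      (∀ s t x, φ (s + t) x = φ s (φ t x)) ∧
      ContMDiff (𝓘(ℝ, ℝ).prod phaseModel) phaseModel ∞
        (fun z : ℝ × Cotangent M => φ z.1 z.2) ∧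
      ∀ ρ, p ρ = 0 → (∀ t, p (φ t ρ) = 0) ∧ (∀ t, hamiltonFlow p t ρ = φ t ρ) ∧
        IsMIntegralCurve (I := phaseModel) (fun t => φ t ρ) (hamiltonField p) := by
  have : IsManifold phaseModel ∞ (Cotangent M) := .of_le (n := ω) le_top
  obtain ⟨c, hc0, hS⟩ := hc
  -- The field b(p) H_p vanishes outside the compact set |p| ≤ c, hence is complete. It still
  -- conserves p and coincides with H_p on p = 0, so its orbits there are orbits of H_p.
  let b : ContDiffBump (0 : ℝ) := ⟨c / 2, c, by positivity, by linarith⟩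
  let f : Cotangent M → ℝ := fun m => b (p m)
  have hf : ContMDiff phaseModel 𝓘(ℝ, ℝ) ∞ f := b.contDiff.contMDiff.comp hp
  let v : (m : Cotangent M) → TangentSpace phaseModel m := fun m => f m • hamiltonField p m
  have hv := contMDiff_smul_hamiltonField hp hf
  obtain ⟨φ, h0, hcurve, hgroup, hsmooth⟩ := exists_smooth_flow (v := v) hv hS (fun m hm => by
    have h1 : f m = 0 := b.zero_of_le_dist (by
      rw [Real.dist_eq, sub_zero]
      exact (not_le.1 hm).le)
    show f m • hamiltonField p m = 0
    rw [h1, zero_smul])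
  refine ⟨φ, h0, hgroup, hsmooth, fun ρ hρ => ?_⟩
  have henergy : ∀ t, p (φ t ρ) = 0 := by
    have hd : ∀ t, HasDerivAt (fun s => p (φ s ρ)) 0 t := by
      intro t
      have h1 := hasDerivAt_comp_curve (hcurve ρ) (hp.mdifferentiable (by simp) (φ t ρ))
      have h2 : modelDeriv p (φ t ρ) (v (φ t ρ) : PhaseModel) =
          f (φ t ρ) • modelDeriv p (φ t ρ) (hamiltonVec p (φ t ρ)) := map_smul _ _ _
      rw [h2, modelDeriv_hamiltonVec_self, smul_zero] at h1
      exact h1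
    intro t
    have := is_const_of_deriv_eq_zero (fun s => (hd s).differentiableAt) (fun s => (hd s).deriv) t 0
    simpa [h0, hρ] using this
  have hint : IsMIntegralCurve (I := phaseModel) (fun t => φ t ρ) (hamiltonField p) := by
    intro t
    have h1 := hcurve ρ t
    have h2 : v (φ t ρ) = hamiltonField p (φ t ρ) := by
      have : f (φ t ρ) = 1 := b.one_of_mem_closedBall (by
        rw [henergy t]; exact Metric.mem_closedBall_self b.rIn_pos.le)
      show f (φ t ρ) • hamiltonField p (φ t ρ) = _
      rw [this, one_smul]
    rw [h2] at h1
    exact h1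
  refine ⟨henergy, fun t => ?_, hint⟩
  have hex : ∃ c : ℝ → Cotangent M, c 0 = ρ ∧
      IsMIntegralCurve (I := phaseModel) c (hamiltonField p) := ⟨_, h0 ρ, hint⟩
  rw [hamiltonFlow, dif_pos hex]
  -- Uniqueness of integral curves makes the choice in the definition of the flow immaterial.
  exact congrFun (IsMIntegralCurve.eq_of_eq_zero (contMDiff_hamiltonField hp) hex.choose_spec.2
    hint (by rw [hex.choose_spec.1, h0])) t

/-- The equation `H_p G = u - ⟨u⟩_{T,K}` on the energy surface, with a bound `O(T)`. -/
theorem exists_average_primitive [T2Space M] {p : Cotangent M → ℝ}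
    (hp : ContMDiff phaseModel 𝓘(ℝ, ℝ) ∞ p) (hc : ∃ c : ℝ, 0 < c ∧ IsCompact {m | |p m| ≤ c})
    {u : Cotangent M → ℝ} (hu : ContMDiff phaseModel 𝓘(ℝ, ℝ) ∞ u) {A : ℝ}
    (hA : ∀ ρ, p ρ = 0 → |u ρ| ≤ A) {K : ℝ → ℝ} (hK : Continuous K) (hK0 : ∀ t, 0 ≤ K t)
    (hK1 : ∫ t, K t = 1) {S : ℝ} (hS0 : 0 < S) (hKS : ∀ t, S ≤ |t| → K t = 0) {T : ℝ}
    (hT : 0 < T) :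
    ∃ G : Cotangent M → ℝ, ContMDiff phaseModel 𝓘(ℝ, ℝ) ∞ G ∧
      (∀ ρ, p ρ = 0 → modelDeriv G ρ (hamiltonVec p ρ) = u ρ - flowAverage p K T u ρ) ∧
      ∀ ρ, p ρ = 0 → |G ρ| ≤ A * (2 * (S * T)) := by
  have : IsManifold phaseModel ∞ (Cotangent M) := .of_le (n := ω) le_top
  obtain ⟨φ, h0, hgroup, hsmooth, hφ⟩ := exists_hamilton_flow hp hc
  -- The density of the flow average, reflection included. It has mass 1 and vanishes for |t| ≥ ST;
  -- the bound on G is the length 2ST of this interval times the bound on u.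
  let k : ℝ → ℝ := fun t => T⁻¹ * K (-t / T)
  have hk : Continuous k := by fun_prop
  have hk0 : ∀ t, 0 ≤ k t := fun t => mul_nonneg (by positivity) (hK0 _)
  have hkS : ∀ t, S * T ≤ |t| → k t = 0 := fun t ht => by
    have : K (-t / T) = 0 := hKS _ (by
      rw [abs_div, abs_neg, abs_of_pos hT, le_div_iff₀ hT]; exact ht)
    simp [k, this]
  have hk1 : ∫ t, k t = 1 := by
    have h1 : ∫ t, K (-t / T) = T := by
      have : (fun t => K (-t / T)) = fun t => K ((-T)⁻¹ * t) := by
        funext t; congr 1; field_simp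
      rw [this, MeasureTheory.Measure.integral_comp_mul_left, hK1]
      simp [abs_of_pos hT]
    simp only [k]
    rw [MeasureTheory.integral_const_mul, h1, inv_mul_cancel₀ hT.ne']
  have hST : 0 < S * T := by positivity
  have hUc : ∀ ρ, Continuous fun t => u (φ t ρ) := fun ρ =>
    hu.continuous.comp (hsmooth.continuous.comp (continuous_id.prodMk continuous_const))
  refine ⟨fun x => ∫ t, primitiveWeight k (S * T) t * u (φ t x),
    contMDiff_flow_integral hsmooth hu (locallyIntegrable_primitiveWeight hk)
      (S := S * T) (fun t ht => primitiveWeight_eq_zero hk hST hkS hk1 ht.le), ?_, ?_⟩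
  · intro ρ hρ
    obtain ⟨-, hflow, hint⟩ := hφ ρ hρ
    have hG := contMDiff_flow_integral hsmooth hu
      (locallyIntegrable_primitiveWeight (S := S * T) hk)
      (S := S * T) (fun t ht => primitiveWeight_eq_zero hk hST hkS hk1 ht.le)
    have h1 : HasDerivAt (fun s => ∫ t, primitiveWeight k (S * T) t * u (φ t (φ s ρ)))
        (modelDeriv (fun x => ∫ t, primitiveWeight k (S * T) t * u (φ t x)) (φ 0 ρ)
          (hamiltonVec p (φ 0 ρ))) 0 :=
      hasDerivAt_comp_curve (t := 0) hint (hG.mdifferentiable (by simp) (φ 0 ρ))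
    have h2 := hasDerivAt_integral_primitiveWeight hk hST hkS hk1 (hUc ρ)
    have h3 : (fun h => ∫ s, primitiveWeight k (S * T) s * u (φ (s + h) ρ)) =
        fun h => ∫ s, primitiveWeight k (S * T) s * u (φ s (φ h ρ)) := by
      funext h
      simp only [hgroup]
    rw [h3] at h2
    have h4 := h1.unique h2
    simp only [h0] at h4
    rw [h4, flowAverage]
    simp only [hflow, k]
  · intro ρ hρ
    exact abs_integral_primitiveWeight_le hk hST hk0 hkS hk1 fun t => hA _ ((hφ ρ hρ).1 t)

end HamiltonFlow

/-! ### Symplectic geometry of canonical tubes -/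

section TubeGeometry

variable {M : Type*} [TopologicalSpace M] [ChartedSpace Plane M] [IsManifold 𝓘(ℝ, Plane) ω M]

theorem IsCanonicalTube.of_le {m n : WithTop ℕ∞} {γ : Plane → Cotangent M} {R : ℝ}
    {Ψ : Plane × Plane → Cotangent M} (h : IsCanonicalTube n γ R Ψ) (hmn : m ≤ n) :
    IsCanonicalTube m γ R Ψ :=
  ⟨h.radius_pos, h.smooth.of_le hmn, h.eq_iff, h.symplectic, h.zero_section⟩

theorem isOpen_strip (R : ℝ) : IsOpen {z : Plane × Plane | ‖z.2‖ < R} :=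
  isOpen_lt continuous_snd.norm continuous_const

/-- The derivative of a tube parametrization, as a map of the model spaces. -/
def tubeDeriv (Ψ : Plane × Plane → Cotangent M) (z : Plane × Plane) :
    Plane × Plane →L[ℝ] PhaseModel := mfderiv 𝓘(ℝ, Plane × Plane) phaseModel Ψ z

/-- The Hamilton field on `ℝ² × ℝ²` determined by a covector. -/
def planeGrad (l : Plane × Plane →L[ℝ] ℝ) : Plane × Plane :=
  (!₂[l (0, EuclideanSpace.single 0 1), l (0, EuclideanSpace.single 1 1)],
    !₂[-l (EuclideanSpace.single 0 1, 0), -l (EuclideanSpace.single 1 1, 0)])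

theorem plane_eq_sum (x : Plane) :
    x = x 0 • EuclideanSpace.single 0 (1 : ℝ) + x 1 • EuclideanSpace.single 1 (1 : ℝ) := by
  ext j; fin_cases j <;> simp

theorem covector_apply_eq (l : Plane × Plane →L[ℝ] ℝ) (v : Plane × Plane) :
    l v = v.1 0 * l (EuclideanSpace.single 0 1, 0) + v.1 1 * l (EuclideanSpace.single 1 1, 0) +
      (v.2 0 * l (0, EuclideanSpace.single 0 1) + v.2 1 * l (0, EuclideanSpace.single 1 1)) := by
  have h : v = v.1 0 • ((EuclideanSpace.single 0 1, 0) : Plane × Plane) +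
      v.1 1 • ((EuclideanSpace.single 1 1, 0) : Plane × Plane) +
      (v.2 0 • ((0, EuclideanSpace.single 0 1) : Plane × Plane) +
      v.2 1 • ((0, EuclideanSpace.single 1 1) : Plane × Plane)) := by
    apply Prod.ext
    · simpa using plane_eq_sum v.1
    · simpa using plane_eq_sum v.2
  conv_lhs => rw [h]
  simp only [map_add, map_smul, smul_eq_mul]

theorem plane_inner (x y : Plane) : inner ℝ x y = x 0 * y 0 + x 1 * y 1 := by
  simp [PiLp.inner_apply, Fin.sum_univ_two, mul_comm]

theorem planeForm_planeGrad (l : Plane × Plane →L[ℝ] ℝ) (v : Plane × Plane) :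
    inner ℝ v.2 (planeGrad l).1 - inner ℝ (planeGrad l).2 v.1 = l v := by
  rw [covector_apply_eq l v, plane_inner, plane_inner]
  simp [planeGrad]
  ring

theorem finrank_phaseModel : Module.finrank ℝ (Plane × Plane) = Module.finrank ℝ PhaseModel := by
  have h : Module.finrank ℝ (Plane →L[ℝ] ℝ) = Module.finrank ℝ Plane := by
    rw [← (LinearMap.toContinuousLinearMap (𝕜 := ℝ) (E := Plane) (F' := ℝ)).finrank_eq]
    exact Subspace.dual_finrank_eq
  rw [Module.finrank_prod, Module.finrank_prod, h]

namespace IsCanonicalTube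

variable {γ : Plane → Cotangent M} {R : ℝ} {Ψ : Plane × Plane → Cotangent M}

theorem stdForm_tubeDeriv {n : WithTop ℕ∞} (hT : IsCanonicalTube n γ R Ψ) {z : Plane × Plane}
    (hz : ‖z.2‖ < R) (v w : Plane × Plane) :
    stdForm (tubeDeriv Ψ z v) (tubeDeriv Ψ z w) = inner ℝ v.2 w.1 - inner ℝ w.2 v.1 :=
  hT.symplectic z hz v w

/-- Pairing v with (v.2, -v.1) gives |v.1|² + |v.2|², so a map that preserves the form has no
kernel. -/
theorem injective_tubeDeriv {n : WithTop ℕ∞} (hT : IsCanonicalTube n γ R Ψ) {z : Plane × Plane}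
    (hz : ‖z.2‖ < R) : Function.Injective (tubeDeriv Ψ z) := by
  rw [injective_iff_map_eq_zero]
  intro v hv
  have h := hT.stdForm_tubeDeriv hz v (v.2, -v.1)
  rw [hv] at h
  simp only [stdForm, real_inner_self_eq_norm_sq, inner_neg_left] at h
  simp only [Prod.snd_zero, zero_apply, Prod.fst_zero, map_zero, sub_zero] at h
  have h1 : ‖v.2‖ ^ 2 = 0 := by nlinarith [sq_nonneg ‖v.1‖, sq_nonneg ‖v.2‖]
  have h2 : ‖v.1‖ ^ 2 = 0 := by nlinarith [sq_nonneg ‖v.1‖, sq_nonneg ‖v.2‖]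
  exact Prod.ext (norm_eq_zero.1 (pow_eq_zero_iff two_ne_zero |>.1 h2))
    (norm_eq_zero.1 (pow_eq_zero_iff two_ne_zero |>.1 h1))

theorem exists_equiv {n : WithTop ℕ∞} (hT : IsCanonicalTube n γ R Ψ) {z : Plane × Plane}
    (hz : ‖z.2‖ < R) : ∃ e : (Plane × Plane) ≃L[ℝ] PhaseModel,
      (e : Plane × Plane →L[ℝ] PhaseModel) = tubeDeriv Ψ z := by
  let e := LinearEquiv.ofInjectiveOfFinrankEq ((tubeDeriv Ψ z : Plane × Plane →ₗ[ℝ] PhaseModel))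
    (hT.injective_tubeDeriv hz) finrank_phaseModel
  exact ⟨e.toContinuousLinearEquiv, ContinuousLinearMap.ext fun _ => rfl⟩

theorem contMDiffAt (hT : IsCanonicalTube ∞ γ R Ψ) {z : Plane × Plane} (hz : ‖z.2‖ < R) :
    ContMDiffAt 𝓘(ℝ, Plane × Plane) phaseModel ∞ Ψ z :=
  hT.smooth.contMDiffAt ((isOpen_strip R).mem_nhds hz)

theorem hasFDerivAt_comp {F : Type*} [NormedAddCommGroup F] [NormedSpace ℝ F]
    (hT : IsCanonicalTube ∞ γ R Ψ) {z : Plane × Plane} (hz : ‖z.2‖ < R) {f : Cotangent M → F}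
    (hf : MDifferentiableAt phaseModel 𝓘(ℝ, F) f (Ψ z)) :
    HasFDerivAt (fun w => f (Ψ w)) ((modelDeriv f (Ψ z)).comp (tubeDeriv Ψ z)) z := by
  have h1 := hf.hasMFDerivAt.comp z ((hT.contMDiffAt hz).mdifferentiableAt (by simp)).hasMFDerivAt
  exact hasMFDerivAt_iff_hasFDerivAt.1 h1

theorem modelDeriv_tubeDeriv {F : Type*} [NormedAddCommGroup F] [NormedSpace ℝ F]
    (hT : IsCanonicalTube ∞ γ R Ψ) {z : Plane × Plane} (hz : ‖z.2‖ < R) {f : Cotangent M → F}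
    (hf : MDifferentiableAt phaseModel 𝓘(ℝ, F) f (Ψ z)) (v : Plane × Plane) :
    modelDeriv f (Ψ z) (tubeDeriv Ψ z v) = fderiv ℝ (fun w => f (Ψ w)) z v := by
  rw [(hT.hasFDerivAt_comp hz hf).fderiv]
  rfl

/-- The Hamilton field in the canonical coordinates of a tube. -/
theorem hamiltonVec_eq (hT : IsCanonicalTube ∞ γ R Ψ) {z : Plane × Plane} (hz : ‖z.2‖ < R)
    {p : Cotangent M → ℝ} (hp : MDifferentiableAt phaseModel 𝓘(ℝ, ℝ) p (Ψ z)) :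
    hamiltonVec p (Ψ z) = tubeDeriv Ψ z (planeGrad (fderiv ℝ (fun w => p (Ψ w)) z)) := by
  obtain ⟨e, he⟩ := hT.exists_equiv hz
  refine eq_of_stdForm_eq fun w => ?_
  have hw : w = tubeDeriv Ψ z (e.symm w) := by rw [← he]; simp
  rw [hw, stdForm_hamiltonVec, hT.modelDeriv_tubeDeriv hz hp, hT.stdForm_tubeDeriv hz,
    planeForm_planeGrad]

theorem modelDeriv_hamiltonVec {F : Type*} [NormedAddCommGroup F] [NormedSpace ℝ F]
    (hT : IsCanonicalTube ∞ γ R Ψ) {z : Plane × Plane} (hz : ‖z.2‖ < R)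
    {p : Cotangent M → ℝ} (hp : MDifferentiableAt phaseModel 𝓘(ℝ, ℝ) p (Ψ z))
    {f : Cotangent M → F} (hf : MDifferentiableAt phaseModel 𝓘(ℝ, F) f (Ψ z)) :
    modelDeriv f (Ψ z) (hamiltonVec p (Ψ z)) =
      fderiv ℝ (fun w => f (Ψ w)) z (planeGrad (fderiv ℝ (fun w => p (Ψ w)) z)) := by
  rw [hT.hamiltonVec_eq hz hp, hT.modelDeriv_tubeDeriv hz hf]

/-- The inverse function theorem in the chart at `Ψ z`. As Ψ is periodic in x it has no global
inverse; local sections are enough, and they make the single-valued coordinate ξ smooth. -/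
theorem exists_local_inverse (hT : IsCanonicalTube ∞ γ R Ψ) {z : Plane × Plane}
    (hz : ‖z.2‖ < R) : ∃ σ : Cotangent M → Plane × Plane,
      ContMDiffAt phaseModel 𝓘(ℝ, Plane × Plane) ∞ σ (Ψ z) ∧ σ (Ψ z) = z ∧
        ∀ᶠ m in 𝓝 (Ψ z), Ψ (σ m) = m := by
  obtain ⟨e, he⟩ := hT.exists_equiv hz
  have hΨ := hT.contMDiffAt hz
  let f : Plane × Plane → PhaseModel := fun w => extChartAt phaseModel (Ψ z) (Ψ w)
  have hf : ContDiffAt ℝ ∞ f z :=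
    (contMDiffAt_extChartAt.comp z hΨ : ContMDiffAt _ 𝓘(ℝ, PhaseModel) ∞ _ z).contDiffAt
  have hd : HasFDerivAt f (e : Plane × Plane →L[ℝ] PhaseModel) z := by
    rw [he]
    have h1 : HasFDerivWithinAt f (tubeDeriv Ψ z) Set.univ z :=
      (hΨ.mdifferentiableAt (by simp)).hasMFDerivAt.2.mono (by simp)
    exact hasFDerivWithinAt_univ.1 h1
  let τ := hf.localInverse hd (by simp)
  have hτ : ContDiffAt ℝ ∞ τ (f z) := hf.to_localInverse hd (by simp)
  have hτz : τ (f z) = z := hf.localInverse_apply_image hd (by simp)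
  have hσ : ContMDiffAt phaseModel 𝓘(ℝ, Plane × Plane) ∞
      (fun m => τ (extChartAt phaseModel (Ψ z) m)) (Ψ z) :=
    hτ.contMDiffAt.comp (Ψ z) contMDiffAt_extChartAt
  refine ⟨_, hσ, hτz, ?_⟩
  have h1 : ∀ᶠ y in 𝓝 (f z), f (τ y) = y :=
    (hf.hasStrictFDerivAt' hd (by simp)).eventually_right_inverse
  have h2 : ∀ᶠ m in 𝓝 (Ψ z), f (τ (extChartAt phaseModel (Ψ z) m)) =
      extChartAt phaseModel (Ψ z) m := (continuousAt_extChartAt (I := phaseModel) (Ψ z)).eventually h1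
  have h3 : ∀ᶠ m in 𝓝 (Ψ z), m ∈ (extChartAt phaseModel (Ψ z)).source :=
    extChartAt_source_mem_nhds (Ψ z)
  have h4 : ∀ᶠ m in 𝓝 (Ψ z), Ψ (τ (extChartAt phaseModel (Ψ z) m)) ∈
      (extChartAt phaseModel (Ψ z)).source := by
    have hc : ContinuousAt (fun m => Ψ (τ (extChartAt phaseModel (Ψ z) m))) (Ψ z) := by
      refine ContinuousAt.comp (g := Ψ) ?_ hσ.continuousAt
      show ContinuousAt Ψ (τ (f z))
      rw [hτz]
      exact hΨ.continuousAt
    refine hc.eventually_mem ?_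
    show _ ∈ 𝓝 (Ψ (τ (f z)))
    rw [hτz]
    exact extChartAt_source_mem_nhds (Ψ z)
  filter_upwards [h2, h3, h4] with m hm2 hm3 hm4
  exact (extChartAt phaseModel (Ψ z)).injOn hm4 hm3 hm2

theorem image_mem_nhds (hT : IsCanonicalTube ∞ γ R Ψ) {z : Plane × Plane} (hz : ‖z.2‖ < R)
    {s : Set (Plane × Plane)} (hs : s ∈ 𝓝 z) : Ψ '' s ∈ 𝓝 (Ψ z) := by
  obtain ⟨σ, hσ, hσz, hΨσ⟩ := hT.exists_local_inverse hz
  have h : ∀ᶠ m in 𝓝 (Ψ z), σ m ∈ s := hσ.continuousAt.eventually_mem (by rwa [hσz])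
  filter_upwards [h, hΨσ] with m h1 h2
  exact ⟨σ m, h1, h2⟩

theorem isOpen_image (hT : IsCanonicalTube ∞ γ R Ψ) {s : Set (Plane × Plane)} (hs : IsOpen s)
    (hR : ∀ z ∈ s, ‖z.2‖ < R) : IsOpen (Ψ '' s) := by
  rw [isOpen_iff_mem_nhds]
  rintro _ ⟨z, hz, rfl⟩
  exact hT.image_mem_nhds (hR z hz) (hs.mem_nhds hz)

end IsCanonicalTube

open Classical in
/-- The coordinate `ξ` of a canonical tube. -/
def fiberCoord (R : ℝ) (Ψ : Plane × Plane → Cotangent M) (m : Cotangent M) : Plane :=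
  if h : ∃ z : Plane × Plane, ‖z.2‖ < R ∧ Ψ z = m then h.choose.2 else 0

namespace IsCanonicalTube

variable {γ : Plane → Cotangent M} {R : ℝ} {Ψ : Plane × Plane → Cotangent M}

theorem fiberCoord_apply {n : WithTop ℕ∞} (hT : IsCanonicalTube n γ R Ψ) {z : Plane × Plane}
    (hz : ‖z.2‖ < R) : fiberCoord R Ψ (Ψ z) = z.2 := by
  have h : ∃ w : Plane × Plane, ‖w.2‖ < R ∧ Ψ w = Ψ z := ⟨z, hz, rfl⟩
  rw [fiberCoord, dif_pos h]
  exact ((hT.eq_iff _ _ h.choose_spec.1 hz).1 h.choose_spec.2).2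

theorem contMDiffAt_fiberCoord (hT : IsCanonicalTube ∞ γ R Ψ) {z : Plane × Plane}
    (hz : ‖z.2‖ < R) : ContMDiffAt phaseModel 𝓘(ℝ, Plane) ∞ (fiberCoord R Ψ) (Ψ z) := by
  obtain ⟨σ, hσ, hσz, hΨσ⟩ := hT.exists_local_inverse hz
  have h1 : ContMDiffAt phaseModel 𝓘(ℝ, Plane) ∞ (fun m => (σ m).2) (Ψ z) :=
    (contDiff_snd.contMDiff (n := ∞)).contMDiffAt.comp (Ψ z) hσ
  refine h1.congr_of_eventuallyEq ?_
  have h2 : ∀ᶠ m in 𝓝 (Ψ z), ‖(σ m).2‖ < R :=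
    hσ.continuousAt.eventually_mem (by rw [hσz]; exact (isOpen_strip R).mem_nhds hz)
  filter_upwards [h2, hΨσ] with m hm2 hm
  conv_lhs => rw [← hm]
  exact hT.fiberCoord_apply hm2

end IsCanonicalTube

/-! ### Uniform bounds from periodicity -/

section Periodic

/-- The compact cube `[0, 2π]²`. -/
def torusCube : Set Plane := (EuclideanSpace.equiv (Fin 2) ℝ).symm '' Set.Icc 0 (fun _ => 2 * Real.pi)

theorem isCompact_torusCube : IsCompact torusCube :=
  isCompact_Icc.image (EuclideanSpace.equiv (Fin 2) ℝ).symm.continuous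

theorem exists_sameTorusPoint (x : Plane) : ∃ y ∈ torusCube, SameTorusPoint x y := by
  have hpi := Real.two_pi_pos
  refine ⟨(EuclideanSpace.equiv (Fin 2) ℝ).symm fun i => toIcoMod hpi 0 (x i),
    Set.mem_image_of_mem _ ⟨fun i => ?_, fun i => ?_⟩, fun i => toIcoDiv hpi 0 (x i), fun i => ?_⟩
  · exact left_le_toIcoMod hpi 0 (x i)
  · have := (toIcoMod_lt_right hpi 0 (x i)).le
    simpa using this
  · have := toIcoMod_add_toIcoDiv_zsmul hpi 0 (x i)
    simp only [zsmul_eq_mul] at this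
    show x i - toIcoMod hpi 0 (x i) = _
    linarith

/-- A function on the strip `|ξ| < R` that is `2πℤ²`-periodic in `x`. -/
def StripPeriodic {F : Type*} (R : ℝ) (f : Plane × Plane → F) : Prop :=
  ∀ x y ξ : Plane, ‖ξ‖ < R → SameTorusPoint x y → f (x, ξ) = f (y, ξ)

/-- Modulo periods a closed substrip is a compact cube times a ball; this is why all later constants
are uniform in x. -/
theorem StripPeriodic.exists_bound {F : Type*} [SeminormedAddCommGroup F] {R : ℝ}
    {f : Plane × Plane → F} (hf : StripPeriodic R f)
    (hc : ContinuousOn f {z | ‖z.2‖ < R}) {ρ : ℝ} (hρ : ρ < R) :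
    ∃ B, 0 ≤ B ∧ ∀ z : Plane × Plane, ‖z.2‖ ≤ ρ → ‖f z‖ ≤ B := by
  obtain ⟨B, hB⟩ := (isCompact_torusCube.prod
    (isCompact_closedBall (0 : Plane) ρ)).exists_bound_of_continuousOn (f := f)
    (hc.mono fun z hz => by
      have := mem_closedBall_zero_iff.1 hz.2
      exact this.trans_lt hρ)
  refine ⟨max B 0, le_max_right _ _, fun z hz => ?_⟩
  obtain ⟨y, hy, hxy⟩ := exists_sameTorusPoint z.1
  rw [show z = (z.1, z.2) from rfl, hf z.1 y z.2 (hz.trans_lt hρ) hxy]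
  exact (hB (y, z.2) ⟨hy, mem_closedBall_zero_iff.2 hz⟩).trans (le_max_left _ _)

theorem StripPeriodic.periodic_fderiv {F : Type*} [NormedAddCommGroup F] [NormedSpace ℝ F] {R : ℝ}
    {f : Plane × Plane → F} (hf : StripPeriodic R f) : StripPeriodic R (fderiv ℝ f) := by
  intro x y ξ hξ hxy
  have h1 : f =ᶠ[𝓝 (x, ξ)] fun z => f (z + (y - x, 0)) := by
    filter_upwards [(isOpen_strip R).mem_nhds (show ‖(x, ξ).2‖ < R from hξ)] with z hz
    have : z + (y - x, 0) = (z.1 + (y - x), z.2) := by ext1 <;> simp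
    rw [this, show z = (z.1, z.2) from rfl]
    refine hf _ _ _ hz ?_
    obtain ⟨k, hk⟩ := hxy
    refine ⟨k, fun i => ?_⟩
    rw [← hk i]
    simp
  rw [h1.fderiv_eq, fderiv_comp_add_right]
  congr 1
  ext1 <;> simp

theorem IsCanonicalTube.stripPeriodic {n : WithTop ℕ∞} {γ : Plane → Cotangent M} {R : ℝ}
    {Ψ : Plane × Plane → Cotangent M} (hT : IsCanonicalTube n γ R Ψ) : StripPeriodic R Ψ :=
  fun x y ξ hξ hxy => (hT.eq_iff (x, ξ) (y, ξ) hξ hξ).2 ⟨hxy, rfl⟩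

theorem IsCanonicalTube.stripPeriodic_comp {F : Type*} {n : WithTop ℕ∞} {γ : Plane → Cotangent M}
    {R : ℝ} {Ψ : Plane × Plane → Cotangent M} (hT : IsCanonicalTube n γ R Ψ)
    (f : Cotangent M → F) : StripPeriodic R (fun z => f (Ψ z)) :=
  fun x y ξ hξ hxy => congrArg f (hT.stripPeriodic x y ξ hξ hxy)

theorem StripPeriodic.mono {F : Type*} {R ρ : ℝ} {f : Plane × Plane → F} (hf : StripPeriodic R f)
    (h : ρ ≤ R) : StripPeriodic ρ f := fun x y ξ hξ hxy => hf x y ξ (hξ.trans_le h) hxy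

/-- The image of a compact set of fibre coordinates is compact. -/
theorem IsCanonicalTube.isCompact_image {γ : Plane → Cotangent M} {R : ℝ}
    {Ψ : Plane × Plane → Cotangent M} (hT : IsCanonicalTube ∞ γ R Ψ) {s : Set (Plane × Plane)}
    (hs : IsClosed s) {ρ : ℝ} (hρ : ρ < R) (hsρ : ∀ z ∈ s, ‖z.2‖ ≤ ρ)
    (hper : ∀ x y ξ, SameTorusPoint x y → (x, ξ) ∈ s → (y, ξ) ∈ s) : IsCompact (Ψ '' s) := by
  have h : Ψ '' s = Ψ '' (s ∩ torusCube ×ˢ Metric.closedBall 0 ρ) := by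
    refine Set.Subset.antisymm ?_ (Set.image_mono Set.inter_subset_left)
    rintro _ ⟨z, hz, rfl⟩
    obtain ⟨y, hy, hxy⟩ := exists_sameTorusPoint z.1
    refine ⟨(y, z.2), ⟨hper _ _ _ hxy hz, hy, mem_closedBall_zero_iff.2 (hsρ z hz)⟩, ?_⟩
    exact (hT.stripPeriodic z.1 y z.2 ((hsρ z hz).trans_lt hρ) hxy).symm
  rw [h]
  refine ((isCompact_torusCube.prod (isCompact_closedBall _ _)).inter_left hs).image_of_continuousOn
    (hT.smooth.continuousOn.mono fun z hz => (hsρ z hz.1).trans_lt hρ)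

end Periodic

end TubeGeometry

/-! ### Taylor estimates and vanishing of derivatives -/

section Interpolation

variable {F : Type*} [NormedAddCommGroup F] [NormedSpace ℝ F]

theorem convex_strip (ρ : ℝ) : Convex ℝ {z : Plane × Plane | ‖z.2‖ ≤ ρ} := by
  have : {z : Plane × Plane | ‖z.2‖ ≤ ρ} =
      (ContinuousLinearMap.snd ℝ Plane Plane) ⁻¹' Metric.closedBall 0 ρ := by
    ext z; simp
  rw [this]
  exact (convex_closedBall _ _).linear_preimage (ContinuousLinearMap.snd ℝ Plane Plane).toLinearMap

theorem contDiffAt_of_strip {R : ℝ} {f : Plane × Plane → F}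
    (hs : ContDiffOn ℝ ∞ f {z | ‖z.2‖ < R}) {z : Plane × Plane} (hz : ‖z.2‖ < R) :
    ContDiffAt ℝ ∞ f z := hs.contDiffAt ((isOpen_strip R).mem_nhds hz)

theorem StripPeriodic.lipschitz {R : ℝ} {f : Plane × Plane → F} (hf : StripPeriodic R f)
    (hs : ContDiffOn ℝ ∞ f {z | ‖z.2‖ < R}) {ρ : ℝ} (hρ : ρ < R) :
    ∃ B, 0 ≤ B ∧ ∀ z w : Plane × Plane, ‖z.2‖ ≤ ρ → ‖w.2‖ ≤ ρ → ‖f w - f z‖ ≤ B * ‖w - z‖ := by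
  obtain ⟨B, hB0, hB⟩ := hf.periodic_fderiv.exists_bound
    (hs.continuousOn_fderiv_of_isOpen (isOpen_strip R) (by simp)) hρ
  refine ⟨B, hB0, fun z w hz hw => ?_⟩
  exact (convex_strip ρ).norm_image_sub_le_of_norm_fderiv_le
    (fun y hy => (contDiffAt_of_strip hs (lt_of_le_of_lt hy hρ)).differentiableAt (by simp))
    (fun y hy => hB y hy) hz hw

theorem StripPeriodic.taylor {R : ℝ} {f : Plane × Plane → F} (hf : StripPeriodic R f)
    (hs : ContDiffOn ℝ ∞ f {z | ‖z.2‖ < R}) {ρ : ℝ} (hρ : ρ < R) :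
    ∃ B, 0 ≤ B ∧ ∀ z w : Plane × Plane, ‖z.2‖ ≤ ρ → ‖w.2‖ ≤ ρ →
      ‖fderiv ℝ f w - fderiv ℝ f z‖ ≤ B * ‖w - z‖ ∧
      ‖f w - f z - fderiv ℝ f z (w - z)‖ ≤ B * ‖w - z‖ ^ 2 := by
  obtain ⟨B, hB0, hB⟩ := hf.periodic_fderiv.lipschitz
    (hs.fderiv_of_isOpen (isOpen_strip R) (by simp)) hρ
  refine ⟨B, hB0, fun z w hz hw => ⟨hB z w hz hw, ?_⟩⟩
  have hseg : segment ℝ z w ⊆ {z | ‖z.2‖ ≤ ρ} := (convex_strip ρ).segment_subset hz hw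
  have := (convex_segment z w).norm_image_sub_le_of_norm_hasFDerivWithin_le' (f := f)
    (f' := fderiv ℝ f) (φ := fderiv ℝ f z) (C := B * ‖w - z‖)
    (fun y hy => ((contDiffAt_of_strip hs ((hseg hy).trans_lt hρ)).differentiableAt
      (by simp)).hasFDerivAt.hasFDerivWithinAt)
    (fun y hy => (hB z y hz (hseg hy)).trans (mul_le_mul_of_nonneg_left (by
      obtain ⟨t, ht, rfl⟩ := (segment_eq_image' ℝ z w ▸ hy :
        y ∈ (fun θ : ℝ => z + θ • (w - z)) '' Set.Icc 0 1)
      rw [add_sub_cancel_left, norm_smul, Real.norm_of_nonneg ht.1]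
      exact mul_le_of_le_one_left (norm_nonneg _) ht.2) hB0))
    (left_mem_segment ℝ z w) (right_mem_segment ℝ z w)
  rwa [mul_assoc, ← pow_two] at this

/-- A smooth periodic function that vanishes to infinite order does so together with its
derivative; quantitatively, half of the order is lost. -/
theorem StripPeriodic.fderiv_le {R : ℝ} {f : Plane × Plane → F} (hf : StripPeriodic R f)
    (hR : 0 < R) (hs : ContDiffOn ℝ ∞ f {z | ‖z.2‖ < R}) {k : ℕ} (hk : 1 ≤ k)
    (hv : ∃ C r : ℝ, 0 < r ∧ ∀ z : Plane × Plane, ‖z.2‖ < r → ‖f z‖ ≤ C * ‖z.2‖ ^ (2 * k)) :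
    ∃ C ρ : ℝ, 0 ≤ C ∧ 0 < ρ ∧ ρ < R ∧ ∀ z : Plane × Plane, ‖z.2‖ ≤ ρ →
      ‖fderiv ℝ f z‖ ≤ C * ‖z.2‖ ^ k := by
  obtain ⟨C, r, hr, hC⟩ := hv
  obtain ⟨B, hB0, hB⟩ := hf.taylor hs (show R / 2 < R by linarith)
  set C' := max C 0 with hC'
  have hC0 : 0 ≤ C' := le_max_right _ _
  have hC2 : ∀ z : Plane × Plane, ‖z.2‖ < r → ‖f z‖ ≤ C' * ‖z.2‖ ^ (2 * k) := fun z hz =>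
    (hC z hz).trans (mul_le_mul_of_nonneg_right (le_max_left _ _) (by positivity))
  obtain ⟨ρ, hρ0, hρ⟩ : ∃ ρ : ℝ, 0 < ρ ∧ ρ < 1 ∧ 2 * ρ < r ∧ 2 * ρ < R / 2 := by
    refine ⟨min (1 / 2) (min (r / 4) (R / 8)), by positivity, ?_, ?_, ?_⟩
    · exact (min_le_left _ _).trans_lt (by norm_num)
    · have := (min_le_right (1 / 2) (min (r / 4) (R / 8))).trans (min_le_left _ _)
      linarith
    · have := (min_le_right (1 / 2) (min (r / 4) (R / 8))).trans (min_le_right _ _)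
      linarith
  refine ⟨C' * 4 ^ k + C' + B, ρ, by positivity, hρ0, by linarith, fun z hz => ?_⟩
  refine ContinuousLinearMap.opNorm_le_of_unit_norm (𝕜 := ℝ) (by positivity) fun v hv => ?_
  have hv2 : ‖v.2‖ ≤ 1 := (norm_snd_le v).trans hv.le
  -- Second order Taylor expansion with step h bounds h times the derivative by the two values of f
  -- and B h².
  have key : ∀ h : ℝ, 0 < h → h ≤ ρ →
      h * ‖fderiv ℝ f z v‖ ≤ C' * (‖z.2‖ + h) ^ (2 * k) + C' * ‖z.2‖ ^ (2 * k) + B * h ^ 2 := by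
    intro h h0 hh
    have hz' : ‖(z + h • v).2‖ ≤ ‖z.2‖ + h := by
      refine (norm_add_le _ _).trans (add_le_add le_rfl ?_)
      rw [Prod.smul_snd, norm_smul, Real.norm_of_nonneg h0.le]
      exact mul_le_of_le_one_right h0.le hv2
    have h1 := (hB z (z + h • v) (by linarith) (by linarith)).2
    rw [add_sub_cancel_left, map_smul, norm_smul, Real.norm_of_nonneg h0.le, hv, mul_one] at h1
    have h2 := hC2 z (by linarith)
    have h3 := (hC2 (z + h • v) (by linarith)).trans (mul_le_mul_of_nonneg_left
      (pow_le_pow_left₀ (norm_nonneg _) hz' _) hC0)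
    calc h * ‖fderiv ℝ f z v‖ = ‖h • fderiv ℝ f z v‖ := by
          rw [norm_smul, Real.norm_of_nonneg h0.le]
      _ = ‖f (z + h • v) - f z - (f (z + h • v) - f z - h • fderiv ℝ f z v)‖ := by
          congr 1; abel
      _ ≤ ‖f (z + h • v)‖ + ‖f z‖ + ‖f (z + h • v) - f z - h • fderiv ℝ f z v‖ :=
          (norm_sub_le _ _).trans (add_le_add (norm_sub_le _ _) le_rfl)
      _ ≤ _ := add_le_add (add_le_add h3 h2) h1
  -- On the zero section there is no scale |ξ| to choose h from, and h tends to 0 instead.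
  rcases eq_or_lt_of_le (norm_nonneg z.2) with h0 | h0
  · rw [← h0, zero_pow (by omega), mul_zero]
    have hlim : ∀ h : ℝ, 0 < h → h ≤ ρ → ‖fderiv ℝ f z v‖ ≤ (C' + B) * h := by
      intro h hh0 hh
      have := key h hh0 hh
      rw [← h0, zero_add, zero_pow (by omega), mul_zero, add_zero] at this
      have h4 : h ^ (2 * k) ≤ h ^ 2 :=
        pow_le_pow_of_le_one hh0.le (by linarith) (by omega)
      have h5 : h * ‖fderiv ℝ f z v‖ ≤ h * ((C' + B) * h) := by nlinarith
      exact le_of_mul_le_mul_left h5 hh0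
    refine le_of_forall_pos_le_add fun ε hε => ?_
    rw [zero_add]
    set h := min ρ (ε / (C' + B + 1)) with hh
    have hh0 : 0 < h := by positivity
    refine (hlim h hh0 (min_le_left _ _)).trans ?_
    have h6 : h * (C' + B + 1) ≤ ε := (le_div_iff₀ (by positivity)).1 (min_le_right _ _)
    nlinarith
  · set s := ‖z.2‖ with hs'
    have hs1 : s ^ k ≤ s := by
      calc s ^ k ≤ s ^ 1 := pow_le_pow_of_le_one h0.le (by linarith) hk
        _ = s := pow_one s
    -- The step h = |ξ|^k balances the terms: h² is |ξ|^{2k}, and |ξ| + h ≤ 2|ξ| since k ≥ 1 and |ξ|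
    -- < 1.
    have h1 := key (s ^ k) (by positivity) (hs1.trans hz)
    have h2 : (s + s ^ k) ^ (2 * k) ≤ 4 ^ k * (s ^ k * s ^ k) := by
      calc (s + s ^ k) ^ (2 * k) ≤ (2 * s) ^ (2 * k) :=
            pow_le_pow_left₀ (by positivity) (by linarith) _
        _ = 4 ^ k * (s ^ k * s ^ k) := by
            rw [mul_pow, pow_mul, ← pow_add, two_mul k]; norm_num
    have h3 : s ^ (2 * k) = s ^ k * s ^ k := by rw [← pow_add, two_mul]
    rw [h3] at h1
    have h4 : s ^ k * ‖fderiv ℝ f z v‖ ≤ s ^ k * ((C' * 4 ^ k + C' + B) * s ^ k) := by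
      have := mul_le_mul_of_nonneg_left h2 hC0
      nlinarith
    exact le_of_mul_le_mul_left h4 (by positivity)

end Interpolation

/-! ### Consequences of the normal form of p -/

section NormalForm

set_option linter.unusedSectionVars false

variable {M : Type*} [TopologicalSpace M] [ChartedSpace Plane M] [IsManifold 𝓘(ℝ, Plane) ω M]
variable {γ : Plane → Cotangent M} {R : ℝ} {Ψ : Plane × Plane → Cotangent M}
  {p : Cotangent M → ℝ} {a : Plane} {pInf : Plane → ℝ}

theorem IsCanonicalTube.contDiffOn_comp {F : Type*} [NormedAddCommGroup F] [NormedSpace ℝ F]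
    (hT : IsCanonicalTube ∞ γ R Ψ) {f : Cotangent M → F} {V : Set (Cotangent M)}
    (hf : ContMDiffOn phaseModel 𝓘(ℝ, F) ∞ f V) {ρ : ℝ} (hρ : ρ ≤ R)
    (hV : ∀ z : Plane × Plane, ‖z.2‖ < ρ → Ψ z ∈ V) :
    ContDiffOn ℝ ∞ (fun z => f (Ψ z)) {z | ‖z.2‖ < ρ} := by
  rw [← contMDiffOn_iff_contDiffOn]
  exact hf.comp (hT.smooth.mono fun z hz => lt_of_lt_of_le hz hρ) fun z hz => hV z hz

theorem IsCanonicalTube.contDiffOn_energy (hT : IsCanonicalTube ∞ γ R Ψ)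
    (hp : ContMDiff phaseModel 𝓘(ℝ, ℝ) ∞ p) :
    ContDiffOn ℝ ∞ (fun z => p (Ψ z)) {z | ‖z.2‖ < R} :=
  hT.contDiffOn_comp hp.contMDiffOn le_rfl fun _ _ => Set.mem_univ _

theorem IsNormalForm.hasFDerivAt_zero {n : WithTop ℕ∞} {N : ℕ}
    (hN : IsNormalForm n p a R Ψ pInf N) : pInf 0 = 0 ∧ HasFDerivAt pInf (innerSL ℝ a) 0 := by
  obtain ⟨C, r, hr, hC⟩ := hN.linear_part
  have h0 : pInf 0 = 0 := by
    have := hC 0 (by simpa using hr)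
    simpa using this
  refine ⟨h0, ?_⟩
  rw [hasFDerivAt_iff_isLittleO_nhds_zero]
  have : (fun h => pInf (0 + h) - pInf 0 - innerSL ℝ a h) =O[𝓝 0] fun h : Plane => ‖h‖ ^ 2 := by
    refine Asymptotics.IsBigO.of_bound C ?_
    filter_upwards [Metric.ball_mem_nhds (0 : Plane) hr] with h hh
    rw [mem_ball_zero_iff] at hh
    simpa [h0] using hC h hh
  exact this.trans_isLittleO (Asymptotics.isLittleO_norm_pow_id one_lt_two)

theorem contDiffOn_snd_strip {f : Plane → ℝ} (hf : ContDiffOn ℝ ∞ f {ξ | ‖ξ‖ < R}) :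
    ContDiffOn ℝ ∞ (fun z : Plane × Plane => f z.2) {z | ‖z.2‖ < R} :=
  hf.comp contDiff_snd.contDiffOn fun _ hz => hz

/-- In the tube, `d(p - p_∞)` vanishes to infinite order on the torus. -/
theorem IsCanonicalTube.fderiv_energy_sub_le (hT : IsCanonicalTube ∞ γ R Ψ)
    (hp : ContMDiff phaseModel 𝓘(ℝ, ℝ) ∞ p)
    (hN : ∀ N : ℕ, IsNormalForm ∞ p a R Ψ pInf N) {k : ℕ} (hk : 1 ≤ k) :
    ∃ C ρ : ℝ, 0 ≤ C ∧ 0 < ρ ∧ ρ < R ∧ ∀ z : Plane × Plane, ‖z.2‖ ≤ ρ →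
      ‖fderiv ℝ (fun w => p (Ψ w)) z - fderiv ℝ (fun w : Plane × Plane => pInf w.2) z‖ ≤
        C * ‖z.2‖ ^ k := by
  have hP := hT.contDiffOn_energy hp
  have hI := contDiffOn_snd_strip (hN 0).smooth
  have hper : StripPeriodic R (fun z : Plane × Plane => p (Ψ z) - pInf z.2) :=
    fun x y ξ hξ hxy => by simp only [hT.stripPeriodic x y ξ hξ hxy]
  -- The remainder for N = 2k − 1 has order 2k, half of which survives for the derivative.
  obtain ⟨C, r, hr, hC⟩ := (hN (2 * k - 1)).remainder
  obtain ⟨C', ρ, h0, hρ, hρR, h⟩ := hper.fderiv_le hT.radius_pos (hP.sub hI) hk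
    ⟨C, r, hr, fun z hz => by
      have := hC z.1 z.2 hz
      rwa [show 2 * k - 1 + 1 = 2 * k by omega] at this⟩
  refine ⟨C', ρ, h0, hρ, hρR, fun z hz => ?_⟩
  rw [← fderiv_fun_sub ((contDiffAt_of_strip hP (hz.trans_lt hρR)).differentiableAt (by simp))
    ((contDiffAt_of_strip hI (hz.trans_lt hρR)).differentiableAt (by simp))]
  exact h z hz

theorem fderiv_comp_snd {f : Plane → ℝ} {z : Plane × Plane} (hf : DifferentiableAt ℝ f z.2) :
    fderiv ℝ (fun w : Plane × Plane => f w.2) z =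
      (fderiv ℝ f z.2).comp (ContinuousLinearMap.snd ℝ Plane Plane) :=
  (hf.hasFDerivAt.comp z hasFDerivAt_snd).fderiv

/-- At ξ = 0 the estimate above with k = 1 makes the differential exactly a·dξ; elsewhere it is
Lipschitz. -/
theorem IsCanonicalTube.fderiv_energy_sub_linear_le (hT : IsCanonicalTube ∞ γ R Ψ)
    (hp : ContMDiff phaseModel 𝓘(ℝ, ℝ) ∞ p)
    (hN : ∀ N : ℕ, IsNormalForm ∞ p a R Ψ pInf N) {ρ : ℝ} (hρ0 : 0 ≤ ρ) (hρ : ρ < R) :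
    ∃ B : ℝ, 0 ≤ B ∧ ∀ z : Plane × Plane, ‖z.2‖ ≤ ρ →
      ‖fderiv ℝ (fun w => p (Ψ w)) z - (innerSL ℝ a).comp (ContinuousLinearMap.snd ℝ Plane Plane)‖
        ≤ B * ‖z.2‖ := by
  obtain ⟨B, hB0, hB⟩ := (hT.stripPeriodic_comp p).taylor (hT.contDiffOn_energy hp) hρ
  obtain ⟨C, ρ', hC0, hρ', -, hC⟩ := hT.fderiv_energy_sub_le hp hN le_rfl
  refine ⟨B, hB0, fun z hz => ?_⟩
  have h1 : fderiv ℝ (fun w => p (Ψ w)) (z.1, 0) =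
      (innerSL ℝ a).comp (ContinuousLinearMap.snd ℝ Plane Plane) := by
    have h2 := hC (z.1, 0) (by simpa using hρ'.le)
    rw [norm_zero, pow_one, mul_zero, norm_le_zero_iff, sub_eq_zero] at h2
    rw [h2, fderiv_comp_snd (z := (z.1, 0)) (hN 0).hasFDerivAt_zero.2.differentiableAt,
      (hN 0).hasFDerivAt_zero.2.fderiv]
  have h3 := (hB (z.1, 0) z (by simpa using hρ0) hz).1
  rw [h1] at h3
  have h4 : z - (z.1, 0) = (0, z.2) := by ext1 <;> simp
  rw [h4, Prod.norm_def] at h3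
  simpa using h3

end NormalForm

/-! ### Mean values over the torus -/

section Mean

open MeasureTheory

/-- The mean value over the torus of a real periodic function. -/
def realMean (h : Plane → ℝ) : ℝ :=
  ((2 * Real.pi) ^ 2)⁻¹ * ∫ s in (0 : ℝ)..(2 * Real.pi), ∫ t in (0 : ℝ)..(2 * Real.pi), h !₂[s, t]

theorem continuous_planePoint : Continuous fun z : ℝ × ℝ => (!₂[z.1, z.2] : Plane) := by
  refine (EuclideanSpace.equiv (Fin 2) ℝ).symm.continuous.comp (continuous_pi fun i => ?_)
  fin_cases i
  · exact continuous_fst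
  · exact continuous_snd

theorem continuous_inner_mean {E : Type*} [NormedAddCommGroup E] [NormedSpace ℝ E]
    {h : Plane → E} (hh : Continuous h) :
    Continuous fun s : ℝ => ∫ t in (0 : ℝ)..(2 * Real.pi), h !₂[s, t] :=
  intervalIntegral.continuous_parametric_intervalIntegral_of_continuous'
    (f := fun s t => h !₂[s, t]) (hh.comp continuous_planePoint) _ _

theorem continuous_slice {E : Type*} [NormedAddCommGroup E]
    {h : Plane → E} (hh : Continuous h) (s : ℝ) : Continuous fun t : ℝ => h !₂[s, t] :=
  (hh.comp continuous_planePoint).comp (continuous_const.prodMk continuous_id)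

theorem re_torusMean {f : Plane → ℂ} (hf : Continuous f) :
    (torusMean f).re = realMean fun x => (f x).re := by
  rw [torusMean, realMean, Complex.smul_re, smul_eq_mul]
  congr 1
  have h1 := Complex.reCLM.intervalIntegral_comp_comm (a := 0) (b := 2 * Real.pi) (μ := volume)
    ((continuous_inner_mean hf).intervalIntegrable 0 (2 * Real.pi))
  rw [Complex.reCLM_apply] at h1
  rw [← h1]
  refine intervalIntegral.integral_congr fun s _ => ?_
  exact (Complex.reCLM.intervalIntegral_comp_comm (a := 0) (b := 2 * Real.pi) (μ := volume)
    ((continuous_slice hf s).intervalIntegrable 0 (2 * Real.pi))).symm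

theorem realMean_add {f g : Plane → ℝ} (hf : Continuous f) (hg : Continuous g) :
    realMean (fun x => f x + g x) = realMean f + realMean g := by
  have h : ∀ s : ℝ, ∫ t in (0 : ℝ)..(2 * Real.pi), (f !₂[s, t] + g !₂[s, t]) =
      (∫ t in (0 : ℝ)..(2 * Real.pi), f !₂[s, t]) + ∫ t in (0 : ℝ)..(2 * Real.pi), g !₂[s, t] :=
    fun s => intervalIntegral.integral_add ((continuous_slice hf s).intervalIntegrable _ _)
      ((continuous_slice hg s).intervalIntegrable _ _)
  simp only [realMean, h]
  rw [intervalIntegral.integral_add ((continuous_inner_mean hf).intervalIntegrable _ _)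
      ((continuous_inner_mean hg).intervalIntegrable _ _), mul_add]

theorem realMean_const_mul (c : ℝ) (f : Plane → ℝ) :
    realMean (fun x => c * f x) = c * realMean f := by
  simp only [realMean, intervalIntegral.integral_const_mul]
  ring

theorem realMean_const (c : ℝ) : realMean (fun _ => c) = c := by
  simp only [realMean, intervalIntegral.integral_const, smul_eq_mul]
  have := Real.pi_ne_zero
  field_simp
  ring

theorem abs_realMean_le {f : Plane → ℝ} {B : ℝ} (hB : ∀ x, |f x| ≤ B) : |realMean f| ≤ B := by
  have hpi := Real.two_pi_pos
  have h1 : ∀ s : ℝ, ‖∫ t in (0 : ℝ)..(2 * Real.pi), f !₂[s, t]‖ ≤ B * (2 * Real.pi) := fun s => by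
    have := intervalIntegral.norm_integral_le_of_norm_le_const (a := 0) (b := 2 * Real.pi)
      (f := fun t => f !₂[s, t]) (C := B) (fun t _ => hB _)
    rwa [sub_zero, abs_of_pos hpi] at this
  have h2 := intervalIntegral.norm_integral_le_of_norm_le_const (a := 0) (b := 2 * Real.pi)
    (f := fun s => ∫ t in (0 : ℝ)..(2 * Real.pi), f !₂[s, t]) (C := B * (2 * Real.pi))
    (fun s _ => h1 s)
  rw [sub_zero, abs_of_pos hpi, Real.norm_eq_abs] at h2
  rw [realMean, abs_mul, abs_of_pos (by positivity), inv_mul_le_iff₀ (by positivity)]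
  calc _ ≤ _ := h2
    _ = (2 * Real.pi) ^ 2 * B := by ring

theorem planePoint_eq (s t : ℝ) : (!₂[s, t] : Plane) =
    s • EuclideanSpace.single 0 (1 : ℝ) + t • EuclideanSpace.single 1 (1 : ℝ) := by
  ext i; fin_cases i <;> simp

theorem hasDerivAt_slice_fst (s t : ℝ) : HasDerivAt (fun s : ℝ => (!₂[s, t] : Plane))
    (EuclideanSpace.single 0 1) s := by
  simp only [planePoint_eq]
  simpa using ((hasDerivAt_id s).smul_const (EuclideanSpace.single 0 1 : Plane)).add_const
    (t • EuclideanSpace.single 1 (1 : ℝ))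

theorem hasDerivAt_slice_snd (s t : ℝ) : HasDerivAt (fun t : ℝ => (!₂[s, t] : Plane))
    (EuclideanSpace.single 1 1) t := by
  simp only [planePoint_eq]
  simpa using ((hasDerivAt_id t).smul_const (EuclideanSpace.single 1 1 : Plane)).const_add
    (s • EuclideanSpace.single 0 (1 : ℝ))

/-- The derivatives of a periodic function have mean value zero. -/
theorem realMean_fderiv {f : Plane → ℝ} (hf : ContDiff ℝ 1 f)
    (hper : ∀ x y, SameTorusPoint x y → f x = f y) (v : Plane) :
    realMean (fun x => fderiv ℝ f x v) = 0 := by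
  have hd : ∀ x, HasFDerivAt f (fderiv ℝ f x) x := fun x =>
    (hf.differentiable (by simp) x).hasFDerivAt
  have hc : ∀ u : Plane, Continuous fun x => fderiv ℝ f x u := fun u =>
    (hf.continuous_fderiv (by simp)).clm_apply continuous_const
  have h0 : realMean (fun x => fderiv ℝ f x (EuclideanSpace.single 0 1)) = 0 := by
    rw [realMean, intervalIntegral_intervalIntegral_swap]
    · have : ∀ t : ℝ, ∫ s in (0 : ℝ)..(2 * Real.pi),
          fderiv ℝ f !₂[s, t] (EuclideanSpace.single 0 1) = 0 := by
        intro t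
        rw [intervalIntegral.integral_eq_sub_of_hasDerivAt (f := fun s : ℝ => f !₂[s, t])
          (fun s _ => (hd _).comp_hasDerivAt s (hasDerivAt_slice_fst s t))
          ((((hc _).comp continuous_planePoint).comp
            (continuous_id.prodMk continuous_const)).intervalIntegrable _ _), sub_eq_zero]
        exact hper _ _ ⟨![1, 0], fun i => by fin_cases i <;> simp⟩
      simp [this]
    · rw [Set.uIoc_of_le Real.two_pi_pos.le]
      have : IntegrableOn (fun z : ℝ × ℝ =>
          fderiv ℝ f !₂[z.1, z.2] (EuclideanSpace.single 0 1))
          (Set.Icc 0 (2 * Real.pi) ×ˢ Set.Icc 0 (2 * Real.pi)) (volume.prod volume) :=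
        ((hc _).comp continuous_planePoint).continuousOn.integrableOn_compact
          (isCompact_Icc.prod isCompact_Icc)
      exact this.mono_set (Set.prod_mono Set.Ioc_subset_Icc_self Set.Ioc_subset_Icc_self)
  have h1 : realMean (fun x => fderiv ℝ f x (EuclideanSpace.single 1 1)) = 0 := by
    have : ∀ s : ℝ, ∫ t in (0 : ℝ)..(2 * Real.pi),
        fderiv ℝ f !₂[s, t] (EuclideanSpace.single 1 1) = 0 := by
      intro s
      rw [intervalIntegral.integral_eq_sub_of_hasDerivAt (f := fun t : ℝ => f !₂[s, t])
        (fun t _ => (hd _).comp_hasDerivAt t (hasDerivAt_slice_snd s t))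
        ((continuous_slice (hc _) s).intervalIntegrable _ _), sub_eq_zero]
      exact hper _ _ ⟨![0, 1], fun i => by fin_cases i <;> simp⟩
    simp [realMean, this]
  have h2 : (fun x => fderiv ℝ f x v) = fun x => v 0 * fderiv ℝ f x (EuclideanSpace.single 0 1) +
      v 1 * fderiv ℝ f x (EuclideanSpace.single 1 1) := by
    funext x
    conv_lhs => rw [plane_eq_sum v]
    simp only [map_add, map_smul, smul_eq_mul]
  rw [h2, realMean_add (f := fun x => v 0 * fderiv ℝ f x (EuclideanSpace.single 0 1))
    (g := fun x => v 1 * fderiv ℝ f x (EuclideanSpace.single 1 1))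
    (continuous_const.mul (hc _)) (continuous_const.mul (hc _)), realMean_const_mul, realMean_const_mul, h0, h1]
  simp

end Mean

/-! ### First order expansions at the torus in different tubes -/

section Expansion

variable {M : Type*} [TopologicalSpace M] [ChartedSpace Plane M] [IsManifold 𝓘(ℝ, Plane) ω M]

theorem planeGrad_sub (l m : Plane × Plane →L[ℝ] ℝ) :
    planeGrad (l - m) = planeGrad l - planeGrad m := by
  apply Prod.ext <;> ext i <;> fin_cases i <;> simp [planeGrad]
  all_goals ring

theorem norm_plane_le {x : Plane} {B : ℝ} (h : ∀ i, |x i| ≤ B) : ‖x‖ ≤ 2 * B := by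
  have hB : 0 ≤ B := (abs_nonneg _).trans (h 0)
  rw [EuclideanSpace.norm_eq, Fin.sum_univ_two]
  refine Real.sqrt_le_iff.2 ⟨by positivity, ?_⟩
  have h0 := pow_le_pow_left₀ (abs_nonneg _) (h 0) 2
  have h1 := pow_le_pow_left₀ (abs_nonneg _) (h 1) 2
  simp only [Real.norm_eq_abs]
  nlinarith

theorem norm_planeGrad_le (l : Plane × Plane →L[ℝ] ℝ) : ‖planeGrad l‖ ≤ 2 * ‖l‖ := by
  have h : ∀ v : Plane × Plane, ‖v‖ ≤ 1 → |l v| ≤ ‖l‖ := fun v hv =>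
    (l.le_opNorm v).trans (mul_le_of_le_one_right (norm_nonneg _) hv)
  rw [Prod.norm_def]
  refine max_le (norm_plane_le fun i => ?_) (norm_plane_le fun i => ?_) <;> fin_cases i <;>
    simp only [planeGrad] <;> simp <;> exact h _ (by simp [Prod.norm_def])

theorem tubeDeriv_zero_section {γ : Plane → Cotangent M} {R : ℝ}
    {Ψ : Plane × Plane → Cotangent M} (hT : IsCanonicalTube ∞ γ R Ψ) (x u : Plane) :
    tubeDeriv Ψ (x, 0) (u, 0) =
      (mfderiv 𝓘(ℝ, Plane) phaseModel γ x : Plane →L[ℝ] PhaseModel) u := by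
  have h0 : ‖((x, 0) : Plane × Plane).2‖ < R := by simpa using hT.radius_pos
  have hi : HasFDerivAt (fun y : Plane => ((y, 0) : Plane × Plane))
      (ContinuousLinearMap.inl ℝ Plane Plane) x := (hasFDerivAt_id x).prodMk (hasFDerivAt_const _ _)
  have h1 := (((hT.contMDiffAt h0).mdifferentiableAt (by simp)).hasMFDerivAt).comp x hi.hasMFDerivAt
  have h2 : Ψ ∘ (fun y : Plane => ((y, 0) : Plane × Plane)) = γ := funext hT.zero_section
  rw [h2] at h1
  rw [h1.mfderiv]
  rfl

variable {γ : Plane → Cotangent M} {R R' : ℝ} {Ψ Ψ' : Plane × Plane → Cotangent M}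

/-- Two canonical tubes around the same torus: their fibre directions at the torus agree up to
tangent vectors of the torus. -/
theorem exists_tubeDeriv_sub (hT : IsCanonicalTube ∞ γ R Ψ) (hT' : IsCanonicalTube ∞ γ R' Ψ')
    (x η : Plane) :
    ∃ u : Plane, tubeDeriv Ψ' (x, 0) (0, η) = tubeDeriv Ψ (x, 0) (0, η) + tubeDeriv Ψ (x, 0) (u, 0)
      := by
  have h0 : ‖((x, 0) : Plane × Plane).2‖ < R := by simpa using hT.radius_pos
  have h0' : ‖((x, 0) : Plane × Plane).2‖ < R' := by simpa using hT'.radius_pos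
  obtain ⟨e, he⟩ := hT.exists_equiv h0
  set w := e.symm (tubeDeriv Ψ' (x, 0) (0, η) - tubeDeriv Ψ (x, 0) (0, η)) with hw
  have hew : tubeDeriv Ψ (x, 0) w = tubeDeriv Ψ' (x, 0) (0, η) - tubeDeriv Ψ (x, 0) (0, η) := by
    rw [hw, ← he]
    exact e.apply_symm_apply _
  -- Both tubes are symplectic and restrict to the same γ, so the difference of the two fibre
  -- vectors pairs to zero with every tangent vector of the torus. The torus is Lagrangian, hence
  -- the difference is tangent to it.
  have hw2 : w.2 = 0 := by
    have h1 : ∀ u : Plane, inner ℝ w.2 u = 0 := by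
      intro u
      have h2 := hT.stdForm_tubeDeriv h0 (u, 0) w
      have h3 := hT.stdForm_tubeDeriv h0 (u, 0) (0, η)
      have h4 := hT'.stdForm_tubeDeriv h0' (u, 0) (0, η)
      rw [tubeDeriv_zero_section hT', ← tubeDeriv_zero_section hT] at h4
      rw [hew] at h2
      have h5 : ∀ v a b : PhaseModel, stdForm v (a - b) = stdForm v a - stdForm v b := by
        intro v a b
        simp only [stdForm, Prod.fst_sub, Prod.snd_sub, map_sub, sub_apply]
        ring
      rw [h5, h3, h4] at h2
      simpa using h2
    exact inner_self_eq_zero.1 (h1 w.2)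
  refine ⟨w.1, ?_⟩
  have h6 : ((w.1, 0) : Plane × Plane) = w := by rw [← hw2]
  rw [h6, hew]
  abel

theorem IsCanonicalTube.mdifferentiableAt_of_comp {F : Type*} [NormedAddCommGroup F]
    [NormedSpace ℝ F] (hT : IsCanonicalTube ∞ γ R Ψ) {z : Plane × Plane} (hz : ‖z.2‖ < R)
    {f : Cotangent M → F} (hf : DifferentiableAt ℝ (fun w => f (Ψ w)) z) :
    MDifferentiableAt phaseModel 𝓘(ℝ, F) f (Ψ z) := by
  obtain ⟨σ, hσ, hσz, hΨσ⟩ := hT.exists_local_inverse hz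
  have h1 : MDifferentiableAt phaseModel 𝓘(ℝ, F) ((fun w => f (Ψ w)) ∘ σ) (Ψ z) := by
    refine MDifferentiableAt.comp (Ψ z) ?_ (hσ.mdifferentiableAt (by simp))
    rw [hσz]
    exact hf.mdifferentiableAt
  refine h1.congr_of_eventuallyEq ?_
  filter_upwards [hΨσ] with m hm
  simp only [Function.comp_apply, hm]

/-- A function with constant value on the torus, whose expansion in one tube is independent of `x`
to second order, is affine to second order in every other tube. -/
theorem exists_linear_expansion (hT : IsCanonicalTube ∞ γ R Ψ) (hT' : IsCanonicalTube ∞ γ R' Ψ')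
    {f : Cotangent M → ℝ} {ρ : ℝ} (hρ0 : 0 < ρ) (hρ : ρ ≤ R)
    (hf : ContDiffOn ℝ ∞ (fun z => f (Ψ z)) {z | ‖z.2‖ < ρ}) {A : Plane → ℝ} {c C r : ℝ}
    (hr : 0 < r) (hA : ∀ x ξ : Plane, ‖ξ‖ < r → |f (Ψ' (x, ξ)) - A ξ| ≤ C * ‖ξ‖ ^ 2)
    (hA0 : A 0 = c) :
    ∃ l : Plane →L[ℝ] ℝ, ∀ ρ' < ρ, ∃ B : ℝ, 0 ≤ B ∧ ∀ z : Plane × Plane, ‖z.2‖ ≤ ρ' →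
      |f (Ψ z) - c - l z.2| ≤ B * ‖z.2‖ ^ 2 := by
  let S : Plane × Plane → ℝ := fun z => f (Ψ z)
  have hzero : ∀ x : Plane, ‖((x, 0) : Plane × Plane).2‖ < ρ := fun x => by simpa using hρ0
  have hzero' : ∀ x : Plane, ‖((x, 0) : Plane × Plane).2‖ < R' := fun x => by
    simpa using hT'.radius_pos
  have hc : ∀ x, S (x, 0) = c := by
    intro x
    have h1 := hA x 0 (by simpa using hr)
    rw [norm_zero, zero_pow two_ne_zero, mul_zero, hA0, hT'.zero_section, ← hT.zero_section] at h1
    exact sub_eq_zero.1 (abs_eq_zero.1 (le_antisymm h1 (abs_nonneg _)))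
  have hS : ∀ x, DifferentiableAt ℝ S (x, 0) := fun x =>
    (contDiffAt_of_strip hf (hzero x)).differentiableAt (by simp)
  have hfd : ∀ x, MDifferentiableAt phaseModel 𝓘(ℝ, ℝ) f (Ψ (x, 0)) := fun x =>
    hT.mdifferentiableAt_of_comp ((hzero x).trans_le hρ) (hS x)
  -- The function is constant on the torus. Hence fibre vectors that differ by tangent vectors give
  -- the same derivative, which links the two tubes.
  have hx : ∀ x u : Plane, fderiv ℝ S (x, 0) (u, 0) = 0 := by
    intro x u
    have hi : HasFDerivAt (fun y : Plane => ((y, 0) : Plane × Plane))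
        (ContinuousLinearMap.inl ℝ Plane Plane) x :=
      (hasFDerivAt_id x).prodMk (hasFDerivAt_const _ _)
    have h1 := HasFDerivAt.comp x (g := S) (f := fun y : Plane => ((y, 0) : Plane × Plane))
      (hS x).hasFDerivAt hi
    have h2 : S ∘ (fun y : Plane => ((y, 0) : Plane × Plane)) = fun _ => c := funext hc
    rw [h2] at h1
    have h3 := h1.unique (hasFDerivAt_const c x)
    exact congrArg (fun L : Plane →L[ℝ] ℝ => L u) h3
  have hfd' : ∀ x, MDifferentiableAt phaseModel 𝓘(ℝ, ℝ) f (Ψ' (x, 0)) := fun x => by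
    rw [hT'.zero_section, ← hT.zero_section]; exact hfd x
  have hη : ∀ x η : Plane, fderiv ℝ S (x, 0) (0, η) =
      fderiv ℝ (fun z => f (Ψ' z)) (x, 0) (0, η) := by
    intro x η
    obtain ⟨u, hu⟩ := exists_tubeDeriv_sub hT hT' x η
    have h1 := hT.modelDeriv_tubeDeriv ((hzero x).trans_le hρ) (hfd x)
    have h2 := hT'.modelDeriv_tubeDeriv (hzero' x) (hfd' x) (0, η)
    rw [hu, show Ψ' (x, 0) = Ψ (x, 0) by rw [hT.zero_section, hT'.zero_section], map_add, h1, h1]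
      at h2
    rw [← h2]
    have := hx x u
    simp only [S] at this ⊢
    rw [this, add_zero]
  -- Over x and over y the function is A(tη) + O(t²) along the fibre, so the two derivatives at t =
  -- 0 agree. Differentiability of A is not needed.
  have hindep : ∀ x y η : Plane, fderiv ℝ S (x, 0) (0, η) = fderiv ℝ S (y, 0) (0, η) := by
    intro x y η
    rw [hη, hη]
    have hd : ∀ x : Plane, HasDerivAt (fun t : ℝ => f (Ψ' (x, t • η)))
        (fderiv ℝ (fun z => f (Ψ' z)) (x, 0) (0, η)) 0 := by
      intro x
      have h1 : HasFDerivAt (fun z => f (Ψ' z)) (fderiv ℝ (fun z => f (Ψ' z)) (x, 0))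
          (x, (0 : ℝ) • η) := by
        rw [zero_smul]
        exact (hT'.hasFDerivAt_comp (hzero' x) (hfd' x)).differentiableAt.hasFDerivAt
      have h2 : HasDerivAt (fun t : ℝ => ((x, t • η) : Plane × Plane)) (0, η) 0 := by
        have h3 : HasDerivAt (fun t : ℝ => t • η) η 0 := by
          simpa using (hasDerivAt_id (0 : ℝ)).smul_const η
        exact (hasDerivAt_const _ _).prodMk h3
      exact h1.comp_hasDerivAt 0 h2
    have h1 := (hd x).sub (hd y)
    have h2 : HasDerivAt (fun t : ℝ => f (Ψ' (x, t • η)) - f (Ψ' (y, t • η))) 0 0 := by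
      rw [hasDerivAt_iff_isLittleO_nhds_zero]
      have h3 : (fun h : ℝ => f (Ψ' (x, (0 + h) • η)) - f (Ψ' (y, (0 + h) • η)) -
          (f (Ψ' (x, (0 : ℝ) • η)) - f (Ψ' (y, (0 : ℝ) • η))) - h • (0 : ℝ)) =O[𝓝 0]
          fun h : ℝ => ‖h‖ ^ 2 := by
        refine Asymptotics.IsBigO.of_bound (2 * (C * ‖η‖ ^ 2)) ?_
        have h4 : ∀ᶠ h : ℝ in 𝓝 0, ‖h • η‖ < r := by
          have : Continuous fun h : ℝ => ‖h • η‖ := by fun_prop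
          exact this.continuousAt.eventually_lt continuousAt_const (by simpa using hr)
        filter_upwards [h4] with h hh
        have e1 := hA x (h • η) hh
        have e2 := hA y (h • η) hh
        have e3 : f (Ψ' (x, 0)) = f (Ψ' (y, 0)) := by
          have a1 := hc x
          have a2 := hc y
          simp only [S] at a1 a2
          rw [hT.zero_section] at a1 a2
          rw [hT'.zero_section, hT'.zero_section, a1, a2]
        rw [zero_add, zero_smul, e3, sub_self, sub_zero, smul_zero, sub_zero, norm_pow, norm_norm,
          Real.norm_eq_abs]
        have e4 : C * ‖h • η‖ ^ 2 = C * ‖η‖ ^ 2 * ‖h‖ ^ 2 := by rw [norm_smul]; ring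
        rw [e4] at e1 e2
        have := abs_sub_le (f (Ψ' (x, h • η))) (A (h • η)) (f (Ψ' (y, h • η)))
        rw [abs_sub_comm (A (h • η))] at this
        linarith
      exact h3.trans_isLittleO (Asymptotics.isLittleO_norm_pow_id one_lt_two)
    exact sub_eq_zero.1 (h1.unique h2)
  refine ⟨(fderiv ℝ S (0, 0)).comp (ContinuousLinearMap.inr ℝ Plane Plane), fun ρ' hρ' => ?_⟩
  have hper : StripPeriodic ρ S := (hT.stripPeriodic_comp f).mono hρ
  obtain ⟨B, hB0, hB⟩ := hper.taylor hf hρ'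
  refine ⟨B, hB0, fun z hz => ?_⟩
  have h1 := (hB (z.1, 0) z (by simpa using (norm_nonneg _).trans hz) hz).2
  have h2 : z - (z.1, 0) = (0, z.2) := by ext1 <;> simp
  rw [h2, hc, hindep z.1 0 z.2, Prod.norm_def, norm_zero, max_eq_right (norm_nonneg _)] at h1
  exact h1

/-- The mean value over the torus of `H_p g` vanishes to second order. -/
theorem exists_realMean_hamiltonDeriv_le {p : Cotangent M → ℝ} {a : Plane} {pInf : Plane → ℝ}
    (hT : IsCanonicalTube ∞ γ R Ψ) (hp : ContMDiff phaseModel 𝓘(ℝ, ℝ) ∞ p)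
    (hN : ∀ N : ℕ, IsNormalForm ∞ p a R Ψ pInf N) {g : Plane × Plane → ℝ} {ρ : ℝ} (hρ0 : 0 < ρ)
    (hg : ContDiffOn ℝ ∞ g {z | ‖z.2‖ < ρ}) (hper : StripPeriodic ρ g) :
    ∃ B r : ℝ, 0 ≤ B ∧ 0 < r ∧ ∀ ξ : Plane, ‖ξ‖ < r →
      |realMean fun x => fderiv ℝ g (x, ξ) (planeGrad (fderiv ℝ (fun w => p (Ψ w)) (x, ξ)))| ≤
        B * ‖ξ‖ ^ 2 := by
  obtain ⟨C, ρ', hC0, hρ', hρR, hC⟩ := hT.fderiv_energy_sub_le hp hN one_le_two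
  obtain ⟨D, hD0, hD⟩ := hper.periodic_fderiv.exists_bound
    (hg.continuousOn_fderiv_of_isOpen (isOpen_strip ρ) (by simp)) (show ρ / 2 < ρ by linarith)
  refine ⟨D * (2 * C), min ρ' (ρ / 2), by positivity, by positivity, fun ξ hξ => ?_⟩
  have hξ1 : ‖ξ‖ ≤ ρ' := (hξ.le.trans (min_le_left _ _))
  have hξ2 : ‖ξ‖ ≤ ρ / 2 := (hξ.le.trans (min_le_right _ _))
  have hξR : ‖ξ‖ < R := hξ1.trans_lt hρR
  have hξρ : ‖ξ‖ < ρ := by linarith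
  have hpI : DifferentiableAt ℝ pInf ξ := by
    have h1 : IsOpen {η : Plane | ‖η‖ < R} := isOpen_lt continuous_norm continuous_const
    exact ((hN 0).smooth.contDiffAt (h1.mem_nhds hξR)).differentiableAt (by simp)
  -- For fixed ξ the Hamilton field of p_∞(ξ) is the constant field b·∂_x, and derivatives of
  -- periodic functions have mean zero. Only the field of p − p_∞ contributes, which is O(|ξ|²).
  set b : Plane := !₂[fderiv ℝ pInf ξ (EuclideanSpace.single 0 1),
    fderiv ℝ pInf ξ (EuclideanSpace.single 1 1)] with hb
  have hpg : ∀ x, planeGrad (fderiv ℝ (fun w : Plane × Plane => pInf w.2) (x, ξ)) = (b, 0) := by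
    intro x
    rw [fderiv_comp_snd (z := (x, ξ)) hpI]
    apply Prod.ext <;> ext i <;> fin_cases i <;> simp [planeGrad, b]
  have hslice : ContDiff ℝ 1 fun x : Plane => g (x, ξ) := by
    rw [contDiff_iff_contDiffAt]
    intro x
    have h1 := (contDiffAt_of_strip hg (z := (x, ξ)) hξρ).of_le (m := 1) (by simp)
    exact ContDiffAt.comp x h1 (contDiffAt_id.prodMk contDiffAt_const)
  have hslice' : ∀ x, fderiv ℝ (fun x : Plane => g (x, ξ)) x b = fderiv ℝ g (x, ξ) (b, 0) := by
    intro x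
    have hi : HasFDerivAt (fun y : Plane => ((y, ξ) : Plane × Plane))
        (ContinuousLinearMap.inl ℝ Plane Plane) x :=
      (hasFDerivAt_id x).prodMk (hasFDerivAt_const _ _)
    have h1 := HasFDerivAt.comp x (g := g) (f := fun y : Plane => ((y, ξ) : Plane × Plane))
      ((contDiffAt_of_strip hg (z := (x, ξ)) hξρ).differentiableAt (by simp)).hasFDerivAt hi
    have h2 : fderiv ℝ (fun x : Plane => g (x, ξ)) x = _ := h1.fderiv
    rw [h2]
    rfl
  have hmean : realMean (fun x => fderiv ℝ g (x, ξ) (b, 0)) = 0 := by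
    simp only [← hslice']
    exact realMean_fderiv hslice (fun x y hxy => hper x y ξ hξρ hxy) b
  have hcont : ∀ {E : Type} [NormedAddCommGroup E] [NormedSpace ℝ E] {f : Plane × Plane → E}
      {s : ℝ}, ‖ξ‖ < s → ContDiffOn ℝ ∞ f {z | ‖z.2‖ < s} →
      Continuous fun x : Plane => fderiv ℝ f (x, ξ) := by
    intro E _ _ f s hs hf
    have h1 := (hf.continuousOn_fderiv_of_isOpen (isOpen_strip s) (by simp)).comp_continuous
      (f := fun x : Plane => ((x, ξ) : Plane × Plane)) (by fun_prop) (fun x => hs)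
    exact h1
  have hgc := hcont hξρ hg
  have hPc := hcont hξR (hT.contDiffOn_energy hp)
  have hsplit : ∀ x, fderiv ℝ g (x, ξ) (planeGrad (fderiv ℝ (fun w => p (Ψ w)) (x, ξ))) =
      fderiv ℝ g (x, ξ) (planeGrad (fderiv ℝ (fun w => p (Ψ w)) (x, ξ) -
        fderiv ℝ (fun w : Plane × Plane => pInf w.2) (x, ξ))) + fderiv ℝ g (x, ξ) (b, 0) := by
    intro x
    rw [planeGrad_sub, map_sub, hpg]
    ring
  have hIc := hcont hξR (contDiffOn_snd_strip (hN 0).smooth)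
  have hgrad : Continuous fun l : Plane × Plane →L[ℝ] ℝ => planeGrad l := by
    have hl : LipschitzWith 2 fun l : Plane × Plane →L[ℝ] ℝ => planeGrad l :=
      LipschitzWith.of_dist_le_mul fun l m => by
        rw [dist_eq_norm, dist_eq_norm, ← planeGrad_sub]
        exact norm_planeGrad_le _
    exact hl.continuous
  have hc1 : Continuous fun x => fderiv ℝ g (x, ξ) (planeGrad (fderiv ℝ (fun w => p (Ψ w)) (x, ξ) -
      fderiv ℝ (fun w : Plane × Plane => pInf w.2) (x, ξ))) :=
    hgc.clm_apply (hgrad.comp (hPc.sub hIc))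
  have hc2 : Continuous fun x => fderiv ℝ g (x, ξ) (b, 0) := hgc.clm_apply continuous_const
  rw [funext hsplit, realMean_add hc1 hc2, hmean, add_zero]
  refine abs_realMean_le fun x => ?_
  have h1 := hC (x, ξ) hξ1
  have h2 := hD (x, ξ) hξ2
  have h3 := norm_planeGrad_le (fderiv ℝ (fun w => p (Ψ w)) (x, ξ) -
        fderiv ℝ (fun w : Plane × Plane => pInf w.2) (x, ξ))
  calc _ ≤ D * (2 * (C * ‖ξ‖ ^ 2)) :=
        ((fderiv ℝ g (x, ξ)).le_opNorm _).trans (mul_le_mul h2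
          (h3.trans (mul_le_mul_of_nonneg_left h1 zero_le_two)) (norm_nonneg _) hD0)
    _ = D * (2 * C) * ‖ξ‖ ^ 2 := by ring

end Expansion

/-! ### Linear part of q minus the derivative of the local solution -/

section SolutionExpansion

variable {M : Type*} [TopologicalSpace M] [ChartedSpace Plane M] [IsManifold 𝓘(ℝ, Plane) ω M]
variable {γ : Plane → Cotangent M} {R R' : ℝ} {Ψ Ψ' : Plane × Plane → Cotangent M}

theorem contDiff_planeGrad : ContDiff ℝ ∞ planeGrad := by
  have h : ∀ i : Fin 2, ContDiff ℝ ∞ (fun l : Plane × Plane →L[ℝ] ℝ =>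
      l (0, EuclideanSpace.single i 1)) := fun i =>
    (ContinuousLinearMap.apply ℝ ℝ ((0, EuclideanSpace.single i 1) : Plane × Plane)).contDiff
  have h' : ∀ i : Fin 2, ContDiff ℝ ∞ (fun l : Plane × Plane →L[ℝ] ℝ =>
      -l (EuclideanSpace.single i 1, 0)) := fun i =>
    (ContinuousLinearMap.apply ℝ ℝ ((EuclideanSpace.single i 1, 0) : Plane × Plane)).contDiff.neg
  have h2 : planeGrad = fun l => (l (0, EuclideanSpace.single 0 1) • EuclideanSpace.single 0 (1 : ℝ) +
      l (0, EuclideanSpace.single 1 1) • EuclideanSpace.single 1 (1 : ℝ),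
      (-l (EuclideanSpace.single 0 1, 0)) • EuclideanSpace.single 0 (1 : ℝ) +
      (-l (EuclideanSpace.single 1 1, 0)) • EuclideanSpace.single 1 (1 : ℝ)) := by
    funext l
    rw [planeGrad, planePoint_eq, planePoint_eq]
  rw [h2]
  exact (((h 0).smul contDiff_const).add ((h 1).smul contDiff_const)).prodMk
    (((h' 0).smul contDiff_const).add ((h' 1).smul contDiff_const))

theorem modelDeriv_re {G : Cotangent M → ℂ} {m : Cotangent M}
    (hG : MDifferentiableAt phaseModel 𝓘(ℝ, ℂ) G m) (v : PhaseModel) :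
    modelDeriv (fun m => (G m).re) m v = (modelDeriv G m v).re := by
  have h1 := HasMFDerivAt.comp (g := fun z : ℂ => z.re) (f := G) m
    (Complex.reCLM.hasFDerivAt.hasMFDerivAt) hG.hasMFDerivAt
  have h2 : mfderiv phaseModel 𝓘(ℝ, ℝ) (fun m => (G m).re) m = _ := h1.mfderiv
  rw [modelDeriv, h2]
  rfl

theorem contMDiffOn_re {n : WithTop ℕ∞} {G : Cotangent M → ℂ} {V : Set (Cotangent M)}
    (hG : ContMDiffOn phaseModel 𝓘(ℝ, ℂ) n G V) :
    ContMDiffOn phaseModel 𝓘(ℝ, ℝ) n (fun m => (G m).re) V :=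
  (Complex.reCLM.contDiff.contMDiff (n := n)).comp_contMDiffOn hG

/-- A neighbourhood of a torus contains a tube. -/
theorem IsCanonicalTube.exists_image_subset (hT : IsCanonicalTube ∞ γ R Ψ)
    {V : Set (Cotangent M)} (hV : IsOpen V) (hγ : ∀ x, γ x ∈ V) :
    ∃ ρ, 0 < ρ ∧ ρ < R ∧ ∀ z : Plane × Plane, ‖z.2‖ ≤ ρ → Ψ z ∈ V := by
  have ho : IsOpen ({z : Plane × Plane | ‖z.2‖ < R} ∩ Ψ ⁻¹' V) :=
    hT.smooth.continuousOn.isOpen_inter_preimage (isOpen_strip R) hV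
  obtain ⟨u, v, -, hv, hu, hv0, huv⟩ := generalized_tube_lemma isCompact_torusCube
    (isCompact_singleton (x := (0 : Plane))) ho (by
      rintro ⟨x, ξ⟩ ⟨-, hξ⟩
      obtain rfl : ξ = 0 := hξ
      refine ⟨by simpa using hT.radius_pos, ?_⟩
      show Ψ (x, 0) ∈ V
      rw [hT.zero_section]
      exact hγ x)
  obtain ⟨ε, hε, hεv⟩ := Metric.isOpen_iff.1 hv 0 (hv0 rfl)
  refine ⟨min (ε / 2) (R / 2), by have := hT.radius_pos; positivity,
    (min_le_right _ _).trans_lt (by linarith [hT.radius_pos]), fun z hz => ?_⟩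
  obtain ⟨y, hy, hxy⟩ := exists_sameTorusPoint z.1
  have hz1 : z.2 ∈ v := hεv (by
    rw [mem_ball_zero_iff]
    exact (hz.trans (min_le_left _ _)).trans_lt (by linarith))
  have h2 := huv (Set.mk_mem_prod (hu hy) hz1)
  have h3 := hT.stripPeriodic z.1 y z.2 h2.1 hxy
  rw [show z = (z.1, z.2) from rfl, h3]
  exact h2.2

/-- In the tube Ψ' the function Re(q − H_p G) is Re⟨q⟩(ξ) + O(ξ²), as N ≥ 2, so in Ψ it is Re F +
l(ξ) + O(ξ²) with l independent of x. Averaging over x in Ψ removes H_p G to second order. Thus l is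
the derivative of the average formed with Ψ, the one to which the independence assumption refers. -/
theorem exists_solution_expansion {p : Cotangent M → ℝ} {q : Cotangent M → ℂ} {a : Plane}
    {pInf : Plane → ℝ} {F : ℂ} (hT : IsCanonicalTube ∞ γ R Ψ) (hT' : IsCanonicalTube ∞ γ R' Ψ')
    (hp : ContMDiff phaseModel 𝓘(ℝ, ℝ) ∞ p) (hq : ContMDiff phaseModel 𝓘(ℝ, ℂ) ∞ q)
    (hN : ∀ N : ℕ, IsNormalForm ∞ p a R Ψ pInf N) (hF : torusMean (fun x => q (γ x)) = F)
    {N : ℕ} (hN2 : 2 ≤ N) {G : Cotangent M → ℂ} (hG : IsLocalSolution p q Ψ' N G) :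
    ∃ V : Set (Cotangent M), IsOpen V ∧ (∀ x, γ x ∈ V) ∧
      ContMDiffOn phaseModel 𝓘(ℝ, ℂ) ∞ G V ∧ ∃ C ρ : ℝ, 0 ≤ C ∧ 0 < ρ ∧ ρ < R ∧
        ∀ z : Plane × Plane, ‖z.2‖ ≤ ρ → Ψ z ∈ V ∧
          |(q (Ψ z)).re - (hamiltonDeriv p G (Ψ z)).re - F.re -
            fderiv ℝ (fun ξ => (torusAverage q Ψ ξ).re) 0 z.2| ≤ C * ‖z.2‖ ^ 2 := by
  obtain ⟨V, hV, hγV, hGV, r, hr, C, r', hr', hC⟩ := hG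
  have hγV' : ∀ x, γ x ∈ V := fun x => by rw [← hT'.zero_section]; exact hγV x
  have hGV' : ContMDiffOn phaseModel 𝓘(ℝ, ℂ) ∞ G V := hGV.of_le le_top
  refine ⟨V, hV, hγV', hGV', ?_⟩
  obtain ⟨ρ, hρ0, hρR, hρV⟩ := hT.exists_image_subset hV hγV'
  obtain ⟨ρ', hρ0', hρR', hρV'⟩ := hT'.exists_image_subset hV hγV'
  let u : Cotangent M → ℝ := fun m => (q m).re
  let g : Cotangent M → ℝ := fun m => (G m).re
  have hu : ContMDiff phaseModel 𝓘(ℝ, ℝ) ∞ u :=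
    (Complex.reCLM.contDiff.contMDiff (n := ∞)).comp hq
  have hg : ContMDiffOn phaseModel 𝓘(ℝ, ℝ) ∞ g V := contMDiffOn_re hGV'
  have hGd : ∀ m ∈ V, MDifferentiableAt phaseModel 𝓘(ℝ, ℂ) G m := fun m hm =>
    (hGV'.contMDiffAt (hV.mem_nhds hm)).mdifferentiableAt (by simp)
  have hgd : ∀ m ∈ V, MDifferentiableAt phaseModel 𝓘(ℝ, ℝ) g m := fun m hm =>
    (hg.contMDiffAt (hV.mem_nhds hm)).mdifferentiableAt (by simp)
  let f : Cotangent M → ℝ := fun m => u m - modelDeriv g m (hamiltonVec p m)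
  have hfV : ∀ m ∈ V, f m = (q m).re - (hamiltonDeriv p G m).re := by
    intro m hm
    simp only [f, u, g, hamiltonDeriv_eq]
    rw [modelDeriv_re (hGd m hm)]
  have hmem : ∀ z : Plane × Plane, ‖z.2‖ < ρ → Ψ z ∈ V := fun z hz => hρV z hz.le
  have hgs : ContDiffOn ℝ ∞ (fun z => g (Ψ z)) {z | ‖z.2‖ < ρ} :=
    hT.contDiffOn_comp hg hρR.le hmem
  have hPs : ContDiffOn ℝ ∞ (fun z => p (Ψ z)) {z | ‖z.2‖ < ρ} :=
    hT.contDiffOn_comp hp.contMDiffOn hρR.le fun _ _ => Set.mem_univ _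
  have hus : ContDiffOn ℝ ∞ (fun z => u (Ψ z)) {z | ‖z.2‖ < ρ} :=
    hT.contDiffOn_comp hu.contMDiffOn hρR.le fun _ _ => Set.mem_univ _
  have hHs : ContDiffOn ℝ ∞ (fun z => fderiv ℝ (fun w => g (Ψ w)) z
      (planeGrad (fderiv ℝ (fun w => p (Ψ w)) z))) {z | ‖z.2‖ < ρ} :=
    (hgs.fderiv_of_isOpen (isOpen_strip ρ) (by simp)).clm_apply
      (contDiff_planeGrad.comp_contDiffOn (hPs.fderiv_of_isOpen (isOpen_strip ρ) (by simp)))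
  have hfΨ : ∀ z : Plane × Plane, ‖z.2‖ < ρ → f (Ψ z) = u (Ψ z) -
      fderiv ℝ (fun w => g (Ψ w)) z (planeGrad (fderiv ℝ (fun w => p (Ψ w)) z)) := by
    intro z hz
    simp only [f]
    rw [hT.modelDeriv_hamiltonVec (hz.trans hρR) (hp.mdifferentiable (by simp) _)
      (hgd _ (hmem z hz))]
  have hfs : ContDiffOn ℝ ∞ (fun z => f (Ψ z)) {z | ‖z.2‖ < ρ} :=
    (hus.sub hHs).congr fun z hz => hfΨ z hz
  have hA0 : (torusAverage q Ψ' 0).re = F.re := by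
    rw [← hF, torusAverage]
    simp only [hT'.zero_section]
  obtain ⟨l, hl⟩ := exists_linear_expansion hT hT' hρ0 hρR.le hfs
    (A := fun ξ => (torusAverage q Ψ' ξ).re) (c := F.re) (C := max C 0)
    (r := min (min r' ρ') 1) (by positivity) (fun x ξ hξ => by
      have h1 : ‖ξ‖ < r' := hξ.trans_le ((min_le_left _ _).trans (min_le_left _ _))
      have h2 : ‖ξ‖ < ρ' := hξ.trans_le ((min_le_left _ _).trans (min_le_right _ _))
      have h3 : ‖ξ‖ < 1 := hξ.trans_le (min_le_right _ _)
      have hm : Ψ' (x, ξ) ∈ V := hρV' _ h2.le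
      have h4 : f (Ψ' (x, ξ)) = (r (Ψ' (x, ξ))).re := by
        rw [hfV _ hm, hr _ hm, Complex.sub_re]; ring
      rw [h4, ← Complex.sub_re]
      refine (Complex.abs_re_le_norm _).trans ((hC x ξ h1).trans ?_)
      exact mul_le_mul (le_max_left _ _) (pow_le_pow_of_le_one (norm_nonneg _) h3.le hN2)
        (by positivity) (le_max_right _ _)) hA0
  obtain ⟨B, hB0, hB⟩ := hl (ρ / 2) (by linarith)
  obtain ⟨B', r₁, hB0', hr₁, hB'⟩ := exists_realMean_hamiltonDeriv_le hT hp hN hρ0 hgs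
    ((hT.stripPeriodic_comp g).mono hρR.le)
  have hslice : ∀ {f : Plane × Plane → ℝ} {s : ℝ} {ξ : Plane}, ‖ξ‖ < s →
      ContDiffOn ℝ ∞ f {z | ‖z.2‖ < s} → Continuous fun x : Plane => f (x, ξ) := by
    intro f s ξ hs hf
    exact hf.continuousOn.comp_continuous (f := fun x : Plane => ((x, ξ) : Plane × Plane))
      (by fun_prop) (fun x => hs)
  -- The identification of l; it also yields differentiability of the average at 0.
  have hlam : HasFDerivAt (fun ξ => (torusAverage q Ψ ξ).re) l 0 := by
    have hest : ∀ ξ : Plane, ‖ξ‖ < min (ρ / 2) r₁ →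
        |(torusAverage q Ψ ξ).re - (F.re + l ξ)| ≤ (B + B') * ‖ξ‖ ^ 2 := by
      intro ξ hξ
      have h1 : ‖ξ‖ < ρ / 2 := hξ.trans_le (min_le_left _ _)
      have h2 : ‖ξ‖ < ρ := by linarith
      have hqc : Continuous fun x : Plane => q (Ψ (x, ξ)) :=
        hq.continuous.comp (hT.smooth.continuousOn.comp_continuous
          (f := fun x : Plane => ((x, ξ) : Plane × Plane)) (by fun_prop)
          (fun x => show ‖ξ‖ < R from h2.trans hρR))
      have hfc : Continuous fun x => f (Ψ (x, ξ)) := hslice h2 hfs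
      have hHc := hslice h2 hHs
      have e1 : (torusAverage q Ψ ξ).re = realMean (fun x => f (Ψ (x, ξ))) +
          realMean fun x => fderiv ℝ (fun w => g (Ψ w)) (x, ξ)
            (planeGrad (fderiv ℝ (fun w => p (Ψ w)) (x, ξ))) := by
        rw [torusAverage, re_torusMean hqc, ← realMean_add hfc hHc]
        congr 1
        funext x
        rw [hfΨ (x, ξ) h2]
        simp [u]
      have e2 : realMean (fun x => f (Ψ (x, ξ))) - (F.re + l ξ) =
          realMean fun x => f (Ψ (x, ξ)) + -(F.re + l ξ) := by
        rw [realMean_add hfc continuous_const, realMean_const]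
        ring
      have e3 : |realMean (fun x => f (Ψ (x, ξ))) - (F.re + l ξ)| ≤ B * ‖ξ‖ ^ 2 := by
        rw [e2]
        refine abs_realMean_le fun x => ?_
        have := hB (x, ξ) h1.le
        rwa [sub_sub, sub_eq_add_neg] at this
      have e4 := hB' ξ (hξ.trans_le (min_le_right _ _))
      rw [e1]
      rw [abs_le] at e3 e4 ⊢
      constructor <;> linarith
    have h0 : (torusAverage q Ψ 0).re = F.re := by
      have := hest 0 (by simp; constructor <;> linarith)
      rw [norm_zero, zero_pow two_ne_zero, mul_zero, map_zero, add_zero] at this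
      exact sub_eq_zero.1 (abs_eq_zero.1 (le_antisymm this (abs_nonneg _)))
    rw [hasFDerivAt_iff_isLittleO_nhds_zero]
    have : (fun h => (torusAverage q Ψ (0 + h)).re - (torusAverage q Ψ 0).re - l h) =O[𝓝 0]
        fun h : Plane => ‖h‖ ^ 2 := by
      refine Asymptotics.IsBigO.of_bound (B + B') ?_
      filter_upwards [Metric.ball_mem_nhds (0 : Plane)
        (show 0 < min (ρ / 2) r₁ by positivity)] with h hh
      rw [mem_ball_zero_iff] at hh
      have := hest h hh
      rw [zero_add, h0, norm_pow, norm_norm, Real.norm_eq_abs, sub_sub]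
      exact this
    exact this.trans_isLittleO (Asymptotics.isLittleO_norm_pow_id one_lt_two)
  refine ⟨B, ρ / 2, hB0, by positivity, by linarith, fun z hz => ⟨hmem z (by linarith), ?_⟩⟩
  rw [hlam.fderiv, ← hfV _ (hmem z (by linarith))]
  exact hB z hz

end SolutionExpansion

/-! ### The energy surface near a torus -/

section EnergySurface

variable {M : Type*} [TopologicalSpace M] [ChartedSpace Plane M] [IsManifold 𝓘(ℝ, Plane) ω M]
variable {γ : Plane → Cotangent M} {R : ℝ} {Ψ : Plane × Plane → Cotangent M}
  {p : Cotangent M → ℝ} {a : Plane} {pInf : Plane → ℝ}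

/-- The vector k = (0, 1) in the Diophantine condition. This lets p = 0 be solved for ξ₂. -/
theorem Diophantine.snd_ne_zero (ha : Diophantine a) : a 1 ≠ 0 := by
  obtain ⟨C, hC, N, hN, h⟩ := ha
  have h1 := h ![0, 1] (fun h => by simpa using congrFun h 1)
  intro h0
  have hn : ‖(!₂[(0 : ℝ), 1] : Plane)‖ = 1 := by simp [EuclideanSpace.norm_eq]
  simp [h0, hn] at h1
  linarith

theorem norm_plane_le_add (x : Plane) : ‖x‖ ≤ |x 0| + |x 1| := by
  conv_lhs => rw [plane_eq_sum x]
  refine (norm_add_le _ _).trans (le_of_eq ?_)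
  simp [norm_smul]

/-- Near the torus the energy surface is a Lipschitz graph over `(x, ξ₁)`. -/
theorem IsCanonicalTube.exists_energy_graph (hT : IsCanonicalTube ∞ γ R Ψ)
    (hp : ContMDiff phaseModel 𝓘(ℝ, ℝ) ∞ p)
    (hN : ∀ N : ℕ, IsNormalForm ∞ p a R Ψ pInf N) (ha : a 1 ≠ 0) {ρ₀ : ℝ} (hρ₀ : 0 < ρ₀) :
    ∃ ρ C s₀ : ℝ, 0 < ρ ∧ ρ ≤ ρ₀ ∧ ρ < R ∧ 0 < C ∧ 0 < s₀ ∧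
      (∀ x, p (Ψ (x, 0)) = 0) ∧
      (∀ x ξ η : Plane, ‖ξ‖ ≤ ρ → ‖η‖ ≤ ρ → p (Ψ (x, ξ)) = 0 → p (Ψ (x, η)) = 0 →
        ‖ξ - η‖ ≤ C * |ξ 0 - η 0|) ∧
      ∀ (x : Plane) (s : ℝ), |s| ≤ s₀ → ∃ ξ : Plane, ξ 0 = s ∧ ‖ξ‖ ≤ ρ ∧ p (Ψ (x, ξ)) = 0 := by
  have hR := hT.radius_pos
  obtain ⟨B, hB0, hB⟩ := hT.fderiv_energy_sub_linear_le hp hN (ρ := R / 2) (by linarith)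
    (by linarith)
  have hα : 0 < |a 1| := abs_pos.2 ha
  -- For |ξ| ≤ ρ the differential of p differs from a·dξ by at most |a₂|/4, so p is dominated by
  -- a₂ξ₂ in the fibre direction.
  set ρ := min (min ρ₀ (R / 2)) (|a 1| / (4 * (B + 1))) with hρ
  have hρ0 : 0 < ρ := by positivity
  have hρ1 : ρ ≤ ρ₀ := (min_le_left _ _).trans (min_le_left _ _)
  have hρ2 : ρ ≤ R / 2 := (min_le_left _ _).trans (min_le_right _ _)
  have hρ3 : B * ρ ≤ |a 1| / 4 := by
    have h1 : ρ * (4 * (B + 1)) ≤ |a 1| := (le_div_iff₀ (by positivity)).1 (min_le_right _ _)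
    nlinarith
  have hdiff : ∀ x ξ η : Plane, ‖ξ‖ ≤ ρ → ‖η‖ ≤ ρ →
      |p (Ψ (x, ξ)) - p (Ψ (x, η)) - (a 0 * (ξ 0 - η 0) + a 1 * (ξ 1 - η 1))| ≤
        |a 1| / 4 * ‖ξ - η‖ := by
    intro x ξ η hξ hη
    have h1 := (convex_strip ρ).norm_image_sub_le_of_norm_hasFDerivWithin_le'
      (f := fun w => p (Ψ w)) (f' := fderiv ℝ fun w => p (Ψ w))
      (φ := (innerSL ℝ a).comp (ContinuousLinearMap.snd ℝ Plane Plane)) (C := |a 1| / 4)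
      (fun z hz => ((contDiffAt_of_strip (hT.contDiffOn_energy hp)
        (lt_of_le_of_lt hz (by linarith))).differentiableAt
        (by simp)).hasFDerivAt.hasFDerivWithinAt)
      (fun z hz => (hB z (le_trans hz hρ2)).trans
        ((mul_le_mul_of_nonneg_left hz hB0).trans hρ3))
      (show ((x, η) : Plane × Plane) ∈ _ from hη) (show ((x, ξ) : Plane × Plane) ∈ _ from hξ)
    have h2 : ((x, ξ) : Plane × Plane) - (x, η) = (0, ξ - η) := by ext1 <;> simp
    rw [h2, Prod.norm_def, norm_zero, max_eq_right (norm_nonneg _), Real.norm_eq_abs] at h1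
    have h3 : ((innerSL ℝ a).comp (ContinuousLinearMap.snd ℝ Plane Plane)) (0, ξ - η) =
        a 0 * (ξ 0 - η 0) + a 1 * (ξ 1 - η 1) := by
      show inner ℝ a (ξ - η) = _
      rw [plane_inner]
      simp
    rwa [h3] at h1
  have hzero : ∀ x, p (Ψ (x, 0)) = 0 := by
    intro x
    obtain ⟨C, r, hr, hC⟩ := (hN 0).remainder
    have := hC x 0 (by simpa using hr)
    rw [(hN 0).hasFDerivAt_zero.1] at this
    simpa using this
  -- For |s| ≤ s₀ the contribution of ξ₁ = s cannot outweigh a₂ξ₂ at ξ₂ = ±ρ/2, so p changes sign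
  -- between these points.
  set s₀ := min (ρ / 2) (|a 1| * ρ / (8 * (|a 0| + |a 1|))) with hs
  have hs0 : 0 < s₀ := by positivity
  have hs1 : s₀ ≤ ρ / 2 := min_le_left _ _
  have hs2 : s₀ * (8 * (|a 0| + |a 1|)) ≤ |a 1| * ρ :=
    (le_div_iff₀ (by positivity)).1 (min_le_right _ _)
  refine ⟨ρ, 1 + (|a 0| + |a 1|) / |a 1| * 2, s₀, hρ0, hρ1, by linarith, by positivity, hs0, hzero,
    ?_, ?_⟩
  · intro x ξ η hξ hη h0 h0'
    have h1 := hdiff x ξ η hξ hη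
    rw [h0, h0', sub_self, zero_sub, abs_neg] at h1
    have h2 := norm_plane_le_add (ξ - η)
    simp only [PiLp.sub_apply] at h2
    set d0 := ξ 0 - η 0
    set d1 := ξ 1 - η 1
    have h3 : |a 1| * |d1| ≤ |a 0| * |d0| + |a 1| / 4 * (|d0| + |d1|) := by
      have := abs_sub_abs_le_abs_sub (a 1 * d1) (-(a 0 * d0))
      rw [abs_neg, abs_mul, abs_mul, sub_neg_eq_add, add_comm] at this
      have h4 := mul_le_mul_of_nonneg_left h2 (show 0 ≤ |a 1| / 4 by positivity)
      linarith
    have h5 : |d1| ≤ (|a 0| + |a 1|) / |a 1| * 2 * |d0| := by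
      have h6 : |a 1| * |d1| ≤ |a 1| * ((|a 0| + |a 1|) / |a 1| * 2 * |d0|) := by
        have : |a 1| * ((|a 0| + |a 1|) / |a 1| * 2 * |d0|) = (|a 0| + |a 1|) * 2 * |d0| := by
          field_simp
        rw [this]
        nlinarith [abs_nonneg d0, abs_nonneg d1, mul_nonneg hα.le (abs_nonneg d0),
          mul_nonneg (abs_nonneg (a 0)) (abs_nonneg d0), mul_nonneg hα.le (abs_nonneg d1)]
      exact le_of_mul_le_mul_left h6 hα
    linarith
  · intro x s hs'
    let φ : ℝ → ℝ := fun t => p (Ψ (x, !₂[s, t]))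
    have hnorm : ∀ t : ℝ, |t| ≤ ρ / 2 → ‖(!₂[s, t] : Plane)‖ ≤ ρ := by
      intro t ht
      refine (norm_plane_le_add _).trans ?_
      simp only [Matrix.cons_val_zero, Matrix.cons_val_one]
      linarith
    have hφ : ContinuousOn φ (Set.uIcc (-(ρ / 2)) (ρ / 2)) := by
      have h1 : ContinuousOn (fun w => p (Ψ w)) {z : Plane × Plane | ‖z.2‖ < R} :=
        (hT.contDiffOn_energy hp).continuousOn
      refine h1.comp (f := fun t : ℝ => ((x, !₂[s, t]) : Plane × Plane))
        (Continuous.continuousOn ?_) fun t ht => ?_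
      · exact continuous_const.prodMk
          (continuous_planePoint.comp (continuous_const.prodMk continuous_id))
      · rw [Set.uIcc_of_le (by linarith)] at ht
        exact (hnorm t (abs_le.2 ⟨ht.1, ht.2⟩)).trans_lt (by linarith)
    have hest : ∀ t : ℝ, |t| ≤ ρ / 2 → |φ t - (a 0 * s + a 1 * t)| ≤ |a 1| / 4 * (|s| + |t|) := by
      intro t ht
      have h1 := hdiff x !₂[s, t] 0 (hnorm t ht) (by simpa using hρ0.le)
      rw [hzero, sub_zero, sub_zero] at h1
      have h2 := norm_plane_le_add (!₂[s, t] : Plane)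
      simp at h1 h2
      exact h1.trans (mul_le_mul_of_nonneg_left h2 (by positivity))
    have hpos := hest (ρ / 2) (by rw [abs_of_pos (by linarith)])
    have hneg := hest (-(ρ / 2)) (by rw [abs_neg, abs_of_pos (by linarith)])
    rw [abs_neg, abs_of_pos (show 0 < ρ / 2 by linarith)] at hneg
    rw [abs_of_pos (show 0 < ρ / 2 by linarith)] at hpos
    have hb : |a 0 * s| + |a 1| / 4 * (|s| + ρ / 2) < |a 1| * (ρ / 2) := by
      rw [abs_mul]
      nlinarith [mul_le_mul_of_nonneg_left hs' (abs_nonneg (a 0)),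
        mul_le_mul_of_nonneg_left hs' hα.le, mul_pos hα hρ0]
    have ha0 := abs_le.1 (le_refl |a 0 * s|)
    have hmem : (0 : ℝ) ∈ Set.uIcc (φ (-(ρ / 2))) (φ (ρ / 2)) := by
      rw [abs_le] at hpos hneg
      rw [Set.mem_uIcc]
      rcases lt_or_gt_of_ne ha with h | h
      · right
        rw [abs_of_neg h] at hpos hneg hb
        constructor <;> linarith
      · left
        rw [abs_of_pos h] at hpos hneg hb
        constructor <;> linarith
    obtain ⟨t, ht, ht0⟩ := intermediate_value_uIcc hφ hmem
    rw [Set.uIcc_of_le (by linarith)] at ht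
    exact ⟨!₂[s, t], by simp, hnorm t (abs_le.2 ⟨ht.1, ht.2⟩), ht0⟩

end EnergySurface

/-! ### Collar charts: slope, near-invariance and local solution -/

section CollarChart

variable {M : Type*} [TopologicalSpace M] [ChartedSpace Plane M] [IsManifold 𝓘(ℝ, Plane) ω M]

/-- The data near one torus that enter the construction of the global weight: in the open set `U`,
which on the energy surface is the collar `|ξ₁| < s₀` of the torus, `y` is the coordinate `ξ₁`, and
`g` solves `H_p g = u - f₀ - c y + O(y²)` on the energy surface. -/
structure IsCollarChart (p u : Cotangent M → ℝ) (R : ℝ) (Ψ : Plane × Plane → Cotangent M)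
    (γ : Plane → Cotangent M) (f₀ c s₀ : ℝ) (U : Set (Cotangent M)) (y g : Cotangent M → ℝ) :
    Prop where
  isOpen : IsOpen U
  pos : 0 < s₀
  smooth_y : ContMDiffOn phaseModel 𝓘(ℝ, ℝ) ∞ y U
  smooth_g : ContMDiffOn phaseModel 𝓘(ℝ, ℝ) ∞ g U
  torus_mem : ∀ x, γ x ∈ U ∧ p (γ x) = 0 ∧ y (γ x) = 0
  isCompact : ∀ s < s₀, IsCompact {m | m ∈ U ∧ p m = 0 ∧ |y m| ≤ s}
  mem : ∀ x ξ : Plane, ‖ξ‖ < R → |ξ 0| < s₀ → p (Ψ (x, ξ)) = 0 →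
    Ψ (x, ξ) ∈ U ∧ y (Ψ (x, ξ)) = ξ 0
  exists_rep : ∀ m ∈ U, p m = 0 → ∃ x ξ : Plane, ‖ξ‖ < R ∧ Ψ (x, ξ) = m ∧ y m = ξ 0
  exists_level : ∀ s : ℝ, |s| < s₀ → ∃ m ∈ U, p m = 0 ∧ y m = s
  torus_of_zero : ∀ m ∈ U, p m = 0 → y m = 0 → ∃ x, γ x = m
  connected : ∀ m ∈ U, p m = 0 → ∀ δ σ : ℝ, 0 < δ → (σ = 1 ∨ σ = -1) → δ ≤ σ * y m →
    ∃ Z : Set (Cotangent M), IsPreconnected Z ∧ m ∈ Z ∧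
      (∀ m' ∈ Z, m' ∈ U ∧ p m' = 0 ∧ δ ≤ σ * y m') ∧ ∃ m' ∈ Z, y m' = σ * δ
  flat : ∀ k : ℕ, 1 ≤ k → ∃ C s : ℝ, 0 ≤ C ∧ 0 < s ∧ ∀ m ∈ U, p m = 0 → |y m| ≤ s →
    |modelDeriv y m (hamiltonVec p m)| ≤ C * |y m| ^ k
  solution : ∃ C : ℝ, 0 ≤ C ∧ ∀ m ∈ U, p m = 0 →
    |u m - modelDeriv g m (hamiltonVec p m) - f₀ - c * y m| ≤ C * y m ^ 2
  bound : ∃ C : ℝ, 0 ≤ C ∧ ∀ m ∈ U, p m = 0 → |g m| ≤ C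

variable {γ : Plane → Cotangent M} {R R' : ℝ} {Ψ Ψ' : Plane × Plane → Cotangent M}

/-- Hamilton's equation for ξ₁. As p_∞ does not depend on x, it makes ξ₁ invariant to infinite order
at the torus. -/
theorem IsCanonicalTube.modelDeriv_fiberCoord (hT : IsCanonicalTube ∞ γ R Ψ) {p : Cotangent M → ℝ}
    (hp : ContMDiff phaseModel 𝓘(ℝ, ℝ) ∞ p) {z : Plane × Plane} (hz : ‖z.2‖ < R) :
    modelDeriv (fun m => fiberCoord R Ψ m 0) (Ψ z) (hamiltonVec p (Ψ z)) =
      -fderiv ℝ (fun w => p (Ψ w)) z (EuclideanSpace.single 0 1, 0) := by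
  have hs : ContMDiffAt phaseModel 𝓘(ℝ, ℝ) ∞ (fun m => fiberCoord R Ψ m 0) (Ψ z) :=
    ((EuclideanSpace.proj (0 : Fin 2) : Plane →L[ℝ] ℝ).contDiff.contMDiff (n := ∞)).contMDiffAt.comp
      (Ψ z) (hT.contMDiffAt_fiberCoord hz)
  rw [hT.modelDeriv_hamiltonVec hz (hp.mdifferentiable (by simp) _)
    (hs.mdifferentiableAt (by simp))]
  have hev : (fun w => fiberCoord R Ψ (Ψ w) 0) =ᶠ[𝓝 z] fun w : Plane × Plane =>
      ((EuclideanSpace.proj (0 : Fin 2) : Plane →L[ℝ] ℝ).comp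
        (ContinuousLinearMap.snd ℝ Plane Plane)) w := by
    filter_upwards [(isOpen_strip R).mem_nhds hz] with w hw
    rw [hT.fiberCoord_apply hw]
    rfl
  rw [hev.fderiv_eq, ContinuousLinearMap.fderiv]
  simp [planeGrad]

theorem continuous_abs_coord : Continuous fun z : Plane × Plane => |z.2 0| :=
  ((EuclideanSpace.proj (0 : Fin 2) : Plane →L[ℝ] ℝ).continuous.comp continuous_snd).abs

/-- On the energy surface |ξ| ≤ C|ξ₁|, so orders in ξ become orders in y. There a·ξ = O(ξ²), and
eliminating ξ₂ from the linear part l leaves the slope c = l₁ − (l₂/a₂)a₁. If c were 0, l would be a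
multiple of dp_∞(0), against linear independence. -/
theorem exists_collarChart {p : Cotangent M → ℝ} {q : Cotangent M → ℂ} {a : Plane}
    {pInf : Plane → ℝ} {F : ℂ} (hT : IsCanonicalTube ∞ γ R Ψ) (hT' : IsCanonicalTube ∞ γ R' Ψ')
    (hp : ContMDiff phaseModel 𝓘(ℝ, ℝ) ∞ p) (hq : ContMDiff phaseModel 𝓘(ℝ, ℂ) ∞ q)
    (ha : Diophantine a)
    (hN : ∀ N : ℕ, IsNormalForm ∞ p a R Ψ pInf N) (hF : torusMean (fun x => q (γ x)) = F)
    (hgraph : IsEnergyGraph p R Ψ) (hindep : LinearIndependent ℝ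
      ![fderiv ℝ pInf 0, fderiv ℝ (fun ξ => (torusAverage q Ψ ξ).re) 0])
    {N : ℕ} (hN2 : 2 ≤ N) {G : Cotangent M → ℂ} (hG : IsLocalSolution p q Ψ' N G)
    {O : Set (Cotangent M)} (hO : IsOpen O) (hγO : ∀ x, γ x ∈ O) :
    ∃ (U : Set (Cotangent M)) (y : Cotangent M → ℝ) (c s₀ : ℝ), U ⊆ O ∧ c ≠ 0 ∧
      ContMDiffOn phaseModel 𝓘(ℝ, ℂ) ∞ G U ∧
      IsCollarChart p (fun m => (q m).re) R Ψ γ F.re c s₀ U y (fun m => (G m).re) := by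
  have hα := ha.snd_ne_zero
  obtain ⟨V, hV, hγV, hGV, C₁, ρ₁, hC₁, hρ₁, hρ₁R, hexp⟩ :=
    exists_solution_expansion hT hT' hp hq hN hF hN2 hG
  set l := fderiv ℝ (fun ξ => (torusAverage q Ψ ξ).re) 0 with hl
  obtain ⟨ρ₂, hρ₂, hρ₂R, hρO⟩ := hT.exists_image_subset hO hγO
  obtain ⟨A₁, r₁, hr₁, hA₁⟩ := (hN 1).remainder
  obtain ⟨A₂, r₂, hr₂, hA₂⟩ := (hN 1).linear_part
  obtain ⟨ρ, C, t₀, hρ0, hρle, hρR, hC0, ht₀, hzero, hlip, hex⟩ := hT.exists_energy_graph hp hN hα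
    (show 0 < min (min ρ₁ ρ₂) (min (r₁ / 2) (r₂ / 2)) by positivity)
  have e₁ : ρ ≤ ρ₁ := hρle.trans ((min_le_left _ _).trans (min_le_left _ _))
  have e₂ : ρ ≤ ρ₂ := hρle.trans ((min_le_left _ _).trans (min_le_right _ _))
  have e₃ : ρ < r₁ := (hρle.trans ((min_le_right _ _).trans (min_le_left _ _))).trans_lt
    (by linarith)
  have e₄ : ρ < r₂ := (hρle.trans ((min_le_right _ _).trans (min_le_right _ _))).trans_lt
    (by linarith)
  -- Cs₀ ≤ ρ/2 keeps the part |ξ₁| < s₀ of the surface in |ξ| ≤ ρ/2, away from the boundary of the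
  -- tube |ξ| < ρ; hence its compactness.
  set s₀ := min t₀ (ρ / (2 * C)) with hs₀
  have hs0 : 0 < s₀ := by positivity
  have hs1 : s₀ ≤ t₀ := min_le_left _ _
  have hs2 : C * s₀ ≤ ρ / 2 := by
    have := (le_div_iff₀ (by positivity)).1 (min_le_right t₀ (ρ / (2 * C)))
    linarith
  have hnorm : ∀ x ξ : Plane, ‖ξ‖ ≤ ρ → p (Ψ (x, ξ)) = 0 → ‖ξ‖ ≤ C * |ξ 0| := by
    intro x ξ hξ h0
    have := hlip x ξ 0 hξ (by simpa using hρ0.le) h0 (hzero x)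
    simpa using this
  -- The graph property in the full tube |ξ| < R excludes further sheets of the surface over small
  -- ξ₁: every such point is the one found close to the torus.
  have hball : ∀ x ξ : Plane, ‖ξ‖ < R → |ξ 0| < s₀ → p (Ψ (x, ξ)) = 0 → ‖ξ‖ ≤ C * |ξ 0| := by
    intro x ξ hξ h0 hpξ
    obtain ⟨η, hη0, hη, hpη⟩ := hex x (ξ 0) (h0.le.trans hs1)
    rw [hgraph x ξ η hξ (hη.trans_lt hρR) hpξ hpη hη0.symm]
    exact hnorm x η hη hpη
  let U : Set (Cotangent M) := Ψ '' {z | ‖z.2‖ < ρ ∧ |z.2 0| < s₀}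
  let y : Cotangent M → ℝ := fun m => fiberCoord R Ψ m 0
  have hy : ∀ z : Plane × Plane, ‖z.2‖ < R → y (Ψ z) = z.2 0 := fun z hz => by
    simp only [y, hT.fiberCoord_apply hz]
  have hUO : U ⊆ O := by
    rintro _ ⟨z, hz, rfl⟩
    exact hρO z (hz.1.le.trans e₂)
  have hUV : U ⊆ V := by
    rintro _ ⟨z, hz, rfl⟩
    exact (hexp z (hz.1.le.trans e₁)).1
  have hc0 : l (EuclideanSpace.single 0 1) - l (EuclideanSpace.single 1 1) / a 1 * a 0 ≠ 0 := by
    intro h0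
    have h1 := (LinearIndependent.pair_iff.1 hindep) (l (EuclideanSpace.single 1 1) / a 1) (-1) (by
      rw [(hN 0).hasFDerivAt_zero.2.fderiv]
      ext v
      conv_lhs => rw [plane_eq_sum v]
      simp [PiLp.inner_apply, Fin.sum_univ_two]
      have h2 : l (EuclideanSpace.single 0 1) = l (EuclideanSpace.single 1 1) / a 1 * a 0 := by
        linarith
      rw [h2]
      field_simp
      ring)
    exact absurd h1.2 (by norm_num)
  refine ⟨U, y, _, s₀, hUO, hc0, hGV.mono hUV, ?_⟩
  refine ⟨?_, hs0, ?_, (contMDiffOn_re hGV).mono hUV, ?_, ?_, ?_, ?_, ?_, ?_, ?_, ?_, ?_, ?_⟩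
  · refine hT.isOpen_image ?_ fun z hz => hz.1.trans hρR
    exact (isOpen_strip ρ).inter (isOpen_lt continuous_abs_coord continuous_const)
  · rintro _ ⟨z, hz, rfl⟩
    exact (((EuclideanSpace.proj (0 : Fin 2) : Plane →L[ℝ] ℝ).contDiff.contMDiff
      (n := ∞)).contMDiffAt.comp (Ψ z)
      (hT.contMDiffAt_fiberCoord (hz.1.trans hρR))).contMDiffWithinAt
  · intro x
    rw [← hT.zero_section]
    refine ⟨⟨(x, 0), ⟨by simpa using hρ0, by simpa using hs0⟩, rfl⟩, hzero x, ?_⟩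
    rw [hy _ (by simpa using hT.radius_pos)]
    simp
  · intro s hs
    have h1 : {m | m ∈ U ∧ p m = 0 ∧ |y m| ≤ s} =
        Ψ '' {z | ‖z.2‖ ≤ ρ / 2 ∧ |z.2 0| ≤ s} ∩ {m | p m = 0} := by
      ext m
      constructor
      · rintro ⟨⟨z, hz, rfl⟩, hpz, hyz⟩
        rw [hy z (hz.1.trans hρR)] at hyz
        refine ⟨⟨z, ⟨?_, hyz⟩, rfl⟩, hpz⟩
        refine (hnorm z.1 z.2 hz.1.le hpz).trans (le_trans ?_ hs2)
        exact mul_le_mul_of_nonneg_left hz.2.le hC0.le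
      · rintro ⟨⟨z, hz, rfl⟩, hpz⟩
        refine ⟨⟨z, ⟨by linarith [hz.1], hz.2.trans_lt hs⟩, rfl⟩, hpz, ?_⟩
        rw [hy z (by linarith [hz.1])]
        exact hz.2
    rw [h1]
    refine (hT.isCompact_image ?_ (show ρ / 2 < R by linarith) (fun z hz => hz.1)
      (fun x x' ξ _ h => h)).inter_right (isClosed_eq hp.continuous continuous_const)
    exact (isClosed_le continuous_snd.norm continuous_const).inter
      (isClosed_le continuous_abs_coord continuous_const)
  · intro x ξ hξ hξ0 hpξ
    refine ⟨⟨(x, ξ), ⟨?_, hξ0⟩, rfl⟩, hy (x, ξ) hξ⟩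
    have := hball x ξ hξ hξ0 hpξ
    have h2 := mul_le_mul_of_nonneg_left hξ0.le hC0.le
    show ‖ξ‖ < ρ
    linarith
  · rintro _ ⟨z, hz, rfl⟩ -
    exact ⟨z.1, z.2, hz.1.trans hρR, rfl, hy z (hz.1.trans hρR)⟩
  · intro s hs
    obtain ⟨ξ, hξ0, hξ, hpξ⟩ := hex 0 s (hs.le.trans hs1)
    have h1 := hnorm 0 ξ hξ hpξ
    rw [← hξ0] at hs
    have h2 := mul_le_mul_of_nonneg_left hs.le hC0.le
    refine ⟨_, ⟨(0, ξ), ⟨show ‖ξ‖ < ρ by linarith, hs⟩, rfl⟩, hpξ, ?_⟩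
    rw [hy (0, ξ) (hξ.trans_lt hρR)]
    exact hξ0
  · rintro _ ⟨z, hz, rfl⟩ hpz hyz
    rw [hy z (hz.1.trans hρR)] at hyz
    have := hnorm z.1 z.2 hz.1.le hpz
    rw [hyz, abs_zero, mul_zero, norm_le_zero_iff] at this
    exact ⟨z.1, by rw [← hT.zero_section, ← this]⟩
  · rintro _ ⟨z, hz, rfl⟩ hpz δ σ hδ hσ hδy
    rw [hy z (hz.1.trans hρR)] at hδy
    have hσ2 : σ * σ = 1 := by rcases hσ with rfl | rfl <;> norm_num
    have hσ1 : |σ| = 1 := by rcases hσ with rfl | rfl <;> norm_num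
    have hlt : σ * z.2 0 < s₀ := by
      refine (le_abs_self _).trans_lt ?_
      rw [abs_mul, hσ1, one_mul]
      exact hz.2
    have hex' : ∀ s : ℝ, ∃ ξ : Plane, s ∈ Set.Icc δ (σ * z.2 0) →
        ξ 0 = σ * s ∧ ‖ξ‖ ≤ ρ ∧ p (Ψ (z.1, ξ)) = 0 := by
      intro s
      by_cases hs : s ∈ Set.Icc δ (σ * z.2 0)
      · obtain ⟨ξ, hξ⟩ := hex z.1 (σ * s) (by
          rw [abs_mul, hσ1, one_mul, abs_of_nonneg (hδ.le.trans hs.1)]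
          linarith [hs.2])
        exact ⟨ξ, fun _ => hξ⟩
      · exact ⟨0, fun h => absurd h hs⟩
    -- The path with x fixed and ξ₁ running from the given value to σδ. It is Lipschitz because the
    -- surface is a Lipschitz graph.
    choose e he using hex'
    have hec : ContinuousOn e (Set.Icc δ (σ * z.2 0)) := by
      refine LipschitzOnWith.continuousOn (K := C.toNNReal) ?_
      refine LipschitzOnWith.of_dist_le_mul fun s hs t ht => ?_
      obtain ⟨a1, a2, a3⟩ := he s hs
      obtain ⟨b1, b2, b3⟩ := he t ht
      have := hlip z.1 (e s) (e t) a2 b2 a3 b3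
      rw [a1, b1, ← mul_sub, abs_mul, hσ1, one_mul] at this
      rwa [dist_eq_norm, Real.dist_eq, Real.coe_toNNReal _ hC0.le]
    have hsmall : ∀ s ∈ Set.Icc δ (σ * z.2 0), ‖e s‖ < ρ ∧ |e s 0| < s₀ := by
      intro s hs
      obtain ⟨a1, a2, a3⟩ := he s hs
      have h0 : |e s 0| < s₀ := by
        rw [a1, abs_mul, hσ1, one_mul, abs_of_nonneg (hδ.le.trans hs.1)]
        exact hs.2.trans_lt hlt
      have h1 := hnorm z.1 (e s) a2 a3
      have h2 := mul_le_mul_of_nonneg_left h0.le hC0.le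
      exact ⟨by linarith, h0⟩
    refine ⟨(fun s => Ψ (z.1, e s)) '' Set.Icc δ (σ * z.2 0), ?_, ?_, ?_, ?_⟩
    · refine isPreconnected_Icc.image _ ?_
      exact hT.smooth.continuousOn.comp (continuousOn_const.prodMk hec)
        fun s hs => (hsmall s hs).1.trans hρR
    · refine ⟨σ * z.2 0, ⟨hδy, le_rfl⟩, ?_⟩
      obtain ⟨a1, a2, a3⟩ := he _ (show σ * z.2 0 ∈ Set.Icc δ (σ * z.2 0) from ⟨hδy, le_rfl⟩)
      rw [← mul_assoc, hσ2, one_mul] at a1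
      show Ψ (z.1, e (σ * z.2 0)) = Ψ z
      rw [hgraph z.1 (e (σ * z.2 0)) z.2 (a2.trans_lt hρR) (hz.1.trans hρR) a3 hpz a1]
    · rintro _ ⟨s, hs, rfl⟩
      obtain ⟨a1, a2, a3⟩ := he s hs
      refine ⟨⟨(z.1, e s), hsmall s hs, rfl⟩, a3, ?_⟩
      show δ ≤ σ * y (Ψ (z.1, e s))
      rw [hy (z.1, e s) (a2.trans_lt hρR), a1, ← mul_assoc, hσ2, one_mul]
      exact hs.1
    · have hδm : δ ∈ Set.Icc δ (σ * z.2 0) := ⟨le_rfl, hδy⟩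
      obtain ⟨a1, a2, a3⟩ := he _ hδm
      refine ⟨_, ⟨δ, hδm, rfl⟩, ?_⟩
      show y (Ψ (z.1, e δ)) = σ * δ
      rw [hy (z.1, e δ) (a2.trans_lt hρR), a1]
  · intro k hk
    obtain ⟨B, r, hB0, hr, hrR, hB⟩ := hT.fderiv_energy_sub_le hp hN hk
    refine ⟨B * C ^ k, r / C, by positivity, by positivity, ?_⟩
    rintro _ ⟨z, hz, rfl⟩ hpz hyz
    have hzR : ‖z.2‖ < R := hz.1.trans hρR
    rw [hy z hzR] at hyz ⊢
    have h1 := hnorm z.1 z.2 hz.1.le hpz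
    have h2 : ‖z.2‖ ≤ r := by
      have := (le_div_iff₀ hC0).1 hyz
      linarith
    rw [hT.modelDeriv_fiberCoord hp hzR, abs_neg]
    have hpI : DifferentiableAt ℝ pInf z.2 := by
      have h1 : IsOpen {η : Plane | ‖η‖ < R} := isOpen_lt continuous_norm continuous_const
      exact ((hN 0).smooth.contDiffAt (h1.mem_nhds hzR)).differentiableAt (by simp)
    -- Subtracting p_∞ is harmless in x-directions, and d(p − p_∞) vanishes to any order.
    have h3 : fderiv ℝ (fun w => p (Ψ w)) z (EuclideanSpace.single 0 1, 0) =
        (fderiv ℝ (fun w => p (Ψ w)) z - fderiv ℝ (fun w : Plane × Plane => pInf w.2) z)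
          (EuclideanSpace.single 0 1, 0) := by
      rw [fderiv_comp_snd hpI]
      simp
    rw [h3, ← Real.norm_eq_abs]
    refine (ContinuousLinearMap.le_opNorm _ _).trans ?_
    have h4 : ‖((EuclideanSpace.single 0 1, 0) : Plane × Plane)‖ = 1 := by simp [Prod.norm_def]
    rw [h4, mul_one]
    refine (hB z h2).trans ?_
    rw [mul_assoc, ← mul_pow]
    exact mul_le_mul_of_nonneg_left (pow_le_pow_left₀ (norm_nonneg _) h1 k) hB0
  · refine ⟨(C₁ + |l (EuclideanSpace.single 1 1) / a 1| * (max A₁ 0 + max A₂ 0)) * C ^ 2,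
      by positivity, ?_⟩
    rintro _ ⟨z, hz, rfl⟩ hpz
    have hzR : ‖z.2‖ < R := hz.1.trans hρR
    have hmV : Ψ z ∈ V := hUV ⟨z, hz, rfl⟩
    have h1 := (hexp z (hz.1.le.trans e₁)).2
    have h2 := hnorm z.1 z.2 hz.1.le hpz
    rw [hy z hzR]
    have h3 : modelDeriv (fun m => (G m).re) (Ψ z) (hamiltonVec p (Ψ z)) =
        (hamiltonDeriv p G (Ψ z)).re :=
      modelDeriv_re ((hGV.contMDiffAt (hV.mem_nhds hmV)).mdifferentiableAt (by simp)) _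
    rw [h3]
    have h4 := hA₁ z.1 z.2 (hz.1.trans e₃)
    have h5 := hA₂ z.2 (hz.1.trans e₄)
    have hpz' : p (Ψ (z.1, z.2)) = 0 := hpz
    rw [hpz', zero_sub, abs_neg] at h4
    have h6 : |a 0 * z.2 0 + a 1 * z.2 1| ≤ (max A₁ 0 + max A₂ 0) * ‖z.2‖ ^ 2 := by
      rw [plane_inner] at h5
      have h7 : A₁ * ‖z.2‖ ^ (1 + 1) ≤ max A₁ 0 * ‖z.2‖ ^ 2 :=
        mul_le_mul_of_nonneg_right (le_max_left _ _) (by positivity)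
      have h8 : A₂ * ‖z.2‖ ^ 2 ≤ max A₂ 0 * ‖z.2‖ ^ 2 :=
        mul_le_mul_of_nonneg_right (le_max_left _ _) (by positivity)
      rw [abs_le] at h4 h5 ⊢
      constructor <;> linarith
    have h7 : l z.2 - (l (EuclideanSpace.single 0 1) -
        l (EuclideanSpace.single 1 1) / a 1 * a 0) * z.2 0 =
        l (EuclideanSpace.single 1 1) / a 1 * (a 0 * z.2 0 + a 1 * z.2 1) := by
      conv_lhs => rw [plane_eq_sum z.2]
      simp
      field_simp
      ring
    have h8 : |l z.2 - (l (EuclideanSpace.single 0 1) -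
        l (EuclideanSpace.single 1 1) / a 1 * a 0) * z.2 0| ≤
        |l (EuclideanSpace.single 1 1) / a 1| * ((max A₁ 0 + max A₂ 0) * ‖z.2‖ ^ 2) := by
      rw [h7, abs_mul]
      exact mul_le_mul_of_nonneg_left h6 (abs_nonneg _)
    have h9 : ‖z.2‖ ^ 2 ≤ C ^ 2 * z.2 0 ^ 2 := by
      rw [← sq_abs (z.2 0), ← mul_pow]
      exact pow_le_pow_left₀ (norm_nonneg _) h2 2
    have h10 := mul_le_mul_of_nonneg_left h9 (show 0 ≤ C₁ +
      |l (EuclideanSpace.single 1 1) / a 1| * (max A₁ 0 + max A₂ 0) by positivity)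
    have h11 : (C₁ + |l (EuclideanSpace.single 1 1) / a 1| * (max A₁ 0 + max A₂ 0)) * ‖z.2‖ ^ 2 =
      C₁ * ‖z.2‖ ^ 2 +
        |l (EuclideanSpace.single 1 1) / a 1| * ((max A₁ 0 + max A₂ 0) * ‖z.2‖ ^ 2) := by ring
    rw [mul_assoc]
    refine le_trans ?_ h10
    rw [h11]
    rw [abs_le] at h1 h8 ⊢
    constructor <;> linarith
  · have hcpt : IsCompact (Ψ '' {z : Plane × Plane | ‖z.2‖ ≤ ρ}) :=
      hT.isCompact_image (isClosed_le continuous_snd.norm continuous_const) hρR (fun z hz => hz)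
        (fun _ _ _ _ h => h)
    obtain ⟨B, hB⟩ := hcpt.exists_bound_of_continuousOn (f := fun m => (G m).re)
      ((contMDiffOn_re hGV).continuousOn.mono (by
        rintro _ ⟨z, hz, rfl⟩
        exact (hexp z (le_trans hz e₁)).1))
    refine ⟨max B 0, le_max_right _ _, ?_⟩
    rintro _ ⟨z, hz, rfl⟩ -
    exact (hB _ ⟨z, hz.1.le, rfl⟩).trans (le_max_left _ _)

end CollarChart

/-! ### Boundary bumping -/

section BoundaryBumping

/-- A component of the complement of a relatively open subset of a compact connected space touches
the closure of this subset. -/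
theorem exists_mem_component_closure {X : Type*} [TopologicalSpace X] [T2Space X] {E A : Set X}
    (hE : IsPreconnected E) (hA : IsCompact (E \ A)) (hne : (E ∩ A).Nonempty)
    {x : X} (hx : x ∈ E \ A) :
    ∃ z ∈ connectedComponentIn (E \ A) x, z ∈ closure A := by
  by_contra! hcon
  have : CompactSpace (E \ A : Set X) := isCompact_iff_compactSpace.1 hA
  let x' : (E \ A : Set X) := ⟨x, hx⟩
  let K : Set (E \ A : Set X) := Subtype.val ⁻¹' closure A
  have hK : IsCompact K := (isClosed_closure.preimage continuous_subtype_val).isCompact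
  -- In a compact Hausdorff space a component is the intersection of the clopen sets around it; if
  -- it misses closure A, then by compactness so does one of these sets.
  have hKe : K ∩ ⋂ s : { s : Set (E \ A : Set X) // IsClopen s ∧ x' ∈ s }, (s : Set _) = ∅ := by
    rw [← connectedComponent_eq_iInter_isClopen]
    refine Set.eq_empty_of_forall_notMem fun z hz => hcon z ?_ hz.1
    rw [connectedComponentIn_eq_image hx]
    exact ⟨z, hz.2, rfl⟩
  have : Nonempty { s : Set (E \ A : Set X) // IsClopen s ∧ x' ∈ s } :=
    ⟨⟨Set.univ, isClopen_univ, trivial⟩⟩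
  obtain ⟨⟨s, hs, hxs⟩, hsK⟩ := hK.elim_directed_family_closed
    (fun s : { s : Set (E \ A : Set X) // IsClopen s ∧ x' ∈ s } => (s : Set _))
    (fun s => s.2.1.1) hKe (fun s t => ⟨⟨s.1 ∩ t.1, s.2.1.inter t.2.1, s.2.2, t.2.2⟩,
      Set.inter_subset_left, Set.inter_subset_right⟩)
  have himg : ∀ t : Set (E \ A : Set X), IsClosed t → IsClosed (Subtype.val '' t) := fun t ht =>
    (ht.isCompact.image continuous_subtype_val).isClosed
  -- The clopen set and the union of its complement with closure A are closed and cover E, so they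
  -- meet by connectedness. This contradicts the choice of `s`.
  have h1 : (E ∩ (Subtype.val '' s ∩ (Subtype.val '' sᶜ ∪ closure A))).Nonempty := by
    refine isPreconnected_closed_iff.1 hE _ _ (himg s hs.1)
      ((himg sᶜ hs.2.isClosed_compl).union isClosed_closure) ?_ ⟨x, hx.1, x', hxs, rfl⟩ ?_
    · intro z hz
      by_cases hzA : z ∈ A
      · exact Or.inr (Or.inr (subset_closure hzA))
      · by_cases hzs : (⟨z, hz, hzA⟩ : (E \ A : Set X)) ∈ s
        · exact Or.inl ⟨_, hzs, rfl⟩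
        · exact Or.inr (Or.inl ⟨_, hzs, rfl⟩)
    · obtain ⟨z, hz, hzA⟩ := hne
      exact ⟨z, hz, Or.inr (subset_closure hzA)⟩
  obtain ⟨_, -, ⟨z, hz, rfl⟩, h2⟩ := h1
  rcases h2 with ⟨z', hz', hzz⟩ | h2
  · exact hz' (Subtype.val_injective hzz ▸ hz)
  · have : z ∈ K ∩ s := ⟨h2, hz⟩
    rw [hsK] at this
    exact this

end BoundaryBumping

/-! ### Orbits as test curves, and cutoff functions -/

section Orbit

variable {M : Type*} [TopologicalSpace M] [ChartedSpace Plane M] [IsManifold 𝓘(ℝ, Plane) ω M]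

/-- Since the orbit stays on p = 0, H_p f at `m` can be computed from information on the energy
surface alone, including a maximum attained there. -/
theorem exists_orbit [T2Space M] {p : Cotangent M → ℝ}
    (hp : ContMDiff phaseModel 𝓘(ℝ, ℝ) ∞ p) (hc : ∃ c : ℝ, 0 < c ∧ IsCompact {m | |p m| ≤ c})
    {m : Cotangent M} (hm : p m = 0) :
    ∃ c : ℝ → Cotangent M, c 0 = m ∧ Continuous c ∧ (∀ t, p (c t) = 0) ∧
      ∀ f : Cotangent M → ℝ, MDifferentiableAt phaseModel 𝓘(ℝ, ℝ) f m →
        HasDerivAt (fun t => f (c t)) (modelDeriv f m (hamiltonVec p m)) 0 := by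
  obtain ⟨φ, h0, -, hsmooth, hφ⟩ := exists_hamilton_flow hp hc
  obtain ⟨hE, -, hint⟩ := hφ m hm
  refine ⟨fun t => φ t m, h0 m, hsmooth.continuous.comp (continuous_id.prodMk continuous_const),
    hE, fun f hf => ?_⟩
  have h1 : HasDerivAt (fun t => f (φ t m)) (modelDeriv f (φ 0 m) (hamiltonVec p (φ 0 m))) 0 :=
    hasDerivAt_comp_curve hint (by rw [h0]; exact hf)
  rwa [h0] at h1

theorem modelDeriv_congr {F : Type*} [NormedAddCommGroup F] [NormedSpace ℝ F]
    {f g : Cotangent M → F} {m : Cotangent M} (h : f =ᶠ[𝓝 m] g) :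
    modelDeriv f m = modelDeriv g m := h.mfderiv_eq

/-- A smooth cutoff function that is `1` near a compact set. -/
theorem exists_cutoff [T2Space M] [SecondCountableTopology M] {A U : Set (Cotangent M)}
    (hA : IsCompact A) (hU : IsOpen U) (hAU : A ⊆ U) :
    ∃ b : Cotangent M → ℝ, ContMDiff phaseModel 𝓘(ℝ, ℝ) ∞ b ∧ (∀ᶠ m in 𝓝ˢ A, b m = 1) ∧
      tsupport b ⊆ U ∧ HasCompactSupport b := by
  have : IsManifold phaseModel ∞ (Cotangent M) := .of_le (n := ω) le_top
  obtain ⟨B, hB, hAB, hBU⟩ := exists_compact_between hA hU hAU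
  obtain ⟨f, hf1, hf0, -⟩ := exists_contMDiffMap_one_nhds_of_subset_interior phaseModel (n := ⊤)
    hA.isClosed hAB
  have hsub : Function.support f ⊆ B := fun m hm => by
    by_contra h
    exact hm (hf0 m h)
  exact ⟨f, f.contMDiff, hf1, (closure_minimal hsub hB.isClosed).trans hBU,
    HasCompactSupport.intro hB hf0⟩

theorem contMDiff_cutoff_smul {F : Type*} [NormedAddCommGroup F] [NormedSpace ℝ F]
    {b : Cotangent M → ℝ} {h : Cotangent M → F} {U : Set (Cotangent M)}
    (hb : ContMDiff phaseModel 𝓘(ℝ, ℝ) ∞ b) (hU : IsOpen U) (hbU : tsupport b ⊆ U)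
    (hh : ContMDiffOn phaseModel 𝓘(ℝ, F) ∞ h U) :
    ContMDiff phaseModel 𝓘(ℝ, F) ∞ (fun m => b m • h m) := by
  refine contMDiff_of_tsupport fun m hm => ?_
  have h1 : m ∈ U := hbU (tsupport_smul_subset_left b h hm)
  exact (hb m).smul (hh.contMDiffAt (hU.mem_nhds h1))

end Orbit

/-! ### The transversal slope is not negative -/

section Estimates

variable {M : Type*} [TopologicalSpace M] [ChartedSpace Plane M] [IsManifold 𝓘(ℝ, Plane) ω M]
variable {γ : Plane → Cotangent M} {R : ℝ} {Ψ : Plane × Plane → Cotangent M}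
  {p u : Cotangent M → ℝ} {f₀ c s₀ : ℝ} {U : Set (Cotangent M)} {y g : Cotangent M → ℝ}

/-- Since the coordinate `y` is almost invariant, no function grows along the flow throughout a
thin shell. -/
theorem IsCollarChart.exists_deriv_le [T2Space M]
    (h : IsCollarChart p u R Ψ γ f₀ c s₀ U y g)
    (hp : ContMDiff phaseModel 𝓘(ℝ, ℝ) ∞ p) (hc : ∃ c : ℝ, 0 < c ∧ IsCompact {m | |p m| ≤ c})
    {δ : ℝ} (hδ : 0 < δ) (hδs : 2 * δ < s₀) {w : Cotangent M → ℝ}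
    (hw : ContMDiffOn phaseModel 𝓘(ℝ, ℝ) ∞ w U) {W b : ℝ}
    (hW : ∀ m ∈ U, p m = 0 → |w m| ≤ W)
    (hb : ∀ m ∈ U, p m = 0 → |y m| ≤ 2 * δ → |modelDeriv y m (hamiltonVec p m)| ≤ b) :
    ∃ m ∈ U, p m = 0 ∧ δ ≤ y m ∧ y m ≤ 2 * δ ∧
      modelDeriv w m (hamiltonVec p m) ≤ 4 * (2 * W + 1) / δ * b := by
  let A : Set (Cotangent M) := {m | m ∈ U ∧ p m = 0 ∧ |y m| ≤ 2 * δ} ∩ {m | m ∈ U ∧ δ ≤ y m}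
  have hAU : ∀ m ∈ A, m ∈ U ∧ p m = 0 ∧ δ ≤ y m ∧ y m ≤ 2 * δ := fun m hm =>
    ⟨hm.1.1, hm.1.2.1, hm.2.2, (abs_le.1 hm.1.2.2).2⟩
  have hAmem : ∀ m ∈ U, p m = 0 → δ ≤ y m → y m ≤ 2 * δ → m ∈ A := fun m hm h1 h2 h3 =>
    ⟨⟨hm, h1, abs_le.2 ⟨by linarith, h3⟩⟩, hm, h2⟩
  have hA : IsCompact A := by
    have h1 := h.isCompact _ hδs
    have h2 : ContinuousOn y {m | m ∈ U ∧ p m = 0 ∧ |y m| ≤ 2 * δ} :=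
      h.smooth_y.continuousOn.mono fun m hm => hm.1
    have h3 := h1.of_isClosed_subset
      (h2.preimage_isClosed_of_isClosed h1.isClosed (isClosed_Ici (a := δ))) Set.inter_subset_left
    convert h3 using 1
    ext m
    constructor
    · exact fun hm => ⟨hm.1, hm.2.2⟩
    · exact fun hm => ⟨hm.1, hm.1.1, hm.2⟩
  obtain ⟨m₁, hm₁U, hm₁p, hm₁y⟩ := h.exists_level (3 * δ / 2) (by
    rw [abs_of_pos (by positivity)]; linarith)
  have hm₁ : m₁ ∈ A := hAmem m₁ hm₁U hm₁p (by linarith) (by linarith)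
  have hW0 : 0 ≤ W := (abs_nonneg _).trans (hW m₁ hm₁U hm₁p)
  -- At |y − 3δ/2| = δ/2 the penalty equals 2W + 1, more than w can vary. The maximum of E over the
  -- shell therefore lies in its interior.
  set κ := 4 * (2 * W + 1) / δ ^ 2 with hκ
  have hκ0 : 0 < κ := by positivity
  have hκδ : κ * δ ^ 2 = 4 * (2 * W + 1) := by rw [hκ]; field_simp
  let E : Cotangent M → ℝ := fun m => w m - κ * (y m - 3 * δ / 2) ^ 2
  have hEc : ContinuousOn E A := by
    have h1 := hw.continuousOn.mono (s := U) (t := A) fun m hm => (hAU m hm).1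
    have h2 := h.smooth_y.continuousOn.mono (s := U) (t := A) fun m hm => (hAU m hm).1
    exact h1.sub (continuousOn_const.mul ((h2.sub continuousOn_const).pow 2))
  obtain ⟨m, hmA, hmax⟩ := hA.exists_isMaxOn ⟨m₁, hm₁⟩ hEc
  obtain ⟨hmU, hmp, hm1, hm2⟩ := hAU m hmA
  have hcenter : -W ≤ E m := by
    have h1 : E m₁ ≤ E m := hmax hm₁
    have h2 : E m₁ = w m₁ := by simp only [E, hm₁y]; ring
    have := abs_le.1 (hW m₁ hm₁U hm₁p)
    linarith
  have hint : δ < y m ∧ y m < 2 * δ := by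
    have h1 := abs_le.1 (hW m hmU hmp)
    have h2 : κ * (y m - 3 * δ / 2) ^ 2 < κ * (δ / 2) ^ 2 := by
      have : κ * (δ / 2) ^ 2 = 2 * W + 1 := by
        rw [div_pow, ← mul_div_assoc, hκδ]; ring
      simp only [E] at hcenter
      linarith
    have h3 := abs_lt_of_sq_lt_sq (lt_of_mul_lt_mul_left h2 hκ0.le) (by linarith)
    rw [abs_lt] at h3
    constructor <;> linarith
  obtain ⟨o, ho0, hoc, hop, hod⟩ := exists_orbit hp hc hmp
  have hyd := hod y ((h.smooth_y.contMDiffAt (h.isOpen.mem_nhds hmU)).mdifferentiableAt (by simp))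
  have hwd := hod w ((hw.contMDiffAt (h.isOpen.mem_nhds hmU)).mdifferentiableAt (by simp))
  have hEd : HasDerivAt (fun t => E (o t)) (modelDeriv w m (hamiltonVec p m) -
      κ * (2 * (y m - 3 * δ / 2) * modelDeriv y m (hamiltonVec p m))) 0 := by
    have h1 := hwd.sub (((hyd.sub_const (3 * δ / 2)).pow 2).const_mul κ)
    refine h1.congr_deriv ?_
    simp [ho0]
  -- The orbit stays on p = 0 and in the open shell for short times, so the maximum is one along the
  -- orbit. There H_p w = 2κ(y − 3δ/2) H_p y, at most κδb.
  have hloc : IsLocalMax (fun t => E (o t)) 0 := by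
    have h1 : ∀ᶠ t in 𝓝 (0 : ℝ), o t ∈ U :=
      hoc.continuousAt.eventually_mem (by rw [ho0]; exact h.isOpen.mem_nhds hmU)
    have h2 : ∀ᶠ t in 𝓝 (0 : ℝ), y (o t) ∈ Set.Ioo δ (2 * δ) :=
      hyd.continuousAt.eventually_mem (by rw [ho0]; exact Ioo_mem_nhds hint.1 hint.2)
    filter_upwards [h1, h2] with t ht1 ht2
    rw [ho0]
    exact hmax (hAmem _ ht1 (hop t) ht2.1.le ht2.2.le)
  have hzero := hloc.hasDerivAt_eq_zero hEd
  refine ⟨m, hmU, hmp, hm1, hm2, ?_⟩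
  have hyb := hb m hmU hmp (abs_le.2 ⟨by linarith, hm2⟩)
  have h3 : |(y m - 3 * δ / 2) * modelDeriv y m (hamiltonVec p m)| ≤ δ / 2 * b := by
    rw [abs_mul]
    exact mul_le_mul (abs_le.2 ⟨by linarith, by linarith⟩) hyb (abs_nonneg _) (by linarith)
  have h4 : κ * (2 * (δ / 2 * b)) = 4 * (2 * W + 1) / δ * b := by
    rw [hκ]; field_simp
  rw [← h4]
  have h5 := mul_le_mul_of_nonneg_left ((le_abs_self _).trans h3) (show 0 ≤ 2 * κ by positivity)
  linarith

/-- The sign of the transversal slope `c`: it is not negative if arbitrarily thin shells carry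
averages `f ≥ f₀` of `u` with a primitive of polynomial size. -/
theorem IsCollarChart.exists_slope_nonneg [T2Space M]
    (h : IsCollarChart p u R Ψ γ f₀ c s₀ U y g)
    (hp : ContMDiff phaseModel 𝓘(ℝ, ℝ) ∞ p) (hc : ∃ c : ℝ, 0 < c ∧ IsCompact {m | |p m| ≤ c})
    {B : ℝ} (hB : 0 ≤ B) (N₁ : ℕ) :
    ∃ ε : ℝ, 0 < ε ∧ ∀ δ : ℝ, 0 < δ → δ < ε → ∀ G f : Cotangent M → ℝ,
      ContMDiff phaseModel 𝓘(ℝ, ℝ) ∞ G →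
      (∀ m, p m = 0 → modelDeriv G m (hamiltonVec p m) = u m - f m) →
      (∀ m, p m = 0 → |G m| ≤ B * δ⁻¹ ^ N₁) →
      (∀ m ∈ U, p m = 0 → δ ≤ y m → f₀ ≤ f m) → 0 ≤ c := by
  by_cases hc0 : 0 ≤ c
  · exact ⟨1, one_pos, fun _ _ _ _ _ _ _ _ _ => hc0⟩
  rw [not_le] at hc0
  -- Of the order N₁ + 3, the size δ^{-N₁} of g − G and the division by δ leave δ².
  obtain ⟨C₁, s₁, hC₁, hs₁, hflat⟩ := h.flat (N₁ + 3) (by omega)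
  obtain ⟨C₂, hC₂, hsol⟩ := h.solution
  obtain ⟨C₃, hC₃, hg⟩ := h.bound
  set D := 4 * (2 * (C₃ + B) + 1) * (C₁ * 2 ^ (N₁ + 3)) + 4 * C₂ + 1 with hD
  have hD0 : 0 < D := by positivity
  refine ⟨min (min 1 (s₀ / 2)) (min (s₁ / 2) (-c / D)), ?_, ?_⟩
  · have := h.pos
    have h2 : 0 < -c / D := div_pos (by linarith) hD0
    positivity
  intro δ hδ hδε G f hG hGf hGb hf
  exfalso
  have e1 : δ < 1 := hδε.trans_le ((min_le_left _ _).trans (min_le_left _ _))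
  have e2 : δ < s₀ / 2 := hδε.trans_le ((min_le_left _ _).trans (min_le_right _ _))
  have e3 : δ < s₁ / 2 := hδε.trans_le ((min_le_right _ _).trans (min_le_left _ _))
  have e4 : δ * D < -c :=
    (lt_div_iff₀ hD0).1 (hδε.trans_le ((min_le_right _ _).trans (min_le_right _ _)))
  have hT1 : 1 ≤ δ⁻¹ ^ N₁ := one_le_pow₀ ((one_le_inv₀ hδ).2 e1.le)
  obtain ⟨m, hmU, hmp, hm1, hm2, hmd⟩ := h.exists_deriv_le hp hc hδ (by linarith)
    (w := fun m => g m - G m) (h.smooth_g.sub hG.contMDiffOn) (W := (C₃ + B) * δ⁻¹ ^ N₁)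
    (b := C₁ * (2 * δ) ^ (N₁ + 3))
    (fun m hmU hmp => by
      have h1 := hg m hmU hmp
      have h2 := hGb m hmp
      have h3 : C₃ ≤ C₃ * δ⁻¹ ^ N₁ := le_mul_of_one_le_right hC₃ hT1
      have h4 := abs_sub (g m) (G m)
      linarith)
    (fun m hmU hmp hmy => (hflat m hmU hmp (by linarith)).trans
      (mul_le_mul_of_nonneg_left (pow_le_pow_left₀ (abs_nonneg _) hmy _) hC₁))
  obtain ⟨o, ho0, -, -, hod⟩ := exists_orbit hp hc hmp
  -- H_p(g − G) = f − f₀ − cy + O(y²), which for c < 0 is at least |c|δ − O(δ²); the maximum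
  -- argument gives a point where it is only O(δ²).
  have hd : modelDeriv (fun m => g m - G m) m (hamiltonVec p m) =
      modelDeriv g m (hamiltonVec p m) - modelDeriv G m (hamiltonVec p m) := by
    have hg' := (h.smooth_g.contMDiffAt (h.isOpen.mem_nhds hmU)).mdifferentiableAt
      (n := ∞) (by simp)
    have hG' := (hG m).mdifferentiableAt (n := ∞) (by simp)
    exact (hod _ (hg'.sub hG')).unique ((hod g hg').sub (hod G hG'))
  rw [hd, hGf m hmp] at hmd
  have h5 := (abs_le.1 (hsol m hmU hmp)).1
  have h5' := (abs_le.1 (hsol m hmU hmp)).2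
  have h6 := hf m hmU hmp hm1
  have h7 : C₂ * y m ^ 2 ≤ 4 * C₂ * δ * δ := by
    have : y m ^ 2 ≤ (2 * δ) ^ 2 := pow_le_pow_left₀ (by linarith) hm2 2
    nlinarith
  have h8 : 4 * (2 * ((C₃ + B) * δ⁻¹ ^ N₁) + 1) / δ * (C₁ * (2 * δ) ^ (N₁ + 3)) ≤
      4 * (2 * (C₃ + B) + 1) * (C₁ * 2 ^ (N₁ + 3)) * δ * δ := by
    have h9 : 2 * ((C₃ + B) * δ⁻¹ ^ N₁) + 1 ≤ (2 * (C₃ + B) + 1) * δ⁻¹ ^ N₁ := by nlinarith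
    have h10 : (2 * δ) ^ (N₁ + 3) = 2 ^ (N₁ + 3) * (δ ^ N₁ * δ ^ 3) := by rw [mul_pow, pow_add δ]
    calc 4 * (2 * ((C₃ + B) * δ⁻¹ ^ N₁) + 1) / δ * (C₁ * (2 * δ) ^ (N₁ + 3))
        ≤ 4 * ((2 * (C₃ + B) + 1) * δ⁻¹ ^ N₁) / δ * (C₁ * (2 * δ) ^ (N₁ + 3)) := by gcongr
      _ = 4 * (2 * (C₃ + B) + 1) * (C₁ * 2 ^ (N₁ + 3)) * δ * δ := by
          rw [h10, inv_pow]
          field_simp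
  have h11 : -c * δ ≤ -c * y m := mul_le_mul_of_nonneg_left hm1 (by linarith)
  have h12 : -c * δ ≤ δ * D * δ := by
    rw [hD]
    nlinarith
  have h13 : δ * D * δ < -c * δ := mul_lt_mul_of_pos_right e4 hδ
  linarith

end Estimates

/-! ### Interpolation in a thin shell -/

section Transition

variable {M : Type*} [TopologicalSpace M] [ChartedSpace Plane M] [IsManifold 𝓘(ℝ, Plane) ω M]
variable {γ : Plane → Cotangent M} {R : ℝ} {Ψ : Plane × Plane → Cotangent M}
  {p u : Cotangent M → ℝ} {f₀ c s₀ : ℝ} {U : Set (Cotangent M)} {y g : Cotangent M → ℝ}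

/-- A cutoff function on the line: `1` on `[-1, 1]` and `0` outside `(-2, 2)`. -/
def shellCutoff : ContDiffBump (0 : ℝ) := ⟨1, 2, one_pos, one_lt_two⟩

theorem shellCutoff_eq_one {t : ℝ} (ht : |t| ≤ 1) : shellCutoff t = 1 :=
  shellCutoff.one_of_mem_closedBall (by
    rw [Metric.mem_closedBall, Real.dist_eq, sub_zero]; exact ht)

theorem shellCutoff_eq_zero {t : ℝ} (ht : 2 ≤ |t|) : shellCutoff t = 0 :=
  shellCutoff.zero_of_le_dist (by rw [Real.dist_eq, sub_zero]; exact ht)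

theorem exists_abs_deriv_shellCutoff_le : ∃ B, 0 ≤ B ∧ ∀ t, |deriv shellCutoff t| ≤ B := by
  obtain ⟨B, hB⟩ := shellCutoff.hasCompactSupport.deriv.exists_bound_of_continuous
    ((shellCutoff.contDiff (n := 1)).continuous_deriv (by simp))
  exact ⟨B, (norm_nonneg _).trans (hB 0), hB⟩

theorem deriv_shellCutoff_eq_zero {t : ℝ} (ht : |t| < 1) : deriv shellCutoff t = 0 := by
  have h : (shellCutoff : ℝ → ℝ) =ᶠ[𝓝 t] fun _ => 1 := by
    filter_upwards [continuous_abs.continuousAt.eventually_lt continuousAt_const ht] with s hs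
    exact shellCutoff_eq_one hs.le
  rw [h.deriv_eq, deriv_const]

/-- The interpolated function has the right behaviour in the shell around the torus. -/
theorem IsCollarChart.exists_transition [T2Space M]
    (h : IsCollarChart p u R Ψ γ f₀ c s₀ U y g)
    (hp : ContMDiff phaseModel 𝓘(ℝ, ℝ) ∞ p) (hc : ∃ c : ℝ, 0 < c ∧ IsCompact {m | |p m| ≤ c})
    (hc0 : 0 < c) {B c₀ : ℝ} (hB : 0 ≤ B) (hc₀ : 0 < c₀) (N₁ : ℕ) {N₂ : ℕ} (hN₂ : 1 ≤ N₂) :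
    ∃ ε : ℝ, 0 < ε ∧ ∀ δ : ℝ, 0 < δ → δ < ε → 2 * δ < s₀ ∧ ∀ G f : Cotangent M → ℝ,
      ContMDiff phaseModel 𝓘(ℝ, ℝ) ∞ G →
      (∀ m, p m = 0 → modelDeriv G m (hamiltonVec p m) = u m - f m) →
      (∀ m, p m = 0 → |G m| ≤ B * δ⁻¹ ^ N₁) →
      (∀ σ : ℝ, (σ = 1 ∨ σ = -1) → ∀ m ∈ U, p m = 0 → δ ≤ σ * y m →
        c₀ * δ ^ N₂ ≤ σ * (f m - f₀)) →
      ∀ m ∈ U, p m = 0 → |y m| ≤ 2 * δ → y m ≠ 0 →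
        0 < y m * (u m - f₀ - modelDeriv (fun m => G m + shellCutoff (y m / δ) * (g m - G m)) m
          (hamiltonVec p m)) := by
  obtain ⟨B', hB'0, hB'⟩ := exists_abs_deriv_shellCutoff_le
  -- The cutoff error χ'(y/δ)(H_p y/δ)(g − G) is then O(δ^{N₂+1}), small against the lower bound
  -- δ^{N₂} of the average.
  obtain ⟨C₁, s₁, hC₁, hs₁, hflat⟩ := h.flat (N₁ + N₂ + 2) (by omega)
  obtain ⟨C₂, hC₂, hsol⟩ := h.solution
  obtain ⟨C₃, hC₃, hg⟩ := h.bound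
  set D := B' * (C₁ * 2 ^ (N₁ + N₂ + 2)) * (C₃ + B) + 1 with hD
  have hD0 : 0 < D := by positivity
  have hspos := h.pos
  refine ⟨min (min 1 (s₀ / 2)) (min (min (s₁ / 2) (c / (4 * (C₂ + 1)))) (min (c / 2) c₀ / D)),
    by positivity, ?_⟩
  intro δ hδ hδε
  have e1 : δ < 1 := hδε.trans_le ((min_le_left _ _).trans (min_le_left _ _))
  have e2 : δ < s₀ / 2 := hδε.trans_le ((min_le_left _ _).trans (min_le_right _ _))
  have e3 : δ < s₁ / 2 := hδε.trans_le
    ((min_le_right _ _).trans ((min_le_left _ _).trans (min_le_left _ _)))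
  have e4 : δ < c / (4 * (C₂ + 1)) := hδε.trans_le
    ((min_le_right _ _).trans ((min_le_left _ _).trans (min_le_right _ _)))
  have e5 : δ * D < min (c / 2) c₀ :=
    (lt_div_iff₀ hD0).1 (hδε.trans_le ((min_le_right _ _).trans (min_le_right _ _)))
  rw [lt_div_iff₀ (by positivity)] at e4
  refine ⟨by linarith, fun G f hG hGf hGb hf m hmU hmp hmy hy0 => ?_⟩
  have hT1 : 1 ≤ δ⁻¹ ^ N₁ := one_le_pow₀ ((one_le_inv₀ hδ).2 e1.le)
  obtain ⟨o, ho0, -, -, hod⟩ := exists_orbit hp hc hmp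
  have hg' := (h.smooth_g.contMDiffAt (h.isOpen.mem_nhds hmU)).mdifferentiableAt (n := ∞) (by simp)
  have hy' := (h.smooth_y.contMDiffAt (h.isOpen.mem_nhds hmU)).mdifferentiableAt (n := ∞) (by simp)
  have hG' := (hG m).mdifferentiableAt (n := ∞) (by simp)
  set χ := shellCutoff (y m / δ) with hχ
  set y' := modelDeriv y m (hamiltonVec p m) with hyd
  set g' := modelDeriv g m (hamiltonVec p m) with hgd
  have hmd : modelDeriv (fun m => G m + shellCutoff (y m / δ) * (g m - G m)) m (hamiltonVec p m) =
      (u m - f m) + (deriv shellCutoff (y m / δ) * (y' / δ) * (g m - G m) +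
        χ * (g' - (u m - f m))) := by
    have hs : ContMDiffAt phaseModel 𝓘(ℝ, ℝ) ∞
        (fun m => G m + shellCutoff (y m / δ) * (g m - G m)) m := by
      have a1 := h.smooth_y.contMDiffAt (h.isOpen.mem_nhds hmU)
      have a2 := h.smooth_g.contMDiffAt (h.isOpen.mem_nhds hmU)
      have a3 : ContDiff ℝ ∞ fun t : ℝ => shellCutoff (t / δ) :=
        shellCutoff.contDiff.comp (contDiff_id.div_const δ)
      exact (hG m).add ((a3.contMDiff.contMDiffAt.comp m a1).mul (a2.sub (hG m)))
    refine (hod _ (hs.mdifferentiableAt (by simp))).unique ?_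
    have d1 := hod G hG'
    rw [hGf m hmp] at d1
    have d2 := hod g hg'
    have d3 := (hod y hy').div_const δ
    have d4 : HasDerivAt (fun t => shellCutoff (y (o t) / δ))
        (deriv shellCutoff (y m / δ) * (y' / δ)) 0 := by
      have d5 : HasDerivAt shellCutoff (deriv shellCutoff (y m / δ)) (y (o 0) / δ) := by
        rw [ho0]
        exact ((shellCutoff.contDiff (n := 1)).differentiable (by simp) _).hasDerivAt
      exact HasDerivAt.comp (h₂ := (shellCutoff : ℝ → ℝ)) (h := fun t => y (o t) / δ) 0 d5 d3
    have d6 := d1.add (d4.mul (d2.sub d1))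
    simp only [ho0, Pi.sub_apply] at d6
    exact d6
  obtain ⟨σ, hσ, hσy⟩ : ∃ σ : ℝ, (σ = 1 ∨ σ = -1) ∧ σ * y m = |y m| := by
    rcases lt_or_gt_of_ne hy0 with hlt | hgt
    · exact ⟨-1, Or.inr rfl, by rw [abs_of_neg hlt]; ring⟩
    · exact ⟨1, Or.inl rfl, by rw [abs_of_pos hgt]; ring⟩
  have hσ2 : σ * σ = 1 := by rcases hσ with rfl | rfl <;> norm_num
  have hσ1 : |σ| = 1 := by rcases hσ with rfl | rfl <;> norm_num
  have hypos : 0 < |y m| := abs_pos.2 hy0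
  -- With σ the sign of y: a convex combination of the two partial solutions minus the cutoff error.
  suffices hkey : 0 < σ * (χ * (u m - g' - f₀) + (1 - χ) * (f m - f₀) -
      deriv shellCutoff (y m / δ) * (y' / δ) * (g m - G m)) by
    rw [hmd]
    have h1 : y m = σ * |y m| := by rw [← hσy, ← mul_assoc, hσ2, one_mul]
    have h2 := mul_pos hypos hkey
    have h3 : ∀ E : ℝ, |y m| * (σ * E) = y m * E := fun E => by
      rw [← mul_assoc, mul_comm (|y m|) σ, ← h1]
    rw [h3] at h2
    refine h2.trans_eq ?_
    ring
  have hmain : c / 2 * |y m| ≤ σ * (u m - g' - f₀) := by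
    have h1 := hsol m hmU hmp
    have h2 : abs (σ * (u m - g' - f₀) - c * |y m|) ≤ C₂ * (2 * δ) * |y m| := by
      rw [← hσy, show σ * (u m - g' - f₀) - c * (σ * y m) = σ * (u m - g' - f₀ - c * y m) by ring,
        abs_mul, hσ1, one_mul, hσy]
      refine h1.trans ?_
      rw [← sq_abs (y m)]
      have := mul_le_mul_of_nonneg_right hmy hypos.le
      nlinarith
    have h3 := (abs_le.1 h2).1
    nlinarith
  have hχ0 : 0 ≤ χ := shellCutoff.nonneg
  have hχ1 : χ ≤ 1 := shellCutoff.le_one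
  -- For |y| < δ nothing is known about the average, but there χ = 1 locally and the linear term
  -- decides. For |y| ≥ δ both members of the combination are at least min(c/2, c₀)δ^{N₂}.
  rcases lt_or_ge |y m| δ with hlt | hge
  · have h1 : |y m / δ| < 1 := by
      rw [abs_div, abs_of_pos hδ, div_lt_one hδ]; exact hlt
    rw [deriv_shellCutoff_eq_zero h1, hχ, shellCutoff_eq_one h1.le]
    have : 0 < c / 2 * |y m| := by positivity
    linarith
  · have hf' := hf σ hσ m hmU hmp (by rwa [hσy])
    have hδN : δ ^ N₂ ≤ δ := by
      calc δ ^ N₂ ≤ δ ^ 1 := pow_le_pow_of_le_one hδ.le e1.le hN₂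
        _ = δ := pow_one δ
    have hδN0 : 0 < δ ^ N₂ := by positivity
    set μ := min (c / 2) c₀ with hμ
    have h1 : μ * δ ^ N₂ ≤ σ * (u m - g' - f₀) := by
      refine le_trans ?_ hmain
      exact mul_le_mul (min_le_left _ _) (hδN.trans hge) hδN0.le (by positivity)
    have h2 : μ * δ ^ N₂ ≤ σ * (f m - f₀) :=
      (mul_le_mul_of_nonneg_right (min_le_right _ _) hδN0.le).trans hf'
    have h3 : |deriv shellCutoff (y m / δ) * (y' / δ) * (g m - G m)| ≤ δ * D * δ ^ N₂ := by
      have a1 := hB' (y m / δ)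
      have a2 : |y'| ≤ C₁ * (2 * δ) ^ (N₁ + N₂ + 2) := (hflat m hmU hmp (by linarith)).trans
        (mul_le_mul_of_nonneg_left (pow_le_pow_left₀ (abs_nonneg _) hmy _) hC₁)
      have a3 : |g m - G m| ≤ (C₃ + B) * δ⁻¹ ^ N₁ := by
        have b1 := hg m hmU hmp
        have b2 := hGb m hmp
        have b3 : C₃ ≤ C₃ * δ⁻¹ ^ N₁ := le_mul_of_one_le_right hC₃ hT1
        have b4 := abs_sub (g m) (G m)
        linarith
      rw [abs_mul, abs_mul, abs_div, abs_of_pos hδ]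
      have a4 : (2 * δ) ^ (N₁ + N₂ + 2) = 2 ^ (N₁ + N₂ + 2) * (δ ^ N₁ * δ ^ N₂ * δ ^ 2) := by
        rw [mul_pow, pow_add δ, pow_add δ]
      calc |deriv shellCutoff (y m / δ)| * (|y'| / δ) * |g m - G m|
          ≤ B' * (C₁ * (2 * δ) ^ (N₁ + N₂ + 2) / δ) * ((C₃ + B) * δ⁻¹ ^ N₁) := by gcongr
        _ = δ * (B' * (C₁ * 2 ^ (N₁ + N₂ + 2)) * (C₃ + B)) * δ ^ N₂ := by
            rw [a4, inv_pow]
            field_simp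
        _ ≤ δ * D * δ ^ N₂ := by
            gcongr
            rw [hD]
            linarith
    have h4 : |σ * (deriv shellCutoff (y m / δ) * (y' / δ) * (g m - G m))| < μ * δ ^ N₂ := by
      rw [abs_mul, hσ1, one_mul]
      exact h3.trans_lt (mul_lt_mul_of_pos_right e5 hδN0)
    have h5 := (abs_lt.1 h4).2
    have h6 := mul_le_mul_of_nonneg_left h1 hχ0
    have h7 := mul_le_mul_of_nonneg_left h2 (show 0 ≤ 1 - χ by linarith)
    linarith

end Transition

/-! ### The complement of the collar -/

section GlobalConstruction

variable {M : Type*} [TopologicalSpace M] [ChartedSpace Plane M] [IsManifold 𝓘(ℝ, Plane) ω M]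
variable {L : ℕ} {γ : Fin L → Plane → Cotangent M} {R : Fin L → ℝ}
  {Ψ : Fin L → Plane × Plane → Cotangent M} {p u : Cotangent M → ℝ} {f₀ : ℝ} {c s₀ : Fin L → ℝ}
  {U : Fin L → Set (Cotangent M)} {y g : Fin L → Cotangent M → ℝ}

theorem mem_collar_iff
    (h : ∀ j, IsCollarChart p u (R j) (Ψ j) (γ j) f₀ (c j) (s₀ j) (U j) (y j) (g j))
    {δ : ℝ} (hδ : ∀ j, δ < s₀ j) {m : Cotangent M} :
    m ∈ collar p R Ψ δ ↔ p m = 0 ∧ ∃ j, m ∈ U j ∧ |y j m| < δ := by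
  constructor
  · rintro ⟨hm, j, x, ξ, hξ, hξ0, rfl⟩
    obtain ⟨h1, h2⟩ := (h j).mem x ξ hξ (hξ0.trans (hδ j)) hm
    exact ⟨hm, j, h1, by rwa [h2]⟩
  · rintro ⟨hm, j, hj, hy⟩
    obtain ⟨x, ξ, hξ, rfl, hyξ⟩ := (h j).exists_rep m hj hm
    exact ⟨hm, j, x, ξ, hξ, by rwa [← hyξ], rfl⟩

/-- The path of the chart runs to the face y = σδ with σy ≥ δ throughout. It avoids its own collar
for that reason, and the collars of the other tori by disjointness. -/
theorem mem_omegaPart_of_chart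
    (h : ∀ j, IsCollarChart p u (R j) (Ψ j) (γ j) f₀ (c j) (s₀ j) (U j) (y j) (g j))
    (hU : ∀ i j, i ≠ j → Disjoint (U i) (U j)) {δ : ℝ} (hδ0 : 0 < δ) (hδ : ∀ j, δ < s₀ j)
    {σ : ℝ} (hσ : σ = 1 ∨ σ = -1) {j : Fin L} {m : Cotangent M} (hmU : m ∈ U j) (hm : p m = 0)
    (hmy : δ ≤ σ * y j m) : m ∈ omegaPart p R Ψ σ δ := by
  obtain ⟨Z, hZ, hmZ, hZU, m', hm'Z, hm'y⟩ := (h j).connected m hmU hm δ σ hδ0 hσ hmy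
  have hσ1 : |σ| = 1 := by rcases hσ with rfl | rfl <;> norm_num
  have hZsub : Z ⊆ {m | p m = 0} \ collar p R Ψ δ := by
    intro z hz
    obtain ⟨h1, h2, h3⟩ := hZU z hz
    refine ⟨h2, fun hcol => ?_⟩
    obtain ⟨-, i, hi, hyi⟩ := (mem_collar_iff h hδ).1 hcol
    by_cases hij : i = j
    · subst hij
      have h4 := le_abs_self (σ * y i z)
      rw [abs_mul, hσ1, one_mul] at h4
      linarith
    · exact Set.disjoint_left.1 (hU i j hij) hi h1
  obtain ⟨h1, h2, -⟩ := hZU m' hm'Z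
  obtain ⟨x, ξ, hξ, rfl, hyξ⟩ := (h j).exists_rep m' h1 h2
  exact ⟨j, x, ξ, hξ, by rw [← hyξ, hm'y], hZsub hm'Z,
    hZ.subset_connectedComponentIn hm'Z hZsub hmZ⟩

/-- By boundary bumping the component of the point touches the closure of the collar, necessarily at
some |y| = δ, that is, on a face. Connectedness of the energy surface enters here. -/
theorem mem_omegaPart_or [T2Space M]
    (h : ∀ j, IsCollarChart p u (R j) (Ψ j) (γ j) f₀ (c j) (s₀ j) (U j) (y j) (g j))
    (hX : IsCompact {m | p m = 0}) (hconn : IsPreconnected {m | p m = 0})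
    (hL : Nonempty (Fin L)) {δ : ℝ} (hδ0 : 0 < δ) (hδ : ∀ j, δ < s₀ j) {m : Cotangent M}
    (hm : m ∈ {m | p m = 0} \ collar p R Ψ δ) :
    m ∈ omegaPart p R Ψ 1 δ ∨ m ∈ omegaPart p R Ψ (-1) δ := by
  have hcol : collar p R Ψ δ = {m | p m = 0} ∩ ⋃ j, (U j ∩ y j ⁻¹' Set.Ioo (-δ) δ) := by
    ext z
    rw [mem_collar_iff h hδ]
    simp only [Set.mem_inter_iff, Set.mem_iUnion, Set.mem_ofPred_eq, Set.mem_preimage, Set.mem_Ioo,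
      abs_lt]
  have hopen : IsOpen (⋃ j, (U j ∩ y j ⁻¹' Set.Ioo (-δ) δ)) := isOpen_iUnion fun j =>
    (h j).smooth_y.continuousOn.isOpen_inter_preimage (h j).isOpen isOpen_Ioo
  have hcpt : IsCompact ({m | p m = 0} \ collar p R Ψ δ) := by
    rw [hcol, Set.sdiff_self_inter]
    exact hX.diff hopen
  obtain ⟨j₀⟩ := hL
  have hne : ({m | p m = 0} ∩ collar p R Ψ δ).Nonempty := by
    obtain ⟨h1, h2, h3⟩ := (h j₀).torus_mem 0
    exact ⟨_, h2, (mem_collar_iff h hδ).2 ⟨h2, j₀, h1, by rwa [h3, abs_zero]⟩⟩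
  obtain ⟨z, hz, hzcl⟩ := exists_mem_component_closure hconn hcpt hne hm
  have hzX := connectedComponentIn_subset _ _ hz
  have hclosed : IsClosed (⋃ j, {m | m ∈ U j ∧ p m = 0 ∧ |y j m| ≤ δ}) :=
    isClosed_iUnion_of_finite fun j => ((h j).isCompact δ (hδ j)).isClosed
  have hzb := closure_minimal (s := collar p R Ψ δ) (fun w hw => by
    obtain ⟨h1, j, h2, h3⟩ := (mem_collar_iff h hδ).1 hw
    exact Set.mem_iUnion.2 ⟨j, h2, h1, h3.le⟩) hclosed hzcl
  obtain ⟨j, hzU, hz0, hzy⟩ := Set.mem_iUnion.1 hzb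
  have hyδ : |y j z| = δ := by
    refine le_antisymm hzy (not_lt.1 fun hlt => hzX.2 ((mem_collar_iff h hδ).2 ⟨hz0, j, hzU, hlt⟩))
  obtain ⟨x, ξ, hξ, rfl, hyξ⟩ := (h j).exists_rep z hzU hz0
  have hcomp : m ∈ connectedComponentIn ({m | p m = 0} \ collar p R Ψ δ) (Ψ j (x, ξ)) := by
    rw [← connectedComponentIn_eq hz]
    exact mem_connectedComponentIn hm
  rcases eq_or_eq_neg_of_abs_eq hyδ with h1 | h1
  · exact Or.inl ⟨j, x, ξ, hξ, by rw [← hyξ, h1, one_mul], hzX, hcomp⟩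
  · exact Or.inr ⟨j, x, ξ, hξ, by rw [← hyξ, h1]; ring, hzX, hcomp⟩

end GlobalConstruction

/-! ### The real weight on the energy surface -/

section GlobalWeightFunction

variable {M : Type*} [TopologicalSpace M] [ChartedSpace Plane M] [IsManifold 𝓘(ℝ, Plane) ω M]
variable {L : ℕ} {γ : Fin L → Plane → Cotangent M} {R : Fin L → ℝ}
  {Ψ : Fin L → Plane × Plane → Cotangent M} {p u : Cotangent M → ℝ} {f₀ : ℝ} {c s₀ : Fin L → ℝ}
  {U : Fin L → Set (Cotangent M)} {y g : Fin L → Cotangent M → ℝ}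

/-- Gluing a flow average primitive with the local solutions near the tori. -/
theorem exists_glued_weight [T2Space M] [SecondCountableTopology M]
    (h : ∀ j, IsCollarChart p u (R j) (Ψ j) (γ j) f₀ (c j) (s₀ j) (U j) (y j) (g j))
    (hU : ∀ i j, i ≠ j → Disjoint (U i) (U j)) {δ : ℝ} (hδ0 : 0 < δ) (hδ : ∀ j, 2 * δ < s₀ j)
    {G : Cotangent M → ℝ} (hG : ContMDiff phaseModel 𝓘(ℝ, ℝ) ∞ G) :
    ∃ G₀ : Cotangent M → ℝ, ContMDiff phaseModel 𝓘(ℝ, ℝ) ∞ G₀ ∧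
      (∃ O : Fin L → Set (Cotangent M), ∀ j, IsOpen (O j) ∧ O j ⊆ U j ∧ (∀ x, γ j x ∈ O j) ∧
        ∀ m ∈ O j, G₀ m = g j m) ∧
      (∀ j, ∀ m ∈ U j, p m = 0 → |y j m| ≤ 2 * δ →
        G₀ =ᶠ[𝓝 m] fun m => G m + shellCutoff (y j m / δ) * (g j m - G m)) ∧
      ∀ m, p m = 0 → (∀ j, m ∈ U j → 2 * δ < |y j m|) → G₀ =ᶠ[𝓝 m] G := by
  have hb : ∀ j, ∃ b : Cotangent M → ℝ, ContMDiff phaseModel 𝓘(ℝ, ℝ) ∞ b ∧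
      (∀ᶠ m in 𝓝ˢ {m | m ∈ U j ∧ p m = 0 ∧ |y j m| ≤ 2 * δ}, b m = 1) ∧
      tsupport b ⊆ U j ∧ HasCompactSupport b := fun j =>
    exists_cutoff ((h j).isCompact _ (hδ j)) (h j).isOpen fun m hm => hm.1
  choose b hbs hb1 hbU _ using hb
  -- The correction is defined only in `U j`, and the shell cutoff localizes it only on p = 0. The
  -- factor `b j`, equal to 1 near the compact shell |y| ≤ 2δ, extends it by zero to T^*M.
  let t : Fin L → Cotangent M → ℝ := fun j m =>
    b j m • (shellCutoff (y j m / δ) * (g j m - G m))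
  let G₀ : Cotangent M → ℝ := fun m => G m + ∑ j, t j m
  have ht : ∀ j, ContMDiff phaseModel 𝓘(ℝ, ℝ) ∞ (t j) := by
    intro j
    refine contMDiff_cutoff_smul (hbs j) (h j).isOpen (hbU j) ?_
    have a3 : ContDiff ℝ ∞ fun t : ℝ => shellCutoff (t / δ) :=
      shellCutoff.contDiff.comp (contDiff_id.div_const δ)
    exact (a3.contMDiff.comp_contMDiffOn (h j).smooth_y).mul ((h j).smooth_g.sub hG.contMDiffOn)
  have hoff : ∀ j, ∀ m, m ∉ tsupport (b j) → ∀ᶠ z in 𝓝 m, t j z = 0 := by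
    intro j m hm
    filter_upwards [(isClosed_tsupport (b j)).isOpen_compl.mem_nhds hm] with z hz
    simp only [t, image_eq_zero_of_notMem_tsupport hz, zero_smul]
  have hother : ∀ j, ∀ m ∈ U j, ∀ᶠ z in 𝓝 m, G₀ z = G z + t j z := by
    intro j m hm
    have h1 : ∀ᶠ z in 𝓝 m, ∀ i, i ≠ j → t i z = 0 := by
      rw [Filter.eventually_all]
      intro i
      by_cases hij : i = j
      · exact Filter.Eventually.of_forall fun z hz => absurd hij hz
      · filter_upwards [hoff i m fun hm' => Set.disjoint_left.1 (hU i j hij) (hbU i hm') hm]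
          with z hz _ using hz
    filter_upwards [h1] with z hz
    simp only [G₀]
    rw [Finset.sum_eq_single j (fun i _ hi => hz i hi) (by simp)]
  refine ⟨G₀, ?_, ⟨fun j => (U j ∩ y j ⁻¹' Set.Ioo (-δ) δ) ∩ interior {m | b j m = 1},
    fun j => ⟨?_, ?_, ?_, ?_⟩⟩, ?_, ?_⟩
  · have : G₀ = fun m => G m + ∑ j, t j m := rfl
    rw [this]
    exact hG.add (contMDiff_finsetSum fun j _ => ht j)
  · exact ((h j).smooth_y.continuousOn.isOpen_inter_preimage (h j).isOpen isOpen_Ioo).inter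
      isOpen_interior
  · exact fun m hm => hm.1.1
  · intro x
    obtain ⟨h1, h2, h3⟩ := (h j).torus_mem x
    refine ⟨⟨h1, ?_⟩, ?_⟩
    · rw [Set.mem_preimage, h3]
      exact ⟨by linarith, hδ0⟩
    · rw [mem_interior_iff_mem_nhds]
      refine Filter.eventually_of_mem (Filter.Eventually.filter_mono (nhds_le_nhdsSet ?_) (hb1 j))
        fun z hz => hz
      exact ⟨h1, h2, by rw [h3, abs_zero]; linarith⟩
  · intro m hm
    have h1 := (hother j m hm.1.1).self_of_nhds
    have h2' : m ∈ {m | b j m = 1} := interior_subset hm.2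
    have h2 : b j m = 1 := h2'
    have h3 : shellCutoff (y j m / δ) = 1 := shellCutoff_eq_one (by
      rw [abs_div, abs_of_pos hδ0, div_le_one hδ0]
      exact (abs_lt.2 hm.1.2).le)
    rw [h1]
    simp only [t, h2, h3]
    simp
  · intro j m hmU hm hmy
    have hmem : m ∈ {m | m ∈ U j ∧ p m = 0 ∧ |y j m| ≤ 2 * δ} := ⟨hmU, hm, hmy⟩
    have h1 : ∀ᶠ z in 𝓝 m, b j z = 1 := (hb1 j).filter_mono (nhds_le_nhdsSet hmem)
    filter_upwards [h1, hother j m hmU] with z hz1 hz2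
    rw [hz2]
    simp only [t, hz1, one_smul]
  · intro m hm hmy
    have h1 : ∀ᶠ z in 𝓝 m, ∀ j, t j z = 0 := by
      rw [Filter.eventually_all]
      intro j
      by_cases hmU : m ∈ U j
      · have h2 : ContinuousAt (fun z => |y j z|) m :=
          ((h j).smooth_y.continuousOn.continuousAt ((h j).isOpen.mem_nhds hmU)).abs
        filter_upwards [continuousAt_const.eventually_lt h2 (hmy j hmU)] with z hz
        have h3 : shellCutoff (y j z / δ) = 0 := shellCutoff_eq_zero (by
          rw [abs_div, abs_of_pos hδ0, le_div_iff₀ hδ0]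
          exact hz.le)
        simp only [t, h3, zero_mul, smul_zero]
      · exact hoff j m fun hm' => hmU (hbU j hm')
    filter_upwards [h1] with z hz
    simp only [G₀, hz, Finset.sum_const_zero, add_zero]

/-- The global weight on the energy surface: `u - f₀ - H_p G₀` vanishes only on the tori, has the
sign of the coordinate `y` near each torus, and `G₀` is the given local solution there. -/
theorem exists_global_weight [T2Space M] [SecondCountableTopology M] {q : Cotangent M → ℂ} {F : ℂ}
    (h : ∀ j, IsCollarChart p (fun m => (q m).re) (R j) (Ψ j) (γ j) F.re (c j) (s₀ j) (U j) (y j)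
      (g j))
    (hU : ∀ i j, i ≠ j → Disjoint (U i) (U j)) (hc0 : ∀ j, c j ≠ 0) (hL : Nonempty (Fin L))
    (hp : ContMDiff phaseModel 𝓘(ℝ, ℝ) ∞ p) (hq : ContMDiff phaseModel 𝓘(ℝ, ℂ) ∞ q)
    (hc : ∃ c : ℝ, 0 < c ∧ IsCompact {m | |p m| ≤ c}) (hconn : IsPreconnected {m | p m = 0})
    {K : ℝ → ℝ} (hK : Continuous K) (hK_supp : HasCompactSupport K) (hK0 : ∀ t, 0 ≤ K t)
    (hK1 : ∫ t, K t = 1) (hglobal : GlobalAssumption p q F K R Ψ) :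
    ∃ G₀ : Cotangent M → ℝ, ContMDiff phaseModel 𝓘(ℝ, ℝ) ∞ G₀ ∧
      (∃ O : Fin L → Set (Cotangent M), ∀ j, IsOpen (O j) ∧ O j ⊆ U j ∧ (∀ x, γ j x ∈ O j) ∧
        ∀ m ∈ O j, G₀ m = g j m) ∧
      (∀ m, p m = 0 → (∀ j x, γ j x ≠ m) →
        (q m).re - F.re - modelDeriv G₀ m (hamiltonVec p m) ≠ 0) ∧
      ∃ ε : ℝ, 0 < ε ∧ (∀ j, ε < s₀ j) ∧ ∀ j, ∀ m ∈ U j, p m = 0 → |y j m| ≤ ε → y j m ≠ 0 →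
        0 < y j m * ((q m).re - F.re - modelDeriv G₀ m (hamiltonVec p m)) := by
  obtain ⟨N₁, N₂, hN₁, hN₂, c₀, hc₀, -, δ, hδ0, hδlim, hδ⟩ := hglobal
  have hu : ContMDiff phaseModel 𝓘(ℝ, ℝ) ∞ (fun m => (q m).re) :=
    (Complex.reCLM.contDiff.contMDiff (n := ∞)).comp hq
  have hX : IsCompact {m | p m = 0} := by
    obtain ⟨c', hc', hcpt⟩ := hc
    refine hcpt.of_isClosed_subset (isClosed_eq hp.continuous continuous_const) fun m hm => ?_
    have hm' : p m = 0 := hm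
    show |p m| ≤ c'
    rw [hm', abs_zero]
    exact hc'.le
  obtain ⟨A, hA⟩ := hX.exists_bound_of_continuousOn (f := fun m => (q m).re)
    hu.continuous.continuousOn
  obtain ⟨S, hS0, hS⟩ : ∃ S : ℝ, 0 < S ∧ ∀ t, S ≤ |t| → K t = 0 := by
    obtain ⟨r, hr⟩ := hK_supp.isCompact.isBounded.subset_ball 0
    refine ⟨max r 1, by positivity, fun t ht => image_eq_zero_of_notMem_tsupport fun ht' => ?_⟩
    have := hr ht'
    rw [mem_ball_zero_iff, Real.norm_eq_abs] at this
    linarith [le_max_left r 1]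
  set B := max A 0 * (2 * S) with hB
  have hB0 : 0 ≤ B := by positivity
  let f : ℕ → Cotangent M → ℝ := fun n =>
    flowAverage p K ((δ n)⁻¹ ^ N₁) (fun m => (q m).re)
  have hprim : ∀ n, ∃ G : Cotangent M → ℝ, ContMDiff phaseModel 𝓘(ℝ, ℝ) ∞ G ∧
      (∀ m, p m = 0 → modelDeriv G m (hamiltonVec p m) = (q m).re - f n m) ∧
      ∀ m, p m = 0 → |G m| ≤ B * (δ n)⁻¹ ^ N₁ := by
    intro n
    have hT : 0 < (δ n)⁻¹ ^ N₁ := pow_pos (inv_pos.2 (hδ0 n)) _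
    obtain ⟨G, h1, h2, h3⟩ := exists_average_primitive hp hc hu (A := max A 0)
      (fun m hm => (hA m hm).trans (le_max_left _ _)) hK hK0 hK1 hS0 hS hT
    refine ⟨G, h1, h2, fun m hm => (h3 m hm).trans (le_of_eq ?_)⟩
    rw [hB]
    ring
  choose G hGs hGf hGb using hprim
  have hsmall : ∀ ε : ℝ, 0 < ε → ∀ᶠ n in Filter.atTop, δ n < ε := fun ε hε =>
    hδlim.eventually_lt_const hε
  have hsmall_s : ∀ᶠ n in Filter.atTop, ∀ j, δ n < s₀ j :=
    Filter.eventually_all.2 fun j => hsmall _ (h j).pos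
  have hfσ : ∀ n, (∀ j, δ n < s₀ j) → ∀ σ : ℝ, (σ = 1 ∨ σ = -1) → ∀ m ∈ omegaPart p R Ψ σ (δ n),
      c₀ * δ n ^ N₂ ≤ σ * (f n m - F.re) := by
    rintro n - σ (rfl | rfl) m hm
    · rw [one_mul]; exact (hδ n).1 m hm
    · have := (hδ n).2 m hm
      show _ ≤ -1 * (flowAverage _ _ _ _ _ - F.re)
      linarith
  have hfU : ∀ n, (∀ j, δ n < s₀ j) → ∀ j, ∀ σ : ℝ, (σ = 1 ∨ σ = -1) → ∀ m ∈ U j, p m = 0 →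
      δ n ≤ σ * y j m → c₀ * δ n ^ N₂ ≤ σ * (f n m - F.re) := fun n hn j σ hσ m hm hmp hmy =>
    hfσ n hn σ hσ m (mem_omegaPart_of_chart h hU (hδ0 n) hn hσ hm hmp hmy)
  -- (H0) on the side y ≥ δ for one sufficiently small δ of the sequence excludes c < 0.
  have hcpos : ∀ j, 0 < c j := by
    intro j
    obtain ⟨ε, hε, hslope⟩ := (h j).exists_slope_nonneg hp hc hB0 N₁
    obtain ⟨n, hn1, hn2⟩ := (hsmall_s.and (hsmall ε hε)).exists
    refine lt_of_le_of_ne (hslope (δ n) (hδ0 n) hn2 (G n) (f n) (hGs n) (hGf n) (hGb n)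
      fun m hm hmp hmy => ?_) (hc0 j).symm
    have h1 := hfU n hn1 j 1 (Or.inl rfl) m hm hmp (by rwa [one_mul])
    have h2 : 0 < c₀ * δ n ^ N₂ := mul_pos hc₀ (pow_pos (hδ0 n) _)
    linarith
  have htr := fun j => (h j).exists_transition hp hc (hcpos j) hB0 hc₀ N₁ hN₂
  choose ε hε htr using htr
  -- From here on a single δ of the sequence is used. For |y| ≤ 2δ the interpolation gives the sign
  -- of y; elsewhere G₀ is the average primitive and (H0) applies.
  obtain ⟨n, hn1, hn2⟩ := (hsmall_s.and (Filter.eventually_all.2 fun j =>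
    hsmall (ε j) (hε j))).exists
  obtain ⟨G₀, hG₀, hO, hnear, hfar⟩ := exists_glued_weight h hU (hδ0 n)
    (fun j => (htr j (δ n) (hδ0 n) (hn2 j)).1) (hGs n)
  have hsign : ∀ j, ∀ m ∈ U j, p m = 0 → |y j m| ≤ 2 * δ n → y j m ≠ 0 →
      0 < y j m * ((q m).re - F.re - modelDeriv G₀ m (hamiltonVec p m)) := by
    intro j m hm hmp hmy hm0
    rw [modelDeriv_congr (hnear j m hm hmp hmy)]
    exact (htr j (δ n) (hδ0 n) (hn2 j)).2 (G n) (f n) (hGs n) (hGf n) (hGb n) (hfU n hn1 j)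
      m hm hmp hmy hm0
  refine ⟨G₀, hG₀, hO, fun m hmp hmγ => ?_, δ n, hδ0 n, hn1, fun j m hm hmp hmy hm0 =>
    hsign j m hm hmp (by linarith [hδ0 n]) hm0⟩
  by_cases hcase : ∀ j, m ∈ U j → 2 * δ n < |y j m|
  · rw [modelDeriv_congr (hfar m hmp hcase), hGf n m hmp]
    have hncol : m ∈ {m | p m = 0} \ collar p R Ψ (δ n) := by
      refine ⟨hmp, fun hcol => ?_⟩
      obtain ⟨-, j, hj, hyj⟩ := (mem_collar_iff h hn1).1 hcol
      linarith [hcase j hj, hδ0 n]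
    have hpos : 0 < c₀ * δ n ^ N₂ := mul_pos hc₀ (pow_pos (hδ0 n) _)
    rcases mem_omegaPart_or h hX hconn hL (hδ0 n) hn1 hncol with h1 | h1
    · have := hfσ n hn1 1 (Or.inl rfl) m h1
      intro h0
      linarith
    · have := hfσ n hn1 (-1) (Or.inr rfl) m h1
      intro h0
      linarith
  · push Not at hcase
    obtain ⟨j, hj, hyj⟩ := hcase
    have hm0 : y j m ≠ 0 := fun h0 => by
      obtain ⟨x, hx⟩ := (h j).torus_of_zero m hj hmp h0
      exact hmγ j x hx
    exact right_ne_zero_of_mul (hsign j m hj hmp hyj hm0).ne'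

end GlobalWeightFunction

/-! ### Elementary topology -/

section Auxiliary

theorem exists_pos_forall_le {ι : Type*} [Finite ι] [Nonempty ι] {f : ι → ℝ} (hf : ∀ j, 0 < f j) :
    ∃ r, 0 < r ∧ ∀ j, r ≤ f j := by
  obtain ⟨j₀, hj₀⟩ := Finite.exists_min f
  exact ⟨f j₀, hf j₀, hj₀⟩

theorem exists_disjoint_open_nhds {ι X : Type*} [Finite ι] [TopologicalSpace X] [T2Space X]
    {A : ι → Set X} (hA : ∀ i, IsCompact (A i)) (hd : ∀ i j, i ≠ j → Disjoint (A i) (A j)) :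
    ∃ O : ι → Set X, (∀ i, IsOpen (O i)) ∧ (∀ i, A i ⊆ O i) ∧
      ∀ i j, i ≠ j → Disjoint (O i) (O j) := by
  have hsep : ∀ i j, ∃ u v : Set X, IsOpen u ∧ IsOpen v ∧ (i ≠ j → A i ⊆ u ∧ A j ⊆ v ∧
      Disjoint u v) := by
    intro i j
    by_cases hij : i = j
    · exact ⟨∅, ∅, isOpen_empty, isOpen_empty, fun h => absurd hij h⟩
    · obtain ⟨u, v, hu, hv, h1, h2, h3⟩ :=
        SeparatedNhds.of_isCompact_isCompact (hA i) (hA j) (hd i j hij)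
      exact ⟨u, v, hu, hv, fun _ => ⟨h1, h2, h3⟩⟩
  choose u v hu hv huv using hsep
  refine ⟨fun i => ⋂ j, {x | i ≠ j → x ∈ u i j ∩ v j i}, fun i => isOpen_iInter_of_finite fun j => ?_,
    fun i x hx => Set.mem_iInter.2 fun j hij => ⟨(huv i j hij).1 hx, (huv j i hij.symm).2.1 hx⟩,
    fun i j hij => Set.disjoint_left.2 fun x hxi hxj => ?_⟩
  · by_cases hij : i = j
    · have : {x : X | i ≠ j → x ∈ u i j ∩ v j i} = Set.univ :=
        Set.eq_univ_of_forall fun x h => absurd hij h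
      rw [this]
      exact isOpen_univ
    · have : {x : X | i ≠ j → x ∈ u i j ∩ v j i} = u i j ∩ v j i :=
        Set.ext fun x => ⟨fun h => h hij, fun h _ => h⟩
      rw [this]
      exact (hu i j).inter (hv j i)
  · exact Set.disjoint_left.1 (huv i j hij).2.2 (Set.mem_iInter.1 hxi j hij).1
      (Set.mem_iInter.1 hxj i hij.symm).2

theorem pos_of_isPreconnected {X : Type*} [TopologicalSpace X] {S : Set X} (hS : IsPreconnected S)
    {f : X → ℝ} (hf : ContinuousOn f S) (h0 : ∀ x ∈ S, f x ≠ 0) {x y : X} (hx : x ∈ S) (hy : y ∈ S)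
    (hfx : 0 < f x) : 0 < f y := by
  by_contra! hfy
  obtain ⟨z, hz, hz0⟩ := hS.intermediate_value hy hx hf ⟨hfy, hfx.le⟩
  exact h0 z hz hz0

end Auxiliary

/-! ### Shells in the analytic tubes and the compactly supported complex weight -/

section Final

variable {M : Type*} [TopologicalSpace M] [ChartedSpace Plane M] [IsManifold 𝓘(ℝ, Plane) ω M]

theorem continuous_modelDeriv_hamiltonVec {p f : Cotangent M → ℝ}
    (hp : ContMDiff phaseModel 𝓘(ℝ, ℝ) ∞ p) (hf : ContMDiff phaseModel 𝓘(ℝ, ℝ) ∞ f) :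
    Continuous fun m => modelDeriv f m (hamiltonVec p m) := by
  refine continuous_iff_continuousAt.2 fun a => ?_
  have hev : (fun m => modelDeriv f m (hamiltonVec p m)) =ᶠ[𝓝 a]
      fun m => fderiv ℝ (f ∘ (extChartAt phaseModel a).symm) (extChartAt phaseModel a m)
        (stdGrad (fderiv ℝ (p ∘ (extChartAt phaseModel a).symm) (extChartAt phaseModel a m))) := by
    filter_upwards [extChartAt_source_mem_nhds (I := phaseModel) a] with m hm
    rw [← hamiltonField_chart (hp.mdifferentiable (by simp) m) hm]
    exact modelDeriv_eq_fderiv_chart (hf.mdifferentiable (by simp) m) hm _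
  refine ContinuousAt.congr ?_ hev.symm
  have hs : ∀ {g : Cotangent M → ℝ}, ContMDiff phaseModel 𝓘(ℝ, ℝ) ∞ g →
      ContinuousAt (fun m => fderiv ℝ (g ∘ (extChartAt phaseModel a).symm)
        (extChartAt phaseModel a m)) a := by
    intro g hg
    have h3 := contMDiffWithinAt_extChartAt_symm_range (I := phaseModel) (n := ∞) a
      (mem_extChartAt_target a)
    rw [ModelWithCorners.range_eq_univ, contMDiffWithinAt_univ] at h3
    have h1 : ContDiffAt ℝ ∞ (g ∘ (extChartAt phaseModel a).symm) (extChartAt phaseModel a a) :=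
      (hg.contMDiffAt.comp _ h3).contDiffAt
    exact ContinuousAt.comp (g := fderiv ℝ (g ∘ (extChartAt phaseModel a).symm))
      (h1.fderiv_right (m := 0) (by simp)).continuousAt (continuousAt_extChartAt (I := phaseModel) a)
  exact (hs hf).clm_apply (stdGrad.continuous.continuousAt.comp (hs hp))

variable {γ : Plane → Cotangent M} {R : ℝ} {Ψ : Plane × Plane → Cotangent M} {p : Cotangent M → ℝ}
  {a : Plane} {pN : Plane → ℝ}

/-- In a small tube, the energy surface meets the slice `ξ₁ = 0` only in the torus. -/
theorem IsNormalForm.exists_radius {n : WithTop ℕ∞} {N : ℕ} (hN : IsNormalForm n p a R Ψ pN N)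
    (hN1 : 1 ≤ N) (ha : a 1 ≠ 0) :
    ∃ r : ℝ, 0 < r ∧ ∀ x ξ : Plane, ‖ξ‖ ≤ r → ξ 0 = 0 → p (Ψ (x, ξ)) = 0 → ξ = 0 := by
  obtain ⟨C₁, r₁, hr₁, h₁⟩ := hN.linear_part
  obtain ⟨C₂, r₂, hr₂, h₂⟩ := hN.remainder
  have hα : 0 < |a 1| := abs_pos.2 ha
  set D := max C₁ 0 + max C₂ 0 + 1 with hD
  have hD0 : 0 < D := by positivity
  refine ⟨min (min (r₁ / 2) (r₂ / 2)) (min 1 (|a 1| / (2 * D))), by positivity,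
    fun x ξ hξ hξ0 hpξ => ?_⟩
  have e₁ : ‖ξ‖ < r₁ :=
    (hξ.trans ((min_le_left _ _).trans (min_le_left _ _))).trans_lt (by linarith)
  have e₂ : ‖ξ‖ < r₂ :=
    (hξ.trans ((min_le_left _ _).trans (min_le_right _ _))).trans_lt (by linarith)
  have e₃ : ‖ξ‖ ≤ 1 := hξ.trans ((min_le_right _ _).trans (min_le_left _ _))
  have e₄ : ‖ξ‖ * (2 * D) ≤ |a 1| := (le_div_iff₀ (by positivity)).1
    (hξ.trans ((min_le_right _ _).trans (min_le_right _ _)))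
  have a₁ := h₁ ξ e₁
  have a₂ := h₂ x ξ e₂
  rw [hpξ, zero_sub, abs_neg] at a₂
  have b₁ : C₁ * ‖ξ‖ ^ 2 ≤ max C₁ 0 * ‖ξ‖ ^ 2 :=
    mul_le_mul_of_nonneg_right (le_max_left _ _) (by positivity)
  have b₂ : C₂ * ‖ξ‖ ^ (N + 1) ≤ max C₂ 0 * ‖ξ‖ ^ 2 :=
    mul_le_mul (le_max_left _ _) (pow_le_pow_of_le_one (norm_nonneg _) e₃ (by omega))
      (by positivity) (le_max_right _ _)
  rw [plane_inner, hξ0, mul_zero, zero_add] at a₁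
  have hnorm : ‖ξ‖ ≤ |ξ 1| := by
    have := norm_plane_le_add ξ
    rwa [hξ0, abs_zero, zero_add] at this
  -- With ξ₁ = 0 the linear part of p is a₂ξ₂ and |ξ| = |ξ₂|, so p = 0 forces |a₂||ξ| = O(|ξ|²),
  -- impossible for small ξ ≠ 0.
  have b₃ : |a 1| * ‖ξ‖ ≤ (D - 1) * ‖ξ‖ ^ 2 := by
    have h3 : |a 1 * ξ 1| ≤ (D - 1) * ‖ξ‖ ^ 2 := by
      rw [hD]
      rw [abs_le] at a₁ a₂ ⊢
      constructor <;> linarith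
    rw [abs_mul] at h3
    exact (mul_le_mul_of_nonneg_left hnorm hα.le).trans h3
  have h4 : ‖ξ‖ ≤ 0 := by
    by_contra! hpos
    have h5 : |a 1| * ‖ξ‖ ≤ |a 1| / 2 * ‖ξ‖ := by nlinarith
    nlinarith
  exact norm_le_zero_iff.1 h4

/-- The closed shell `|ξ| ≤ r`, `|ξ₁| ≤ δ` of a tube. -/
def closedShell (Ψ : Plane × Plane → Cotangent M) (r δ : ℝ) : Set (Cotangent M) :=
  Ψ '' {z | ‖z.2‖ ≤ r ∧ |z.2 0| ≤ δ}

theorem IsCanonicalTube.isCompact_closedShell (hT : IsCanonicalTube ∞ γ R Ψ) {r : ℝ} (hr : r < R)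
    (δ : ℝ) : IsCompact (closedShell Ψ r δ) :=
  hT.isCompact_image ((isClosed_le continuous_snd.norm continuous_const).inter
    (isClosed_le continuous_abs_coord continuous_const)) hr (fun _ hz => hz.1) fun _ _ _ _ h => h

theorem IsCanonicalTube.isOpen_torusNhd (hT : IsCanonicalTube ∞ γ R Ψ) {r : ℝ} (hr : r ≤ R)
    (δ : ℝ) : IsOpen (torusNhd Ψ r δ) := by
  have h : torusNhd Ψ r δ = Ψ '' {z | ‖z.2‖ < r ∧ |z.2 0| < δ} := by
    ext m
    constructor
    · rintro ⟨x, ξ, h1, h2, h3⟩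
      exact ⟨(x, ξ), ⟨h1, h2⟩, h3⟩
    · rintro ⟨z, ⟨h1, h2⟩, h3⟩
      exact ⟨z.1, z.2, h1, h2, h3⟩
  rw [h]
  exact hT.isOpen_image ((isOpen_strip r).inter (isOpen_lt continuous_abs_coord continuous_const))
    fun z hz => hz.1.trans_le hr

/-- In a thin shell, the energy surface stays in a given neighbourhood of the torus. -/
theorem IsCanonicalTube.exists_shell_subset [T2Space M] (hT : IsCanonicalTube ∞ γ R Ψ)
    (hp : Continuous p) {r : ℝ} (hr : r < R)
    (hslice : ∀ x ξ : Plane, ‖ξ‖ ≤ r → ξ 0 = 0 → p (Ψ (x, ξ)) = 0 → ξ = 0)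
    {O : Set (Cotangent M)} (hO : IsOpen O) (hγ : ∀ x, γ x ∈ O) :
    ∃ δ : ℝ, 0 < δ ∧ ∀ m ∈ closedShell Ψ r δ, p m = 0 → m ∈ O := by
  -- On this compact set ξ₁ has no zeros, because the slice ξ₁ = 0 of the surface is the torus,
  -- contained in O. Half the minimum of |ξ₁| is the required δ.
  let B : Set (Cotangent M) := (Ψ '' {z | ‖z.2‖ ≤ r} ∩ {m | p m = 0}) \ O
  have hB : IsCompact B := ((hT.isCompact_image (isClosed_le continuous_snd.norm continuous_const) hr
    (fun _ hz => hz) fun _ _ _ _ h => h).inter_right (isClosed_eq hp continuous_const)).diff hO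
  have hcont : ContinuousOn (fun m => |fiberCoord R Ψ m 0|) B := by
    rintro _ ⟨⟨⟨z, hz, rfl⟩, -⟩, -⟩
    have h1 := (hT.contMDiffAt_fiberCoord (lt_of_le_of_lt hz hr)).continuousAt
    exact ((EuclideanSpace.proj (0 : Fin 2) : Plane →L[ℝ] ℝ).continuous.continuousAt.comp
      h1).abs.continuousWithinAt
  have hpos : ∀ m ∈ B, 0 < |fiberCoord R Ψ m 0| := by
    rintro _ ⟨⟨⟨z, hz, rfl⟩, hpz⟩, hzO⟩
    rw [hT.fiberCoord_apply (lt_of_le_of_lt hz hr)]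
    refine abs_pos.2 fun h0 => hzO ?_
    have := hslice z.1 z.2 hz h0 hpz
    have h2 : z = (z.1, 0) := by rw [← this]
    rw [h2, hT.zero_section]
    exact hγ _
  have key : ∃ δ : ℝ, 0 < δ ∧ ∀ m ∈ B, δ < |fiberCoord R Ψ m 0| := by
    rcases B.eq_empty_or_nonempty with hBe | hBn
    · exact ⟨1, one_pos, fun m hm => by rw [hBe] at hm; exact absurd hm (Set.notMem_empty m)⟩
    · obtain ⟨m₀, hm₀, hmin⟩ := hB.exists_isMinOn hBn hcont
      have h0 := hpos m₀ hm₀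
      refine ⟨|fiberCoord R Ψ m₀ 0| / 2, by linarith, fun m hm => ?_⟩
      have h1 : |fiberCoord R Ψ m₀ 0| ≤ |fiberCoord R Ψ m 0| := hmin hm
      linarith
  obtain ⟨δ, hδ, hδB⟩ := key
  refine ⟨δ, hδ, ?_⟩
  rintro _ ⟨z, ⟨hz1, hz2⟩, rfl⟩ hpz
  by_contra hzO
  have := hδB (Ψ z) ⟨⟨⟨z, hz1, rfl⟩, hpz⟩, hzO⟩
  rw [hT.fiberCoord_apply (lt_of_le_of_lt hz1 hr)] at this
  linarith

/-- Gluing the complex local solutions into a compactly supported function whose real part is the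
given one near the energy surface. -/
theorem exists_compact_weight [T2Space M] [SecondCountableTopology M] {L : ℕ}
    {Q U O : Fin L → Set (Cotangent M)} {G : Fin L → Cotangent M → ℂ} {G₀ : Cotangent M → ℝ}
    (hp : Continuous p) (hX : IsCompact {m | p m = 0}) (hQ : ∀ j, IsCompact (Q j))
    (hU : ∀ j, IsOpen (U j)) (hUd : ∀ i j, i ≠ j → Disjoint (U i) (U j)) (hQU : ∀ j, Q j ⊆ U j)
    (hO : ∀ j, IsOpen (O j)) (hQO : ∀ j, ∀ m ∈ Q j, p m = 0 → m ∈ O j)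
    (hG : ∀ j, ContMDiffOn phaseModel 𝓘(ℝ, ℂ) ∞ (G j) (U j))
    (hG₀ : ContMDiff phaseModel 𝓘(ℝ, ℝ) ∞ G₀) (hGO : ∀ j, ∀ m ∈ O j, G₀ m = (G j m).re) :
    ∃ Gt : Cotangent M → ℂ, ContMDiff phaseModel 𝓘(ℝ, ℂ) ∞ Gt ∧ HasCompactSupport Gt ∧
      (∀ j, ∀ m ∈ Q j, Gt m = G j m) ∧
      ∀ m, p m = 0 → (fun z => (Gt z).re) =ᶠ[𝓝 m] G₀ := by
  obtain ⟨β, hβ, hβ1, -, hβc⟩ := exists_cutoff hX isOpen_univ (Set.subset_univ _)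
  -- `Q j` also contains points off the energy surface, where G₀ and Re G_j are unrelated.
  -- Supporting the cutoff where either they agree or p ≠ 0 makes the replacement of G₀ by G_j
  -- affect only imaginary parts near p = 0.
  have hV : ∀ j, IsOpen (U j ∩ (O j ∪ {m | p m ≠ 0})) := fun j =>
    (hU j).inter ((hO j).union (isOpen_ne_fun hp continuous_const))
  have hθ := fun j => exists_cutoff (hQ j) (hV j) fun m hm => ⟨hQU j hm, by
    by_cases h : p m = 0
    · exact Or.inl (hQO j m hm h)
    · exact Or.inr h⟩
  choose θ hθ hθ1 hθU hθc using hθ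
  have hGc : ContMDiff phaseModel 𝓘(ℝ, ℂ) ∞ (fun m => β m • (G₀ m : ℂ)) :=
    hβ.smul ((Complex.ofRealCLM.contDiff.contMDiff (n := ∞)).comp hG₀)
  let Gt : Cotangent M → ℂ := fun m => β m • (G₀ m : ℂ) + ∑ j, θ j m • (G j m - β m • (G₀ m : ℂ))
  refine ⟨Gt, ?_, ?_, ?_, ?_⟩
  · have : Gt = fun m => β m • (G₀ m : ℂ) + ∑ j, θ j m • (G j m - β m • (G₀ m : ℂ)) := rfl
    rw [this]
    exact hGc.add (contMDiff_finsetSum fun j _ => contMDiff_cutoff_smul (hθ j) (hV j) (hθU j)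
      (((hG j).mono Set.inter_subset_left).sub hGc.contMDiffOn))
  · refine HasCompactSupport.intro (K := tsupport β ∪ ⋃ j, tsupport (θ j))
      (hβc.isCompact.union (isCompact_iUnion fun j => (hθc j).isCompact)) fun m hm => ?_
    simp only [Set.mem_union, Set.mem_iUnion, not_or, not_exists] at hm
    simp only [Gt, image_eq_zero_of_notMem_tsupport hm.1,
      fun j => image_eq_zero_of_notMem_tsupport (hm.2 j), zero_smul, Finset.sum_const_zero, add_zero]
  · intro j m hm
    have h1 : θ j m = 1 := (hθ1 j).self_of_nhdsSet m hm
    simp only [Gt]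
    rw [Finset.sum_eq_single j (fun i _ hi => ?_) (by simp), h1, one_smul]
    · ring
    · rw [image_eq_zero_of_notMem_tsupport fun h => Set.disjoint_left.1 (hUd i j hi)
        (hθU i h).1 (hQU j hm), zero_smul]
  · intro m hm
    have h1 : ∀ᶠ z in 𝓝 m, β z = 1 :=
      hβ1.filter_mono (nhds_le_nhdsSet (show m ∈ {m | p m = 0} from hm))
    have h2 : ∀ᶠ z in 𝓝 m, ∀ j, θ j z = 0 ∨ (G j z).re = G₀ z := by
      rw [Filter.eventually_all]
      intro j
      by_cases hmj : m ∈ tsupport (θ j)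
      · have hmO : m ∈ O j := (hθU j hmj).2.resolve_right fun h => h hm
        filter_upwards [(hO j).mem_nhds hmO] with z hz
        exact Or.inr (hGO j z hz).symm
      · filter_upwards [(isClosed_tsupport (θ j)).isOpen_compl.mem_nhds hmj] with z hz
        exact Or.inl (image_eq_zero_of_notMem_tsupport hz)
    filter_upwards [h1, h2] with z hz1 hz2
    have h3 : ∀ j, (θ j z • (G j z - β z • (G₀ z : ℂ))).re = 0 := by
      intro j
      rcases hz2 j with h | h
      · rw [h, zero_smul, Complex.zero_re]
      · rw [hz1, one_smul, Complex.smul_re, Complex.sub_re, Complex.ofReal_re, h, sub_self, smul_zero]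
    show (β z • (G₀ z : ℂ) + ∑ j, θ j z • (G j z - β z • (G₀ z : ℂ))).re = G₀ z
    rw [Complex.add_re, Complex.re_sum, Finset.sum_eq_zero fun j _ => h3 j, add_zero, hz1, one_smul,
      Complex.ofReal_re]

end Final

/-! ### Signs on components and lower bounds -/

section Sign

variable {M : Type*} [TopologicalSpace M] [ChartedSpace Plane M] [IsManifold 𝓘(ℝ, Plane) ω M]
variable {L : ℕ} {p : Cotangent M → ℝ} {Φ : Cotangent M → ℝ} {R : Fin L → ℝ}
  {Ψ : Fin L → Plane × Plane → Cotangent M}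

/-- A function without zeros on the energy surface outside the collar, and without zeros on a thick
energy shell outside `W`, has on the thickened components the sign it has on the faces of the
collar. -/
theorem pos_of_mem_thickened (hΦ : Continuous Φ) {s δ η : ℝ} {W : Set (Cotangent M)}
    (hX : ∀ m ∈ {m | p m = 0} \ collar p R Ψ δ, Φ m ≠ 0)
    (hface : ∀ j, ∀ x ξ : Plane, ‖ξ‖ < R j → ξ 0 = s * δ → p (Ψ j (x, ξ)) = 0 →
      0 < s * Φ (Ψ j (x, ξ)))
    (hW : ∀ m ∈ {m | |p m| < η} \ W, Φ m ≠ 0) {ρ : Cotangent M}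
    (hρ : ρ ∈ thickened p W (omegaPart p R Ψ s δ) η) (hs : s ≠ 0) : 0 < s * Φ ρ := by
  obtain ⟨ρ', ⟨j, x, ξ, hξ, hξ0, hmem, hρ'⟩, hρ'W, hρ⟩ := hρ
  have hcont : Continuous fun m => s * Φ m := continuous_const.mul hΦ
  -- The sign travels in two stages: from the face to ρ' within the energy surface, then from ρ' to
  -- ρ within the thick shell outside W.
  have h1 : 0 < s * Φ ρ' := pos_of_isPreconnected isPreconnected_connectedComponentIn
    hcont.continuousOn
    (fun m hm => mul_ne_zero hs (hX m (connectedComponentIn_subset _ _ hm)))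
    (mem_connectedComponentIn hmem) hρ' (hface j x ξ hξ hξ0 hmem.1)
  exact pos_of_isPreconnected isPreconnected_connectedComponentIn hcont.continuousOn
    (fun m hm => mul_ne_zero hs (hW m (connectedComponentIn_subset _ _ hm)))
    (mem_connectedComponentIn hρ'W) hρ h1

/-- A continuous function without zeros on the energy surface outside an open set is bounded away
from `0` on an energy shell outside this set. -/
theorem exists_le_abs_of_ne_zero (hp : Continuous p) (hΦ : Continuous Φ)
    (hc : ∃ c : ℝ, 0 < c ∧ IsCompact {m | |p m| ≤ c}) {W : Set (Cotangent M)} (hW : IsOpen W)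
    (h0 : ∀ m, p m = 0 → m ∉ W → Φ m ≠ 0) :
    ∃ μ : ℝ, 0 < μ ∧ ∀ m, |p m| < μ → m ∉ W → μ ≤ |Φ m| := by
  obtain ⟨c, hc, hcpt⟩ := hc
  rcases ({m | |p m| ≤ c} \ W).eq_empty_or_nonempty with he | hne
  · refine ⟨c, hc, fun m hm hmW => ?_⟩
    have : m ∈ {m | |p m| ≤ c} \ W := ⟨hm.le, hmW⟩
    rw [he] at this
    exact absurd this (Set.notMem_empty m)
  -- The function max(|p|, |Φ|) is positive on this compact set. Where |p| is below its minimum, |Φ|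
  -- must reach it.
  · obtain ⟨m₀, hm₀, hmin⟩ := (hcpt.diff hW).exists_isMinOn hne
      (hp.abs.max hΦ.abs).continuousOn
    have hν : 0 < max |p m₀| |Φ m₀| := by
      by_cases h : p m₀ = 0
      · exact lt_max_of_lt_right (abs_pos.2 (h0 m₀ h hm₀.2))
      · exact lt_max_of_lt_left (abs_pos.2 h)
    refine ⟨min c (max |p m₀| |Φ m₀|), lt_min hc hν, fun m hm hmW => ?_⟩
    have h1 : max |p m₀| |Φ m₀| ≤ max |p m| |Φ m| :=
      hmin (show m ∈ {m | |p m| ≤ c} \ W from ⟨(hm.trans_le (min_le_left _ _)).le, hmW⟩)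
    rcases le_max_iff.1 h1 with h2 | h2
    · exact absurd (hm.trans_le (min_le_right _ _)) (not_lt.2 h2)
    · exact (min_le_right _ _).trans h2

end Sign

end
end GlobalWeight

/-! ### The proposition -/

open GlobalWeight in
theorem proposition2p3
    {M : Type*} [TopologicalSpace M] [T2Space M] [SecondCountableTopology M]
    [ChartedSpace Plane M] [IsManifold 𝓘(ℝ, Plane) ω M]
    -- the symbols `p` (real) and `q` (complex), and the energy surface `p = 0`
    (p : Cotangent M → ℝ) (q : Cotangent M → ℂ)
    (hp : ContMDiff phaseModel 𝓘(ℝ, ℝ) ω p) (hq : ContMDiff phaseModel 𝓘(ℝ, ℂ) ω q)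
    (hp_elliptic : ∃ c : ℝ, 0 < c ∧ IsCompact {m | |p m| ≤ c})
    (hp_connected : IsConnected {m | p m = 0})
    (hp_regular : ∀ m, p m = 0 → differential p m ≠ 0)
    -- the kernel of the flow averages
    (K : ℝ → ℝ) (hK : ContDiff ℝ ∞ K) (hK_supp : HasCompactSupport K) (hK_nonneg : ∀ t, 0 ≤ K t)
    (hK_int : ∫ t, K t = 1)
    -- the invariant Diophantine tori, and the common mean value of `q` over them
    {L : ℕ} (a : Fin L → Plane) (γ : Fin L → Plane → Cotangent M)
    (hγ : ∀ j, IsInvariantTorus p (a j) (γ j)) (ha : ∀ j, Diophantine (a j))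
    (hγ_disjoint : ∀ i j, i ≠ j → Disjoint (Set.range (γ i)) (Set.range (γ j)))
    (F : ℂ) (hF : ∀ j, torusMean (fun x => q (γ j x)) = F)
    -- the smooth canonical transformations `κ_{∞,j}`
    (R : Fin L → ℝ) (Ψ : Fin L → Plane × Plane → Cotangent M) (pInf : Fin L → Plane → ℝ)
    (hΨ : ∀ j, IsCanonicalTube ∞ (γ j) (R j) (Ψ j))
    (hΨ_normal : ∀ j, ∀ N : ℕ, IsNormalForm ∞ p (a j) (R j) (Ψ j) (pInf j) N)
    (hΨ_graph : ∀ j, IsEnergyGraph p (R j) (Ψ j))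
    -- the linear independence condition and the global dynamical assumption
    (hindep : ∀ j, LinearIndependent ℝ
      ![fderiv ℝ (pInf j) 0, fderiv ℝ (fun ξ => (torusAverage q (Ψ j) ξ).re) 0])
    (hglobal : GlobalAssumption p q F K R Ψ) :
    ∃ N₀ : ℕ, ∀ N : ℕ, N₀ ≤ N →
      -- the analytic canonical transformations `κ_{N,j}` and the local solutions `G_j`
      ∀ (RN : Fin L → ℝ) (ΨN : Fin L → Plane × Plane → Cotangent M) (pN : Fin L → Plane → ℝ)
        (G : Fin L → Cotangent M → ℂ),
      (∀ j, IsCanonicalTube ω (γ j) (RN j) (ΨN j)) →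
      (∀ j, IsNormalForm ω p (a j) (RN j) (ΨN j) (pN j) N) →
      (∀ j, IsLocalSolution p q (ΨN j) N (G j)) →
      ∃ r₀ : ℝ, 0 < r₀ ∧ ∀ r : ℝ, 0 < r → r ≤ r₀ →
      ∃ δ₁ : ℝ, 0 < δ₁ ∧ ∀ δ₀ : ℝ, 0 < δ₀ → δ₀ ≤ δ₁ →
      ∃ Gt : Cotangent M → ℂ,
        ContMDiff phaseModel 𝓘(ℝ, ℂ) ∞ Gt ∧ HasCompactSupport Gt ∧
        (∀ j, ∀ ρ ∈ torusNhd (ΨN j) r δ₀, Gt ρ = G j ρ) ∧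
        ∃ C : ℝ, 0 < C ∧ ∃ η₀ : ℝ, 0 < η₀ ∧ ∀ η : ℝ, 0 < η → η ≤ η₀ →
          (∀ ρ ∈ thickened p (⋃ j, torusNhd (ΨN j) r δ₀) (omegaPart p R Ψ 1 δ₀) η,
            1 / C ≤ (q ρ - hamiltonDeriv p Gt ρ - F).re) ∧
          (∀ ρ ∈ thickened p (⋃ j, torusNhd (ΨN j) r δ₀) (omegaPart p R Ψ (-1) δ₀) η,
            (q ρ - hamiltonDeriv p Gt ρ - F).re ≤ -1 / C) := by
  -- Only first order expansions at the tori matter, so N ≥ 2 suffices.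
  refine ⟨2, fun N hN2 RN ΨN pN G hTN hNN hG => ?_⟩
  have hp' : ContMDiff phaseModel 𝓘(ℝ, ℝ) ∞ p := hp.of_le le_top
  have hq' : ContMDiff phaseModel 𝓘(ℝ, ℂ) ∞ q := hq.of_le le_top
  -- Without tori there are no faces, so Ω_± are empty.
  rcases isEmpty_or_nonempty (Fin L) with hL | hL
  · refine ⟨1, one_pos, fun r _ _ => ⟨1, one_pos, fun δ₀ _ _ => ⟨0, contMDiff_const,
      HasCompactSupport.zero, fun j => hL.elim j, 1, one_pos, 1, one_pos, fun η _ _ =>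
      ⟨?_, ?_⟩⟩⟩⟩
    all_goals
      rintro ρ ⟨ρ', ⟨j, -⟩, -⟩
      exact hL.elim j
  have hT' : ∀ j, IsCanonicalTube ∞ (γ j) (RN j) (ΨN j) := fun j => (hTN j).of_le le_top
  -- collar charts with disjoint domains
  have hcpt : ∀ j, IsCompact (Set.range (γ j)) := fun j => by
    have h1 : Set.range (γ j) = γ j '' torusCube := by
      refine Set.Subset.antisymm ?_ (Set.image_subset_range _ _)
      rintro _ ⟨x, rfl⟩
      obtain ⟨y, hy, hxy⟩ := exists_sameTorusPoint x
      exact ⟨y, hy, (((hγ j).eq_iff x y).2 hxy).symm⟩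
    rw [h1]
    exact isCompact_torusCube.image (hγ j).analytic.continuous
  obtain ⟨D, hD, hγD, hDd⟩ := exists_disjoint_open_nhds hcpt hγ_disjoint
  have hchart := fun j => exists_collarChart (hΨ j) (hT' j) hp' hq' (ha j) (hΨ_normal j) (hF j)
    (hΨ_graph j) (hindep j) hN2 (hG j) (hD j) fun x => hγD j ⟨x, rfl⟩
  choose U y c s₀ hUD hc0 hGU hch using hchart
  have hUd : ∀ i j, i ≠ j → Disjoint (U i) (U j) := fun i j hij =>
    (hDd i j hij).mono (hUD i) (hUD j)
  obtain ⟨G₀, hG₀, ⟨O, hO⟩, hne, ε, hε, hεs, hsign⟩ := exists_global_weight hch hUd hc0 hL hp' hq'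
    hp_elliptic hp_connected.isPreconnected hK.continuous hK_supp hK_nonneg hK_int hglobal
  -- the radius of the tubes
  have hrad : ∀ j, ∃ ρ, 0 < ρ ∧ ρ < RN j ∧ (∀ z : Plane × Plane, ‖z.2‖ ≤ ρ → ΨN j z ∈ U j) ∧
      ∀ x ξ : Plane, ‖ξ‖ ≤ ρ → ξ 0 = 0 → p (ΨN j (x, ξ)) = 0 → ξ = 0 := by
    intro j
    obtain ⟨ρ₁, h1, h2, h3⟩ := (hT' j).exists_image_subset (hch j).isOpen
      fun x => ((hch j).torus_mem x).1
    obtain ⟨ρ₂, h4, h5⟩ := (hNN j).exists_radius (by omega) (ha j).snd_ne_zero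
    exact ⟨min ρ₁ ρ₂, lt_min h1 h4, (min_le_left _ _).trans_lt h2,
      fun z hz => h3 z (hz.trans (min_le_left _ _)),
      fun x ξ hξ => h5 x ξ (hξ.trans (min_le_right _ _))⟩
  choose ρ hρ hρR hρU hρs using hrad
  obtain ⟨r₀, hr₀, hr₀ρ⟩ := exists_pos_forall_le hρ
  refine ⟨r₀, hr₀, fun r hr hrr₀ => ?_⟩
  have hrρ : ∀ j, r ≤ ρ j := fun j => hrr₀.trans (hr₀ρ j)
  have hrR : ∀ j, r < RN j := fun j => (hrρ j).trans_lt (hρR j)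
  have hshell := fun j => (hT' j).exists_shell_subset hp.continuous (hrR j)
    (fun x ξ hξ => hρs j x ξ (hξ.trans (hrρ j))) (hO j).1 (hO j).2.2.1
  choose d hd hdO using hshell
  obtain ⟨d₁, hd₁, hd₁d⟩ := exists_pos_forall_le hd
  -- Below ε the weight has the sign of y on the faces y = ±δ₀; below d₁ the energy surface inside
  -- the closed shells lies where G₀ = Re G_j.
  refine ⟨min ε d₁, lt_min hε hd₁, fun δ₀ hδ₀ hδ₀₁ => ?_⟩
  have hδε : δ₀ ≤ ε := hδ₀₁.trans (min_le_left _ _)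
  have hδs : ∀ j, δ₀ < s₀ j := fun j => hδε.trans_lt (hεs j)
  have hδd : ∀ j, δ₀ ≤ d j := fun j => (hδ₀₁.trans (min_le_right _ _)).trans (hd₁d j)
  have hX : IsCompact {m | p m = 0} := by
    obtain ⟨c', hc', hcpt'⟩ := hp_elliptic
    refine hcpt'.of_isClosed_subset (isClosed_eq hp.continuous continuous_const) fun m hm => ?_
    have hm' : p m = 0 := hm
    show |p m| ≤ c'
    rw [hm', abs_zero]
    exact hc'.le
  obtain ⟨Gt, hGt, hGts, hGtQ, hGtG₀⟩ := exists_compact_weight (p := p)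
    (Q := fun j => closedShell (ΨN j) r δ₀) (U := U) (O := O) (G := G) (G₀ := G₀)
    hp.continuous hX (fun j => (hT' j).isCompact_closedShell (hrR j) δ₀) (fun j => (hch j).isOpen)
    hUd
    (by
      rintro j _ ⟨z, ⟨hz, -⟩, rfl⟩
      exact hρU j z (hz.trans (hrρ j)))
    (fun j => (hO j).1)
    (by
      rintro j _ ⟨z, ⟨hz, hz'⟩, rfl⟩ hpz
      exact hdO j _ ⟨z, ⟨hz, hz'.trans (hδd j)⟩, rfl⟩ hpz)
    hGU hG₀ fun j => (hO j).2.2.2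
  refine ⟨Gt, hGt, hGts, ?_, ?_⟩
  · rintro j _ ⟨x, ξ, hξ, hξ0, rfl⟩
    exact hGtQ j _ ⟨(x, ξ), ⟨hξ.le, hξ0.le⟩, rfl⟩
  -- the weight `Re (q - H_p Gt - F)`
  set W : Set (Cotangent M) := ⋃ j, torusNhd (ΨN j) r δ₀ with hWdef
  have hW : IsOpen W := isOpen_iUnion fun j => (hT' j).isOpen_torusNhd (hrR j).le δ₀
  have hγW : ∀ j x, γ j x ∈ W := fun j x => Set.mem_iUnion.2
    ⟨j, x, 0, by simpa using hr, by simpa using hδ₀, (hT' j).zero_section x⟩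
  let Φ : Cotangent M → ℝ := fun m => (q m - hamiltonDeriv p Gt m - F).re
  have hΦeq : ∀ m, Φ m = (q m).re - modelDeriv (fun m => (Gt m).re) m (hamiltonVec p m) - F.re := by
    intro m
    show (q m - hamiltonDeriv p Gt m - F).re = _
    rw [Complex.sub_re, Complex.sub_re, hamiltonDeriv_eq,
      modelDeriv_re (hGt.mdifferentiable (by simp) m)]
  have hΦ : Continuous Φ := by
    rw [show Φ = fun m => (q m).re - modelDeriv (fun m => (Gt m).re) m (hamiltonVec p m) - F.re
      from funext hΦeq]
    exact ((Complex.continuous_re.comp hq.continuous).sub (continuous_modelDeriv_hamiltonVec hp'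
      ((Complex.reCLM.contDiff.contMDiff (n := ∞)).comp hGt))).sub continuous_const
  have hΦ₀ : ∀ m, p m = 0 → Φ m = (q m).re - F.re - modelDeriv G₀ m (hamiltonVec p m) := by
    intro m hm
    rw [hΦeq, modelDeriv_congr (hGtG₀ m hm)]
    ring
  have hΦne : ∀ m, p m = 0 → (∀ j x, γ j x ≠ m) → Φ m ≠ 0 := fun m hm hγm => by
    rw [hΦ₀ m hm]
    exact hne m hm hγm
  -- The same μ serves as η₀ and as 1/C.
  obtain ⟨μ, hμ, hμΦ⟩ := exists_le_abs_of_ne_zero hp.continuous hΦ hp_elliptic hW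
    fun m hm hmW => hΦne m hm fun j x hx => hmW (hx ▸ hγW j x)
  have hface : ∀ s : ℝ, (s = 1 ∨ s = -1) → ∀ j, ∀ x ξ : Plane, ‖ξ‖ < R j → ξ 0 = s * δ₀ →
      p (Ψ j (x, ξ)) = 0 → 0 < s * Φ (Ψ j (x, ξ)) := by
    intro s hs j x ξ hξ hξ0 hpξ
    have habs : |ξ 0| = δ₀ := by
      rcases hs with rfl | rfl
      · rw [hξ0, one_mul, abs_of_pos hδ₀]
      · rw [hξ0, neg_one_mul, abs_neg, abs_of_pos hδ₀]
    obtain ⟨h1, h2⟩ := (hch j).mem x ξ hξ (habs.trans_lt (hδs j)) hpξ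
    have h3 := hsign j _ h1 hpξ (by rw [h2, habs]; exact hδε)
      (by rw [h2]; exact abs_pos.1 (habs ▸ hδ₀))
    rw [h2, hξ0, ← hΦ₀ _ hpξ] at h3
    have h4 : 0 < δ₀ * (s * Φ (Ψ j (x, ξ))) := by linarith
    exact pos_of_mul_pos_right h4 hδ₀.le
  have hcol : ∀ m ∈ {m | p m = 0} \ collar p R Ψ δ₀, Φ m ≠ 0 := by
    rintro m ⟨hm, hmc⟩
    refine hΦne m hm fun j x hx => hmc ?_
    rw [← hx, ← (hΨ j).zero_section x]
    refine ⟨?_, j, x, 0, by simpa using (hΨ j).radius_pos, by simpa using hδ₀, rfl⟩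
    rw [(hΨ j).zero_section x]
    exact (hγ j).energy x
  have hpos : ∀ s : ℝ, (s = 1 ∨ s = -1) → ∀ η ≤ μ, ∀ m ∈ thickened p W (omegaPart p R Ψ s δ₀) η,
      0 < s * Φ m ∧ μ ≤ |Φ m| := by
    intro s hs η hη m hm
    refine ⟨pos_of_mem_thickened hΦ hcol (hface s hs) (fun m hm => ?_) hm (by
      rcases hs with rfl | rfl <;> norm_num), ?_⟩
    · exact abs_pos.1 (hμ.trans_le (hμΦ m (lt_of_lt_of_le hm.1 hη) hm.2))
    · obtain ⟨ρ', -, -, hmem⟩ := hm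
      have := connectedComponentIn_subset _ _ hmem
      exact hμΦ m (lt_of_lt_of_le this.1 hη) this.2
  refine ⟨1 / μ, by positivity, μ, hμ, fun η _ hη => ⟨fun m hm => ?_, fun m hm => ?_⟩⟩
  · obtain ⟨h1, h2⟩ := hpos 1 (Or.inl rfl) η hη m hm
    rw [one_mul] at h1
    rw [abs_of_pos h1] at h2
    rw [one_div_one_div]
    exact h2
  · obtain ⟨h1, h2⟩ := hpos (-1) (Or.inr rfl) η hη m hm
    rw [neg_one_mul, neg_pos] at h1
    rw [abs_of_neg h1] at h2
    rw [neg_div, one_div_one_div]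
    show Φ m ≤ -μ
    linarith
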